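/- **Setting.** Let $\mathbb S^3=\{y\in\mathbb R^4:|y|^2=9\}$ with the induced round metric $\mathring g$ (scalar curvature $2/3$). For $1\le k<l\le 4$ put $\Omega_{kl}=\frac13(y^k\partial_{y^l}-y^l\partial_{y^k})$, and let $\mathscr Z=\{Z_{(1)},Z_{(2)},Z_{(3)}\}$ be the global $\mathring g$-orthonormal frame $Z_{(1)}=\Omega_{12}+\Omega_{34}$, $Z_{(2)}=\Omega_{23}+\Omega_{14}$, $Z_{(3)}=\Omega_{13}-\Omega_{24}$, extended to $[0,T)\times\mathbb S^3$ independently of $t$. For $\vec I=(i_1,\dots,i_N)\in\{1,2,3\}^N$ write $|\vec I|=N$ and $\mathcal L_{\mathscr Z}^{\vec I}=\mathcal L_{Z_{(i_1)}}\cdots\mathcal L_{Z_{(i_N)}}$ (Lie derivatives on $\Sigma_t=\{t\}\times\mathbb S^3$; for functions write $\mathscr Z^{\vec I}$). $\mathcal L_{\partial_t}$ denotes the $\Sigma_t$-projected Lie derivative, i.e. the $t$-derivative of the components with respect to a $t$-independent frame (one-sided at $t=0$). Let $a$ be the solution of $a''=-\frac23a^{1/3}$, $a(0)=1$, $a'(0)=0$,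 and let $T>0$ be such that $a>0$ on $[0,T)$. Put $\mathcal H=a'/a$. **Solutions.** Let $(g,k,n,\phi)$ be a classical solution on $[0,T)\times\mathbb S^3$ of the Einstein-scalar field equations for the space-time metric $-n^2dt^2+g$ in constant-mean-curvature-transported spatial coordinates gauge: $g$ is a Riemannian metric on each $\Sigma_t$, $k=k^i{}_j$ is the second fundamental form in mixed form, $n>0$; $g,\phi$ are $C^{17}$, $k$ is $C^{16}$, $n$ is $C^{18}$; and, with $\hat k$ the trace-free part of $k$ and $\nabla$, $\mathrm{Ric}[g]$, $R[g]$ the connection and curvatures of $g$ (positive on round spheres), indices being moved with $g$, $$k^a{}_a=-\mathcal H,\qquad R[g]-k^a{}_bk^b{}_a+\mathcal H^2=(n^{-1}\partial_t\phi)^2+\nabla^a\phi\nabla_a\phi,\qquad \nabla_a\hat k^a{}_i=-n^{-1}\partial_t\phi\,\nabla_i\phi,$$ $$\partial_tg_{ij}=-2n\,g_{ia}k^a{}_j,\qquad \partial_tk^i{}_j=-\nabla^i\nabla_jn+n\{\mathrm{Ric}[g]^i{}_j-\mathcal Hk^i{}_j-\nabla^i\phi\nabla_j\phi\},$$ $$-n^{-1}\partial_t(n^{-1}\partial_t\phi)+\nabla^a\nabla_a\phi=\mathcal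 Hn^{-1}\partial_t\phi-n^{-1}\nabla^an\nabla_a\phi,$$ $$\nabla^a\nabla_an=\mathcal H'+n\{\hat k^a{}_b\hat k^b{}_a+\tfrac13\mathcal H^2+(n^{-1}\partial_t\phi)^2\}.$$ **Rescaled variables.** $G=a^{-2/3}g$, $K=a\hat k$ (type $\binom11$), $\nu=a^{-4/3}(n-1)$, $\Psi=n^{-1}a\,\partial_t\phi-\sqrt{2/3}$, $\omega=\nabla\phi$ (the spatial one-form $d\phi|_{\Sigma_t}$); $\mathrm{Ric}^\#$ is the Ricci tensor of $G$ with one index raised by $G^{-1}$, and $\mathrm{Id}$ the identity. **Norms.** For $h\in\{\mathring g,G\}$ let $|\xi|_h$ be the pointwise norm of a tensor and $\|\xi\|_{C^0_h(\Sigma_t)}=\sup_{\Sigma_t}|\xi|_h$. Put $\|\mathcal L_{\mathscr Z}^{\le M}\xi\|_{C_h^0}=\sum_{|\vec I|\le M}\sup_{\Sigma_t}|\mathcal L^{\vec I}_{\mathscr Z}\xi|_h$, $\|\mathcal L_{\mathscr Z}^{[1,M]}\xi\|_{C_h^0}=\sum_{1\le|\vec I|\le M}\sup_{\Sigma_t}|\mathcal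 L^{\vec I}_{\mathscr Z}\xi|_h$, $\|\mathcal L_{\partial_t}\mathcal L_{\mathscr Z}^{\le M}\xi\|_{C_h^0}=\sum_{|\vec I|\le M}\sup_{\Sigma_t}|\mathcal L_{\partial_t}\mathcal L^{\vec I}_{\mathscr Z}\xi|_h$. Further, with the volume measure of $\mathring g$, $\|\xi\|_{H^M}^2=\sum_{|\vec I|\le M}\big\||\mathcal L^{\vec I}_{\mathscr Z}\xi|_{\mathring g}\big\|_{L^2}^2$, $\|\xi\|_{\dot H^M}^2$ is the same sum over $|\vec I|=M$, and $\|\xi\|_{C^M}^2=\sum_{|\vec I|\le M}\sup|\mathcal L^{\vec I}_{\mathscr Z}\xi|^2_{\mathring g}$. The solution norm is $$\begin{aligned}\mathcal N(t)=\;&\|K\|_{H^{16}}+a^{2/3}\|G\|_{\dot H^{17}}+\|G-\mathring g\|_{H^{16}}+\|G^{-1}-\mathring g^{-1}\|_{H^{16}}+\sum_{L=1}^4a^{2L/3}\|\nu\|_{\dot H^{14+L}}+\|\nu\|_{H^{14}}\\&+\|\Psi\|_{H^{16}}+a^{2/3}\|\omega\|_{H^{16}}+\|\omega\|_{H^{15}}+\|K\|_{C^{14}}+\|G-\mathring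 g\|_{C^{14}}+\|G^{-1}-\mathring g^{-1}\|_{C^{14}}\\&+\|\nu\|_{C^{12}}+\|\Psi\|_{C^{14}}+\|\omega\|_{C^{13}},\end{aligned}$$ all evaluated on $\Sigma_t$. **Proposition (strong sup-norm estimates).** There are constants $\varepsilon_0,\sigma_0,C,c>0$ such that the following holds whenever $0<\varepsilon\le\varepsilon_0$ and $\sqrt\varepsilon\le\sigma\le\sigma_0$, for all $T$ and all solutions as above (the constants do not depend on $\varepsilon$, $\sigma$, $T$ or the solution). If $\mathcal N(0)\le\varepsilon^2$ and $\mathcal N(t)\le\varepsilon a^{-\sigma}(t)$ for all $t\in[0,T)$, then for all $t\in[0,T)$, all norms being taken on $\Sigma_t$ and $a=a(t)$: 1. $\|\mathcal L_{\mathscr Z}^{\le10}(G-\mathring g)\|_{C^0_{\mathring g}}\le C\sqrt\varepsilon\,a^{-c\sqrt\varepsilon}$; 2. $\|\mathcal L_{\mathscr Z}^{\le10}(G^{-1}-\mathring g^{-1})\|_{C^0_{\mathring g}}\le C\sqrt\varepsilon\,a^{-c\sqrt\varepsilon}$; 3. $\|\mathcal L_{\mathscr Z}^{\le10}(G-\mathring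 g)\|_{C^0_{G}}\le C\sqrt\varepsilon\,a^{-c\sqrt\varepsilon}$; 4. $\|\mathcal L_{\mathscr Z}^{\le10}(G^{-1}-\mathring g^{-1})\|_{C^0_{G}}\le C\sqrt\varepsilon\,a^{-c\sqrt\varepsilon}$; 5. $\|\mathcal L_{\partial_t}G\|_{C^0_G}\le C\varepsilon a^{-1}$; 6. $\|\mathcal L_{\partial_t}G^{-1}\|_{C^0_G}\le C\varepsilon a^{-1}$; 7. $\|\mathcal L_{\mathscr Z}^{\le10}K\|_{C^0_{\mathring g}}\le C\varepsilon$; 8. $\|\mathcal L_{\partial_t}\mathcal L_{\mathscr Z}^{\le10}K\|_{C^0_{\mathring g}}\le C\varepsilon a^{1/3-c\sigma}$; 9. $\|K\|_{C^0_G}\le C\varepsilon$; 10. $\|\mathcal L_{\mathscr Z}^{[1,10]}K\|_{C^0_G}\le C\varepsilon a^{-c\sqrt\varepsilon}$; 11. $\|\mathscr Z^{\le10}\Psi\|_{C^0}\le C\varepsilon$; 12. $\|\partial_t\mathscr Z^{\le10}\Psi\|_{C^0}\le C\varepsilon a^{1/3-c\sigma}$; 13. $\|\mathcal L_{\mathscr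 Z}^{\le9}\omega\|_{C^0_G}\le C\sqrt\varepsilon\,a^{-c\sqrt\varepsilon}$; 14. $\|\mathscr Z^{\le8}\nu\|_{C^0}\le C\sqrt\varepsilon\,a^{-c\sqrt\varepsilon}$; 15. $\|\mathcal L_{\mathscr Z}^{\le8}\{\mathrm{Ric}^\#-\tfrac29\mathrm{Id}\}\|_{C^0_G}\le C\sqrt\varepsilon\,a^{-c\sqrt\varepsilon}$. -/

import Mathlib

open Set MeasureTheory

namespace EinsteinScalar

noncomputable section

/-! ### The three-sphere of radius `3` and its rotation frame -/

/-- The ambient Euclidean space `ℝ⁴`, with coordinates `y 0, y 1, y 2, y 3`. -/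
abbrev E4 : Type := EuclideanSpace ℝ (Fin 4)

/-- The sphere `{y ∈ ℝ⁴ : |y|² = 9}`; the metric induced by `ℝ⁴` has scalar curvature `2/3`. -/
abbrev S3 : Type := Metric.sphere (0 : E4) 3

/-- The point `3 • ω` of the sphere of radius `3`, for `ω` on the unit sphere. -/
def tripleUnit (ω : Metric.sphere (0 : E4) 1) : S3 :=
  ⟨(3 : ℝ) • (ω : E4), by
    have h : ‖(ω : E4)‖ = 1 := by simp
    simp [norm_smul, h]⟩

/-- The volume measure of the round metric of radius `3`: the push-forward of `3³` times the
surface measure of the unit sphere. -/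
def roundVolume : Measure S3 :=
  (27 : ENNReal) • ((volume : Measure E4).toSphere.map tripleUnit)

/-- The radial projection `y ↦ 3 y / |y|` of `ℝ⁴ \ {0}` to the sphere (an arbitrary value at
the origin, which plays no role). -/
def radial (y : E4) : S3 :=
  if h : y = 0 then
    ⟨EuclideanSpace.single 0 3, by simp⟩
  else
    ⟨(3 / ‖y‖) • y, by
      have h' : ‖y‖ ≠ 0 := norm_ne_zero_iff.mpr h
      simp [norm_smul, h']⟩

/-- The rotation vector field `(1/3) (yᵏ ∂_l - yˡ ∂_k)`. -/
def Rot (k l : Fin 4) (y : E4) : E4 :=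
  (1 / 3 : ℝ) • (y k • EuclideanSpace.single l (1 : ℝ) - y l • EuclideanSpace.single k (1 : ℝ))

/-- The frame `Z₁ = Ω₁₂ + Ω₃₄`, `Z₂ = Ω₂₃ + Ω₁₄`, `Z₃ = Ω₁₃ - Ω₂₄` (indices shifted by one). -/
def Z (A : Fin 3) (y : E4) : E4 :=
  ![Rot 0 1 y + Rot 2 3 y, Rot 1 2 y + Rot 0 3 y, Rot 0 2 y - Rot 1 3 y] A

/-- The totally antisymmetric symbol with `ε₁₂₃ = 1`. -/
def eps (A B C : Fin 3) : ℝ :=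
  (((B : ℕ) : ℝ) - ((A : ℕ) : ℝ)) * (((C : ℕ) : ℝ) - ((B : ℕ) : ℝ)) *
    (((C : ℕ) : ℝ) - ((A : ℕ) : ℝ)) / 2

/-- The structure constants of the frame, `[Z_A, Z_B] = ∑ C, structConst A B C • Z_C`;
see `lieBracket_Z`. -/
def structConst (A B C : Fin 3) : ℝ := (2 / 3) * eps A B C

/-- The frame is tangent to the sphere. -/
theorem inner_self_Z (A : Fin 3) (y : E4) : inner ℝ y (Z A y) = 0 := by
  fin_cases A <;> simp [Z, Rot, PiLp.inner_apply, Fin.sum_univ_four] <;> ring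

/-- The frame is orthonormal for the round metric, so that in this frame the round metric and
its inverse both have the identity matrix as matrix of components. -/
theorem inner_Z_Z (A B : Fin 3) (p : S3) :
    inner ℝ (Z A (p : E4)) (Z B (p : E4)) = if A = B then 1 else 0 := by
  have hp : ‖(p : E4)‖ = 3 := by simp
  have h9 : (p : E4) 0 ^ 2 + (p : E4) 1 ^ 2 + (p : E4) 2 ^ 2 + (p : E4) 3 ^ 2 = 9 := by
    have := EuclideanSpace.norm_sq_eq (p : E4)
    rw [hp, Fin.sum_univ_four] at this
    simp only [Real.norm_eq_abs, sq_abs] at this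
    linarith
  rw [PiLp.inner_apply, Fin.sum_univ_four]
  fin_cases A <;> fin_cases B <;> simp [Z, Rot] <;>
    first
    | (ring; done)
    | (simp only [mul_pow, sq_abs]; linear_combination (1 / 9 : ℝ) * h9)

/-- The frame fields are linear vector fields on `ℝ⁴`. -/
def ZLin (A : Fin 3) : E4 →ₗ[ℝ] E4 where
  toFun := Z A
  map_add' x y := by
    fin_cases A <;> ext i <;> fin_cases i <;> simp [Z, Rot] <;> ring
  map_smul' r y := by
    fin_cases A <;> ext i <;> fin_cases i <;> simp [Z, Rot] <;> ring

/-- The commutation relations of the frame. -/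
theorem lieBracket_Z (A B : Fin 3) (y : E4) :
    VectorField.lieBracket ℝ (Z A) (Z B) y = ∑ C, structConst A B C • Z C y := by
  have hd : ∀ (A : Fin 3) (y : E4), fderiv ℝ (Z A) y = LinearMap.toContinuousLinearMap (ZLin A) :=
    fun A y => (LinearMap.toContinuousLinearMap (ZLin A)).hasFDerivAt.fderiv
  have hz : ∀ (A : Fin 3) (v : E4), LinearMap.toContinuousLinearMap (ZLin A) v = Z A v :=
    fun _ _ => rfl
  simp only [VectorField.lieBracket, hd, hz]
  fin_cases A <;> fin_cases B <;> ext i <;> fin_cases i <;>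
    simp [Z, Rot, structConst, eps, Fin.sum_univ_three] <;> ring

/-! ### Tensor fields, differentiation, norms

The frame `Z` is global, so a tensor field of type `(l, m)` on the sphere is the family of its
components `ξ^{A₁ ⋯ A_l}_{B₁ ⋯ B_m}` with respect to `Z` and the dual coframe. -/

/-- Tensor fields of type `(l, m)` on the sphere. -/
abbrev Tensor (l m : ℕ) : Type := (Fin l → Fin 3) → (Fin m → Fin 3) → S3 → ℝ

/-- Fields of `3 × 3` matrices of frame components (of a tensor with two indices). -/
abbrev MatrixField : Type := S3 → Matrix (Fin 3) (Fin 3) ℝ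

/-- The scalar function `f` as a tensor field of type `(0, 0)`. -/
def scalarT (f : S3 → ℝ) : Tensor 0 0 := fun _ _ p => f p

/-- The one-form with components `ω_A`. -/
def formT (ω : Fin 3 → S3 → ℝ) : Tensor 0 1 := fun _ B p => ω (B 0) p

/-- The tensor field of type `(0, 2)` with components `h_{AB} = h p A B`. -/
def covT (h : MatrixField) : Tensor 0 2 := fun _ B p => h p (B 0) (B 1)

/-- The tensor field of type `(2, 0)` with components `h^{AB} = h p A B`. -/
def contraT (h : MatrixField) : Tensor 2 0 := fun A _ p => h p (A 0) (A 1)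

/-- The tensor field of type `(1, 1)` with components `k^A_B = k p A B`. -/
def mixedT (k : MatrixField) : Tensor 1 1 := fun A B p => k p (A 0) (B 0)

/-- The derivative `Z_A f` of a function on the sphere. -/
def Zder (A : Fin 3) (f : S3 → ℝ) (p : S3) : ℝ :=
  fderiv ℝ (fun y : E4 => f (radial y)) (p : E4) (Z A (p : E4))

/-- The Lie derivative along `Z_C`, from the Leibniz rule and
`𝓛_{Z_C} Z_B = c_{CB}^D Z_D`, `𝓛_{Z_C} θ^A = - c_{CD}^A θ^D`. -/
def lieZ {l m : ℕ} (C : Fin 3) (ξ : Tensor l m) : Tensor l m := fun A B p =>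
  Zder C (ξ A B) p
    + ∑ i : Fin l, ∑ D : Fin 3, structConst C D (A i) * ξ (Function.update A i D) B p
    - ∑ j : Fin m, ∑ D : Fin 3, structConst C (B j) D * ξ A (Function.update B j D) p

/-- The iterated Lie derivative `𝓛_{Z_{i₁}} ⋯ 𝓛_{Z_{i_N}} ξ`. -/
def lieI {l m N : ℕ} (I : Fin N → Fin 3) (ξ : Tensor l m) : Tensor l m :=
  (List.ofFn I).foldr lieZ ξ

/-- The time derivative (one-sided at `0`) on `[0, T)`. As the frame and coframe do not depend
on `t`, these are the components of the projected Lie derivative along `∂_t`. -/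
def timeDeriv {l m : ℕ} (T : ℝ) (ξ : ℝ → Tensor l m) (t : ℝ) : Tensor l m :=
  fun A B p => derivWithin (fun s => ξ s A B p) (Ico 0 T) t

/-- The pointwise norm `|ξ|_h` at `p`, for a metric `h`. -/
def pnorm {l m : ℕ} (h : MatrixField) (ξ : Tensor l m) (p : S3) : ℝ :=
  Real.sqrt (∑ A : Fin l → Fin 3, ∑ A' : Fin l → Fin 3, ∑ B : Fin m → Fin 3, ∑ B' : Fin m → Fin 3,
    (∏ i, h p (A i) (A' i)) * (∏ j, (h p)⁻¹ (B j) (B' j)) * ξ A B p * ξ A' B' p)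

/-- The sup-norm `sup_p |ξ|_h`. -/
def supNorm {l m : ℕ} (h : MatrixField) (ξ : Tensor l m) : ℝ := ⨆ p : S3, pnorm h ξ p

/-- The round metric, in the orthonormal frame `Z`. -/
def St : MatrixField := fun _ => 1

/-- `(∑ ‖𝓛^I ξ‖²_{L²})^{1/2}`, for the round metric, over the multi-indices with order in `s`. -/
def sobolev {l m : ℕ} (s : Finset ℕ) (ξ : Tensor l m) : ℝ :=
  Real.sqrt (∑ N ∈ s, ∑ I : Fin N → Fin 3, ∫ p, (pnorm St (lieI I ξ) p) ^ 2 ∂roundVolume)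

/-- The norm of `H^M`, for the round metric. -/
def normH {l m : ℕ} (M : ℕ) (ξ : Tensor l m) : ℝ := sobolev (Finset.range (M + 1)) ξ

/-- The homogeneous seminorm of order `M` in `L²`, for the round metric. -/
def normHdot {l m : ℕ} (M : ℕ) (ξ : Tensor l m) : ℝ := sobolev {M} ξ

/-- The norm of `C^M`, for the round metric. -/
def normC {l m : ℕ} (M : ℕ) (ξ : Tensor l m) : ℝ :=
  Real.sqrt (∑ N ∈ Finset.range (M + 1), ∑ I : Fin N → Fin 3, (supNorm St (lieI I ξ)) ^ 2)

/-- `∑ sup_p |𝓛^I ξ|_h` over the multi-indices with order in `s`. -/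
def sumSup {l m : ℕ} (h : MatrixField) (s : Finset ℕ) (ξ : Tensor l m) : ℝ :=
  ∑ N ∈ s, ∑ I : Fin N → Fin 3, supNorm h (lieI I ξ)

/-- `∑ sup_p |∂_t 𝓛^I ξ|_h` over the multi-indices with order in `s`. -/
def sumSupDt {l m : ℕ} (T : ℝ) (h : MatrixField) (s : Finset ℕ) (ξ : ℝ → Tensor l m) (t : ℝ) : ℝ :=
  ∑ N ∈ s, ∑ I : Fin N → Fin 3, supNorm h (timeDeriv T (fun r => lieI I (ξ r)) t)

/-! ### Levi-Civita connection and curvature of a metric `h` with components `h p A B` -/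

/-- `Γ_{ACB} = h(∇_{Z_A} Z_B, Z_C)`, by the Koszul formula. -/
def gammaLow (h : MatrixField) (A C B : Fin 3) (p : S3) : ℝ :=
  (1 / 2) * (Zder A (fun q => h q B C) p + Zder B (fun q => h q A C) p
      - Zder C (fun q => h q A B) p
    + ∑ D, structConst A B D * h p D C
    - ∑ D, structConst A C D * h p D B
    - ∑ D, structConst B C D * h p D A)

/-- The connection coefficients: `∇_{Z_A} Z_B = ∑ D, conn h A D B • Z_D`. -/
def conn (h : MatrixField) (A D B : Fin 3) (p : S3) : ℝ :=
  ∑ C, (h p)⁻¹ C D * gammaLow h A C B p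

/-- The components of the covariant derivative `∇_{Z_C} ξ`. -/
def covD {l m : ℕ} (h : MatrixField) (C : Fin 3) (ξ : Tensor l m) : Tensor l m := fun A B p =>
  Zder C (ξ A B) p
    + ∑ i : Fin l, ∑ D : Fin 3, conn h C (A i) D p * ξ (Function.update A i D) B p
    - ∑ j : Fin m, ∑ D : Fin 3, conn h C D (B j) p * ξ A (Function.update B j D) p

/-- The differential of a function, as a one-form: components `Z_A f`. -/
def dT (f : S3 → ℝ) : Tensor 0 1 := formT (fun A => Zder A f)

/-- The Hessian `∇_A ∇_B f`. -/
def hess (h : MatrixField) (f : S3 → ℝ) (A B : Fin 3) (p : S3) : ℝ :=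
  covD h A (dT f) ![] ![B] p

/-- The Laplacian `∇^A ∇_A f`. -/
def lap (h : MatrixField) (f : S3 → ℝ) (p : S3) : ℝ := ∑ A, ∑ B, (h p)⁻¹ A B * hess h f A B p

/-- `∇^A f ∇_A f'`. -/
def gradInner (h : MatrixField) (f f' : S3 → ℝ) (p : S3) : ℝ :=
  ∑ A, ∑ B, (h p)⁻¹ A B * Zder A f p * Zder B f' p

/-- The curvature `R(Z_A, Z_B) Z_C = ∑ D, curv h A B C D • Z_D`, where
`R(X, Y) W = ∇_X ∇_Y W - ∇_Y ∇_X W - ∇_{[X, Y]} W`. -/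
def curv (h : MatrixField) (A B C D : Fin 3) (p : S3) : ℝ :=
  Zder A (conn h B D C) p - Zder B (conn h A D C) p
    + ∑ F, (conn h B F C p * conn h A D F p - conn h A F C p * conn h B D F p)
    - ∑ F, structConst A B F * conn h F D C p

/-- The Ricci tensor `Ric_{BC}`, the trace of `X ↦ R(X, Z_B) Z_C`
(positive on round spheres). -/
def Ric (h : MatrixField) : MatrixField := fun p => Matrix.of fun B C => ∑ A, curv h A B C A p

/-- The Ricci tensor with the first index raised by `h`, `(Ric^#)^A_B`. -/
def RicSharp (h : MatrixField) : MatrixField := fun p => (h p)⁻¹ * Ric h p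

/-- The scalar curvature. -/
def scalarCurv (h : MatrixField) (p : S3) : ℝ := (RicSharp h p).trace

/-! ### The scale factor and the field equations -/

/-- The derivative of a function of time on `[0, T)` (one-sided at `0`). -/
def dt (T : ℝ) (f : ℝ → ℝ) (t : ℝ) : ℝ := derivWithin f (Ico 0 T) t

/-- `a` is, on `[0, T)`, the solution of `a'' = -(2/3) a^{1/3}`, `a(0) = 1`, `a'(0) = 0`, and it
has not vanished before the time `T`. -/
structure IsScaleFactor (T : ℝ) (a : ℝ → ℝ) : Prop where
  init : a 0 = 1
  init_deriv : dt T a 0 = 0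
  pos : ∀ t ∈ Ico 0 T, 0 < a t
  diff : DifferentiableOn ℝ a (Ico 0 T)
  ode : ∀ t ∈ Ico 0 T, HasDerivWithinAt (dt T a) (-(2 / 3) * a t ^ (1 / 3 : ℝ)) (Ico 0 T) t

/-- The Hubble factor `a' / a`. -/
def hubble (T : ℝ) (a : ℝ → ℝ) (t : ℝ) : ℝ := dt T a t / a t

/-- `u` is of class `C^N` on `[0, T) × S³`. -/
def SlabC (N : ℕ) (T : ℝ) (u : ℝ → S3 → ℝ) : Prop :=
  ContDiffOn ℝ N (fun q : ℝ × E4 => u q.1 (radial q.2)) (Ico 0 T ×ˢ {0}ᶜ)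

/-- The trace-free part of a tensor of type `(1, 1)`. -/
def traceFree (k : MatrixField) : MatrixField := fun p => k p - ((1 / 3 : ℝ) * (k p).trace) • 1

/-- `n⁻¹ ∂_t φ`. -/
def normalDeriv (T : ℝ) (n φ : ℝ → S3 → ℝ) (t : ℝ) (p : S3) : ℝ :=
  (n t p)⁻¹ * dt T (fun s => φ s p) t

/-- Classical solutions on `[0, T) × S³` of the Einstein-scalar field equations in
constant-mean-curvature-transported spatial coordinates gauge, normalized by `tr k = - a'/a`.
Here `g t p A B = g_{AB}` is the metric induced on the slice of time `t`, `k t p A B = k^A_B` its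
second fundamental form in mixed form, `n` the lapse, `φ` the scalar field; the space-time metric is
`-n² dt² + g`. -/
structure IsSolution (T : ℝ) (a : ℝ → ℝ) (g k : ℝ → MatrixField) (n φ : ℝ → S3 → ℝ) : Prop where
  reg_g : ∀ A B, SlabC 17 T (fun t p => g t p A B)
  reg_k : ∀ A B, SlabC 16 T (fun t p => k t p A B)
  reg_n : SlabC 18 T n
  reg_φ : SlabC 17 T φ
  metric : ∀ t ∈ Ico 0 T, ∀ p, (g t p).PosDef
  lapse_pos : ∀ t ∈ Ico 0 T, ∀ p, 0 < n t p
  cmc : ∀ t ∈ Ico 0 T, ∀ p, (k t p).trace = - hubble T a t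
  hamiltonian : ∀ t ∈ Ico 0 T, ∀ p,
    scalarCurv (g t) p - (k t p * k t p).trace + hubble T a t ^ 2
      = normalDeriv T n φ t p ^ 2 + gradInner (g t) (φ t) (φ t) p
  momentum : ∀ t ∈ Ico 0 T, ∀ p, ∀ B,
    ∑ A, covD (g t) A (mixedT (traceFree (k t))) ![A] ![B] p
      = - normalDeriv T n φ t p * Zder B (φ t) p
  evol_g : ∀ t ∈ Ico 0 T, ∀ p, ∀ A B,
    dt T (fun s => g s p A B) t = -2 * n t p * ∑ C, g t p A C * k t p C B
  evol_k : ∀ t ∈ Ico 0 T, ∀ p, ∀ A B,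
    dt T (fun s => k s p A B) t
      = - ∑ C, (g t p)⁻¹ A C * hess (g t) (n t) C B p
        + n t p * (RicSharp (g t) p A B - hubble T a t * k t p A B
          - (∑ C, (g t p)⁻¹ A C * Zder C (φ t) p) * Zder B (φ t) p)
  wave : ∀ t ∈ Ico 0 T, ∀ p,
    - (n t p)⁻¹ * dt T (fun s => normalDeriv T n φ s p) t + lap (g t) (φ t) p
      = hubble T a t * normalDeriv T n φ t p - (n t p)⁻¹ * gradInner (g t) (n t) (φ t) p
  lapse : ∀ t ∈ Ico 0 T, ∀ p,
    lap (g t) (n t) p = dt T (hubble T a) t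
      + n t p * ((traceFree (k t) p * traceFree (k t) p).trace + (1 / 3) * hubble T a t ^ 2
        + normalDeriv T n φ t p ^ 2)

/-! ### The time-rescaled variables and the solution norm -/

/-- The rescaled metric `a^{-2/3} g`. -/
def resMetric (a : ℝ → ℝ) (g : ℝ → MatrixField) (t : ℝ) : MatrixField :=
  fun p => a t ^ (-(2 / 3) : ℝ) • g t p

/-- The inverse of the rescaled metric. -/
def resInv (a : ℝ → ℝ) (g : ℝ → MatrixField) (t : ℝ) : MatrixField := fun p => (resMetric a g t p)⁻¹

/-- The rescaled trace-free part of the second fundamental form, `a` times the trace-free part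
of `k`. -/
def resK (a : ℝ → ℝ) (k : ℝ → MatrixField) (t : ℝ) : MatrixField :=
  fun p => a t • traceFree (k t) p

/-- The rescaled lapse `a^{-4/3} (n - 1)`. -/
def resLapse (a : ℝ → ℝ) (n : ℝ → S3 → ℝ) (t : ℝ) (p : S3) : ℝ :=
  a t ^ (-(4 / 3) : ℝ) * (n t p - 1)

/-- The rescaled time derivative of the scalar field, `n⁻¹ a ∂_t φ - √(2/3)`. -/
def timeScalar (T : ℝ) (a : ℝ → ℝ) (n φ : ℝ → S3 → ℝ) (t : ℝ) (p : S3) : ℝ :=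
  a t * normalDeriv T n φ t p - Real.sqrt (2 / 3)

/-- The solution norm at time `t`. -/
def highNorm (T : ℝ) (a : ℝ → ℝ) (g k : ℝ → MatrixField) (n φ : ℝ → S3 → ℝ) (t : ℝ) : ℝ :=
  normH 16 (mixedT (resK a k t))
  + a t ^ (2 / 3 : ℝ) * normHdot 17 (covT (resMetric a g t))
  + normH 16 (covT (resMetric a g t - St))
  + normH 16 (contraT (resInv a g t - St))
  + ∑ L ∈ Finset.Icc (1 : ℕ) 4,
      a t ^ ((2 / 3 : ℝ) * (L : ℝ)) * normHdot (14 + L) (scalarT (resLapse a n t))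
  + normH 14 (scalarT (resLapse a n t))
  + normH 16 (scalarT (timeScalar T a n φ t))
  + a t ^ (2 / 3 : ℝ) * normH 16 (dT (φ t))
  + normH 15 (dT (φ t))
  + normC 14 (mixedT (resK a k t))
  + normC 14 (covT (resMetric a g t - St))
  + normC 14 (contraT (resInv a g t - St))
  + normC 12 (scalarT (resLapse a n t))
  + normC 14 (scalarT (timeScalar T a n φ t))
  + normC 13 (dT (φ t))

end

end EinsteinScalar

open EinsteinScalar

/-!
The lapse and the curvature enter the equations for `K` and `Ψ` with a factor `a ^ (1 / 3)`, which
absorbs the loss `a ^ (-c σ)` of the bootstrap assumptions. Their rates of change are therefore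
integrable in time, uniformly in the solution, and `K` and `Ψ` stay of size `ε`. Consequently the
metric changes at the rate `ε / a`. In the logarithmic time `t - log a`, whose derivative
dominates `1 / a`, a linear Gronwall argument turns this rate into the loss
`a ^ (-c √ε)`, and the same holds for the gradient of the scalar field. The curvature is controlled
by the metric, and the lapse by the zeroth order term of its elliptic equation. In norms with
respect to `G`, the tensors `K`, `∂ₜ G` and `∂ₜ G⁻¹` do not lose powers of `a`, because they are
`G`-symmetric: the square of such a norm is the trace of the square of an endomorphism.
-/

namespace EinsteinScalar

noncomputable section

/-! ### Functions on the slab `[0, T) × S³` -/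

lemma coe_ne_zero (p : S3) : (p : E4) ≠ 0 :=
  ne_zero_of_mem_sphere three_ne_zero p

lemma radial_of_ne_zero {y : E4} (hy : y ≠ 0) : (radial y : E4) = (3 / ‖y‖) • y := by
  simp [radial, hy]

lemma radial_coe (p : S3) : radial (p : E4) = p := by
  have hp : ‖(p : E4)‖ = 3 := by simp
  exact Subtype.ext (by simp [radial_of_ne_zero (coe_ne_zero p), hp])

lemma contDiffOn_radial {N : WithTop ℕ∞} :
    ContDiffOn ℝ N (fun y : E4 => (radial y : E4)) {0}ᶜ := by
  have h : ContDiffOn ℝ N (fun y : E4 => (3 / ‖y‖) • y) {0}ᶜ := fun y (hy : y ≠ 0) =>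
    ((contDiffAt_const.div (contDiffAt_norm ℝ hy) (norm_ne_zero_iff.mpr hy)).smul
      contDiffAt_id).contDiffWithinAt
  exact h.congr fun y hy => radial_of_ne_zero hy

lemma differentiableAt_radial (p : S3) :
    DifferentiableAt ℝ (fun y : E4 => (radial y : E4)) (p : E4) :=
  (contDiffOn_radial (N := 1)).differentiableOn one_ne_zero _ (coe_ne_zero p)
    |>.differentiableAt (isOpen_compl_singleton.mem_nhds (coe_ne_zero p))

lemma fderiv_radial_apply {p : S3} {v : E4} (hv : inner ℝ (p : E4) v = 0) :
    fderiv ℝ (fun y : E4 => (radial y : E4)) (p : E4) v = v := by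
  have hp : ‖(p : E4)‖ = 3 := by simp
  have hnorm := (hasStrictFDerivAt_norm_sq (p : E4)).hasFDerivAt.sqrt (by simp [hp])
  simp only [Real.sqrt_sq (norm_nonneg _)] at hnorm
  have hquot : HasFDerivAt (fun y : E4 => 3 / ‖y‖) _ (p : E4) :=
    ((hasDerivAt_const ‖(p : E4)‖ (3 : ℝ)).div (hasDerivAt_id _) (by simp [hp])).comp_hasFDerivAt
      (p : E4) hnorm
  have hrad : (fun y : E4 => (radial y : E4)) =ᶠ[nhds (p : E4)] fun y => (3 / ‖y‖) • y := by
    filter_upwards [isOpen_compl_singleton.mem_nhds (coe_ne_zero p)] with y hy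
    exact radial_of_ne_zero hy
  have hsmul : HasFDerivAt (fun y : E4 => (3 / ‖y‖) • y) _ (p : E4) :=
    hquot.smul (hasFDerivAt_id (p : E4))
  rw [hrad.fderiv_eq, hsmul.fderiv]
  simp [hv, hp]

lemma contDiff_Z {N : WithTop ℕ∞} (A : Fin 3) : ContDiff ℝ N (Z A) :=
  (LinearMap.toContinuousLinearMap (ZLin A)).contDiff

/-- The slab `[0, T) × (ℝ⁴ \ {0})`, on which regularity of functions on `[0, T) × S³` is tested
after homogeneous extension. -/
abbrev slab (T : ℝ) : Set (ℝ × E4) := Ico 0 T ×ˢ {0}ᶜ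

/-- The extension of a function on `[0, T) × S³`, homogeneous of degree `0` in the ambient
variable. -/
abbrev homExt (u : ℝ → S3 → ℝ) : ℝ × E4 → ℝ := fun q => u q.1 (radial q.2)

/-- The space-time differential, relative to the slab, of the homogeneous extension of `u`. -/
abbrev slabDeriv (T : ℝ) (u : ℝ → S3 → ℝ) : ℝ × E4 → (ℝ × E4 →L[ℝ] ℝ) :=
  fderivWithin ℝ (homExt u) (slab T)

/-- The second space-time differential, relative to the slab, of the homogeneous extension. -/
abbrev slabDeriv₂ (T : ℝ) (u : ℝ → S3 → ℝ) (q : ℝ × E4) :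
    ℝ × E4 →L[ℝ] ℝ × E4 →L[ℝ] ℝ :=
  fderivWithin ℝ (slabDeriv T u) (slab T) q

lemma uniqueDiffOn_slab (T : ℝ) : UniqueDiffOn ℝ (slab T) :=
  (uniqueDiffOn_Ico 0 T).prod isOpen_compl_singleton.uniqueDiffOn

lemma mem_slab {T t : ℝ} (ht : t ∈ Ico 0 T) (p : S3) : (t, (p : E4)) ∈ slab T :=
  ⟨ht, coe_ne_zero p⟩

lemma contDiffOn_slab_radial (T : ℝ) {N : WithTop ℕ∞} :
    ContDiffOn ℝ N (fun q : ℝ × E4 => (q.1, (radial q.2 : E4))) (slab T) :=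
  contDiffOn_fst.prodMk (contDiffOn_radial.comp contDiffOn_snd fun _ hq => hq.2)

lemma mapsTo_slab_radial (T : ℝ) :
    MapsTo (fun q : ℝ × E4 => (q.1, (radial q.2 : E4))) (slab T) (slab T) :=
  fun q hq => mem_slab hq.1 (radial q.2)

lemma hasDerivWithinAt_slab_time {F : Type*} [NormedAddCommGroup F] [NormedSpace ℝ F] {T t : ℝ}
    {f : ℝ × E4 → F} {f' : ℝ × E4 →L[ℝ] F} {p : S3}
    (hf : HasFDerivWithinAt f f' (slab T) (t, (p : E4))) :
    HasDerivWithinAt (fun s => f (s, (p : E4))) (f' (1, 0)) (Ico 0 T) t :=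
  hf.comp_hasDerivWithinAt t (f := fun s : ℝ => (s, (p : E4)))
    ((hasDerivWithinAt_id t _).prodMk (hasDerivWithinAt_const t _ _)) fun _ hs => mem_slab hs p

lemma dt_eq {T t f' : ℝ} {f : ℝ → ℝ} (h : HasDerivWithinAt f f' (Ico 0 T) t)
    (ht : t ∈ Ico 0 T) : dt T f t = f' :=
  h.derivWithin (uniqueDiffOn_Ico 0 T t ht)

lemma dt_congr {T t : ℝ} {f g : ℝ → ℝ} (h : ∀ s ∈ Ico 0 T, f s = g s)
    (ht : t ∈ Ico 0 T) : dt T f t = dt T g t :=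
  derivWithin_congr h (h t ht)

/-- Differentiability along the sphere, tested on the homogeneous extension. -/
def SphereDiff (f : S3 → ℝ) : Prop :=
  ∀ p : S3, DifferentiableAt ℝ (fun y : E4 => f (radial y)) p

namespace SlabC

variable {M N : ℕ} {T t : ℝ} {u v : ℝ → S3 → ℝ}

lemma of_le (h : SlabC N T u) (hMN : M ≤ N) : SlabC M T u :=
  ContDiffOn.of_le h (mod_cast hMN)

lemma const (N : ℕ) (T c : ℝ) : SlabC N T (fun _ _ => c) := contDiffOn_const

lemma of_time {b : ℝ → ℝ} (hb : ContDiffOn ℝ N b (Ico 0 T)) : SlabC N T (fun t _ => b t) :=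
  hb.comp contDiffOn_fst fun _ hq => hq.1

lemma add (hu : SlabC N T u) (hv : SlabC N T v) : SlabC N T (fun t p => u t p + v t p) :=
  ContDiffOn.add hu hv

lemma sub (hu : SlabC N T u) (hv : SlabC N T v) : SlabC N T (fun t p => u t p - v t p) :=
  ContDiffOn.sub hu hv

lemma mul (hu : SlabC N T u) (hv : SlabC N T v) : SlabC N T (fun t p => u t p * v t p) :=
  ContDiffOn.mul hu hv

lemma sum {ι : Type*} {s : Finset ι} {u : ι → ℝ → S3 → ℝ} (hu : ∀ i ∈ s, SlabC N T (u i)) :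
    SlabC N T (fun t p => ∑ i ∈ s, u i t p) :=
  ContDiffOn.sum hu

lemma inv (hu : SlabC N T u) (h0 : ∀ t ∈ Ico 0 T, ∀ p, u t p ≠ 0) :
    SlabC N T (fun t p => (u t p)⁻¹) :=
  ContDiffOn.inv hu fun q hq => h0 q.1 hq.1 _

lemma slice (h : SlabC N T u) (ht : t ∈ Ico 0 T) (T' : ℝ) : SlabC N T' (fun _ => u t) :=
  ContDiffOn.comp (g := homExt u) (f := fun q : ℝ × E4 => (t, q.2)) h
    (contDiffOn_const.prodMk contDiffOn_snd) fun _ hq => ⟨ht, hq.2⟩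

lemma hasFDerivWithinAt (h : SlabC (N + 1) T u) (ht : t ∈ Ico 0 T) (p : S3) :
    HasFDerivWithinAt (homExt u) (slabDeriv T u (t, (p : E4))) (slab T) (t, (p : E4)) :=
  (ContDiffOn.differentiableOn h (by simp) _ (mem_slab ht p)).hasFDerivWithinAt

lemma hasFDerivAt_slice (h : SlabC (N + 1) T u) (ht : t ∈ Ico 0 T) (p : S3) :
    HasFDerivAt (fun y : E4 => u t (radial y))
      ((slabDeriv T u (t, (p : E4))).comp (ContinuousLinearMap.inr ℝ ℝ E4)) (p : E4) :=
  ((h.hasFDerivWithinAt ht p).comp (s := {0}ᶜ) (p : E4) (f := fun y : E4 => (t, y))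
    (hasFDerivAt_prodMk_right t (p : E4)).hasFDerivWithinAt fun _ hy => ⟨ht, hy⟩).hasFDerivAt
    (isOpen_compl_singleton.mem_nhds (coe_ne_zero p))

lemma sphereDiff (h : SlabC (N + 1) T u) (ht : t ∈ Ico 0 T) : SphereDiff (u t) := fun p =>
  (h.hasFDerivAt_slice ht p).differentiableAt

lemma hasDerivWithinAt (h : SlabC (N + 1) T u) (ht : t ∈ Ico 0 T) (p : S3) :
    HasDerivWithinAt (fun s => u s p) (slabDeriv T u (t, (p : E4)) (1, 0)) (Ico 0 T) t := by
  simpa only [homExt, radial_coe] using hasDerivWithinAt_slab_time (h.hasFDerivWithinAt ht p)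

lemma hasDerivWithinAt_dt (h : SlabC (N + 1) T u) (ht : t ∈ Ico 0 T) (p : S3) :
    HasDerivWithinAt (fun s => u s p) (dt T (fun s => u s p) t) (Ico 0 T) t :=
  (h.hasDerivWithinAt ht p).differentiableWithinAt.hasDerivWithinAt

lemma dt_eq_slabDeriv (h : SlabC (N + 1) T u) (ht : t ∈ Ico 0 T) (p : S3) :
    dt T (fun s => u s p) t = slabDeriv T u (t, (p : E4)) (1, 0) :=
  dt_eq (h.hasDerivWithinAt ht p) ht

lemma Zder_eq_slabDeriv (h : SlabC (N + 1) T u) (ht : t ∈ Ico 0 T) (A : Fin 3) (p : S3) :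
    Zder A (u t) p = slabDeriv T u (t, (p : E4)) (0, Z A (p : E4)) := by
  rw [Zder, (h.hasFDerivAt_slice ht p).fderiv]
  rfl

lemma contDiffOn_slabDeriv (h : SlabC (N + 1) T u) : ContDiffOn ℝ N (slabDeriv T u) (slab T) :=
  ContDiffOn.fderivWithin h (uniqueDiffOn_slab T) (by simp)

protected lemma dt (h : SlabC (N + 1) T u) : SlabC N T (fun t p => dt T (fun s => u s p) t) :=
  ((h.contDiffOn_slabDeriv.comp (contDiffOn_slab_radial T) (mapsTo_slab_radial T)).clm_apply
    (contDiffOn_const (c := ((1 : ℝ), (0 : E4))))).congr fun _ hq => h.dt_eq_slabDeriv hq.1 _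

lemma zder (h : SlabC (N + 1) T u) (A : Fin 3) : SlabC N T (fun t => Zder A (u t)) :=
  ((h.contDiffOn_slabDeriv.comp (contDiffOn_slab_radial T) (mapsTo_slab_radial T)).clm_apply
    (contDiffOn_const (c := (0 : ℝ)) |>.prodMk ((contDiff_Z A).comp_contDiffOn
      (contDiffOn_slab_radial T).snd))).congr fun _ hq => h.Zder_eq_slabDeriv hq.1 A _

lemma hasFDerivWithinAt_slabDeriv (h : SlabC 2 T u) (ht : t ∈ Ico 0 T) (p : S3) :
    HasFDerivWithinAt (slabDeriv T u) (slabDeriv₂ T u (t, (p : E4))) (slab T) (t, (p : E4)) :=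
  (h.contDiffOn_slabDeriv.differentiableOn one_ne_zero _ (mem_slab ht p)).hasFDerivWithinAt

lemma slabDeriv₂_symm (h : SlabC 2 T u) (ht : t ∈ Ico 0 T) (p : S3) (v w : ℝ × E4) :
    slabDeriv₂ T u (t, (p : E4)) v w = slabDeriv₂ T u (t, (p : E4)) w v := by
  have hT : (0 : ℝ) < T := ht.1.trans_lt ht.2
  refine ContDiffWithinAt.isSymmSndFDerivWithinAt (n := 2) (h _ (mem_slab ht p)) (by simp)
    (uniqueDiffOn_slab T) ?_ (mem_slab ht p) v w
  rw [interior_prod_eq, closure_prod_eq, interior_Ico, isOpen_compl_singleton.interior_eq,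
    closure_Ioo hT.ne]
  exact ⟨Ico_subset_Icc_self ht, subset_closure (coe_ne_zero p)⟩

lemma dt_Zder_eq (h : SlabC 2 T u) (ht : t ∈ Ico 0 T) (A : Fin 3) (p : S3) :
    dt T (fun s => Zder A (u s) p) t
      = slabDeriv₂ T u (t, (p : E4)) (1, 0) (0, Z A (p : E4)) := by
  rw [dt_congr (fun s hs => Zder_eq_slabDeriv (N := 1) h hs A p) ht]
  refine dt_eq ?_ ht
  simpa using (hasDerivWithinAt_slab_time (h.hasFDerivWithinAt_slabDeriv ht p)).clm_apply
    (hasDerivWithinAt_const t (Ico 0 T) ((0 : ℝ), Z A (p : E4)))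

lemma Zder_dt_eq (h : SlabC 2 T u) (ht : t ∈ Ico 0 T) (A : Fin 3) (p : S3) :
    Zder A (fun q => dt T (fun s => u s q) t) p
      = slabDeriv₂ T u (t, (p : E4)) (0, Z A (p : E4)) (1, 0) := by
  have hD : HasFDerivWithinAt (slabDeriv T u) (slabDeriv₂ T u (t, (p : E4))) (slab T)
      (t, (radial (p : E4) : E4)) := by
    rw [radial_coe]
    exact h.hasFDerivWithinAt_slabDeriv ht p
  have hcomp := ((hD.comp (s := {0}ᶜ) (p : E4) (f := fun y : E4 => (t, (radial y : E4)))
    ((hasFDerivAt_const t (p : E4)).prodMk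
      (differentiableAt_radial p).hasFDerivAt).hasFDerivWithinAt
    fun y _ => mem_slab ht (radial y)).hasFDerivAt
    (isOpen_compl_singleton.mem_nhds (coe_ne_zero p))).clm_apply
    (hasFDerivAt_const ((1 : ℝ), (0 : E4)) (p : E4))
  have hdt : (fun y : E4 => dt T (fun s => u s (radial y)) t)
      = fun y => slabDeriv T u (t, (radial y : E4)) (1, 0) :=
    funext fun y => dt_eq_slabDeriv (N := 1) h ht (radial y)
  simp only [Function.comp_def] at hcomp
  rw [Zder, hdt, hcomp.fderiv]
  simp [fderiv_radial_apply (inner_self_Z A p)]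

lemma dt_Zder (h : SlabC 2 T u) (ht : t ∈ Ico 0 T) (A : Fin 3) (p : S3) :
    dt T (fun s => Zder A (u s) p) t = Zder A (fun q => dt T (fun s => u s q) t) p := by
  rw [h.dt_Zder_eq ht, h.Zder_dt_eq ht, h.slabDeriv₂_symm ht]

end SlabC

/-! ### Bounds for frame derivatives -/

section FrameDerivative

variable {f g : S3 → ℝ}

lemma SphereDiff.add (hf : SphereDiff f) (hg : SphereDiff g) :
    SphereDiff (fun p => f p + g p) := fun p => (hf p).add (hg p)

lemma SphereDiff.mul (hf : SphereDiff f) (hg : SphereDiff g) :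
    SphereDiff (fun p => f p * g p) := fun p => (hf p).mul (hg p)

lemma SphereDiff.const (c : ℝ) : SphereDiff (fun _ => c) := fun _ => differentiableAt_const c

lemma Zder_add (hf : SphereDiff f) (hg : SphereDiff g) (A : Fin 3) :
    Zder A (fun p => f p + g p) = fun p => Zder A f p + Zder A g p := by
  funext p
  simp only [Zder]
  rw [fderiv_fun_add (hf p) (hg p)]
  rfl

lemma Zder_mul (hf : SphereDiff f) (hg : SphereDiff g) (A : Fin 3) :
    Zder A (fun p => f p * g p) = fun p => Zder A f p * g p + f p * Zder A g p := by
  funext p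
  simp only [Zder]
  rw [fderiv_fun_mul (hf p) (hg p)]
  simp [radial_coe]
  ring

lemma Zder_const (c : ℝ) (A : Fin 3) : Zder A (fun _ => c) = fun _ => 0 := by
  funext p
  simp [Zder]

lemma Zder_const_mul (c : ℝ) (f : S3 → ℝ) (A : Fin 3) :
    Zder A (fun p => c * f p) = fun p => c * Zder A f p := by
  funext p
  simp only [Zder]
  change fderiv ℝ (c • (fun y : E4 => f (radial y))) (p : E4) _ = _
  rw [fderiv_const_smul_field]
  rfl

lemma Zder_sub_const (c : ℝ) (f : S3 → ℝ) (A : Fin 3) :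
    Zder A (fun p => f p - c) = Zder A f := by
  funext p
  simp only [Zder]
  rw [fderiv_sub_const]

end FrameDerivative

/-- All frame derivatives of `f` of order less than `N` are differentiable, and those of order at
most `N` are bounded by `B`. -/
def DerivBound : ℕ → (S3 → ℝ) → ℝ → Prop
  | 0, f, B => ∀ p, |f p| ≤ B
  | N + 1, f, B => (∀ p, |f p| ≤ B) ∧ SphereDiff f ∧ ∀ A, DerivBound N (Zder A f) B

namespace DerivBound

variable {M N : ℕ} {f g : S3 → ℝ} {B B' : ℝ}

lemma abs_le (h : DerivBound N f B) (p : S3) : |f p| ≤ B := by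
  cases N with
  | zero => exact h p
  | succ N => exact h.1 p

lemma nonneg (h : DerivBound N f B) : 0 ≤ B :=
  (abs_nonneg _).trans (h.abs_le (radial 0))

lemma mono (h : DerivBound N f B) (hB : B ≤ B') : DerivBound N f B' := by
  induction N generalizing f with
  | zero => exact fun p => (h p).trans hB
  | succ N ih => exact ⟨fun p => (h.1 p).trans hB, h.2.1, fun A => ih (h.2.2 A)⟩

lemma of_succ (h : DerivBound (N + 1) f B) : DerivBound N f B := by
  induction N generalizing f with
  | zero => exact h.1
  | succ N ih => exact ⟨h.1, h.2.1, fun A => ih (h.2.2 A)⟩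

lemma of_le (h : DerivBound N f B) (hMN : M ≤ N) : DerivBound M f B := by
  induction N, hMN using Nat.le_induction with
  | base => exact h
  | succ N _ ih => exact ih h.of_succ

lemma zder (h : DerivBound (N + 1) f B) (A : Fin 3) : DerivBound N (Zder A f) B := h.2.2 A

lemma zero (N : ℕ) (hB : 0 ≤ B) : DerivBound N (fun _ => 0) B := by
  induction N with
  | zero => intro p; simpa using hB
  | succ N ih =>
    refine ⟨fun p => by simpa using hB, SphereDiff.const 0, fun A => ?_⟩
    rw [Zder_const]
    exact ih

lemma const (N : ℕ) (c : ℝ) : DerivBound N (fun _ => c) |c| := by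
  cases N with
  | zero => exact fun p => le_rfl
  | succ N =>
    refine ⟨fun p => le_rfl, SphereDiff.const c, fun A => ?_⟩
    rw [Zder_const]
    exact zero N (abs_nonneg c)

lemma add (hf : DerivBound N f B) (hg : DerivBound N g B') :
    DerivBound N (fun p => f p + g p) (B + B') := by
  induction N generalizing f g with
  | zero => exact fun p => (abs_add_le _ _).trans (add_le_add (hf p) (hg p))
  | succ N ih =>
    refine ⟨fun p => (abs_add_le _ _).trans (add_le_add (hf.1 p) (hg.1 p)), hf.2.1.add hg.2.1,
      fun A => ?_⟩
    rw [Zder_add hf.2.1 hg.2.1]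
    exact ih (hf.2.2 A) (hg.2.2 A)

lemma abs_mul_le (hf : DerivBound N f B) (hg : DerivBound N g B') (p : S3) :
    |f p * g p| ≤ B * B' := by
  rw [abs_mul]
  exact mul_le_mul (hf.abs_le p) (hg.abs_le p) (abs_nonneg _) hf.nonneg

lemma mul (hf : DerivBound N f B) (hg : DerivBound N g B') :
    DerivBound N (fun p => f p * g p) (2 ^ N * (B * B')) := by
  induction N generalizing f g with
  | zero => simpa [DerivBound] using hf.abs_mul_le hg
  | succ N ih =>
    refine ⟨fun p => (hf.abs_mul_le hg p).trans (le_mul_of_one_le_left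
      (mul_nonneg hf.nonneg hg.nonneg) (one_le_pow₀ one_le_two)), hf.2.1.mul hg.2.1, fun A => ?_⟩
    rw [Zder_mul hf.2.1 hg.2.1]
    refine ((ih (hf.2.2 A) hg.of_succ).add (ih hf.of_succ (hg.2.2 A))).mono (le_of_eq ?_)
    ring

lemma const_mul (hf : DerivBound N f B) (c : ℝ) :
    DerivBound N (fun p => c * f p) (|c| * B) := by
  induction N generalizing f with
  | zero =>
    intro p
    rw [abs_mul]
    exact mul_le_mul_of_nonneg_left (hf p) (abs_nonneg c)
  | succ N ih =>
    refine ⟨fun p => ?_, (SphereDiff.const c).mul hf.2.1, fun A => ?_⟩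
    · rw [abs_mul]
      exact mul_le_mul_of_nonneg_left (hf.1 p) (abs_nonneg c)
    · rw [Zder_const_mul]
      exact ih (hf.2.2 A)

lemma sub (hf : DerivBound N f B) (hg : DerivBound N g B') :
    DerivBound N (fun p => f p - g p) (B + B') := by
  simpa [← sub_eq_add_neg] using hf.add (hg.const_mul (-1))

lemma sum {ι : Type*} {s : Finset ι} {f : ι → S3 → ℝ} {B : ι → ℝ}
    (h : ∀ i ∈ s, DerivBound N (f i) (B i)) :
    DerivBound N (fun p => ∑ i ∈ s, f i p) (∑ i ∈ s, B i) := by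
  classical
  induction s using Finset.induction_on with
  | empty => simpa using zero N le_rfl
  | insert i s hi ih =>
    simp only [Finset.sum_insert hi]
    exact (h i (Finset.mem_insert_self i s)).add
      (ih fun j hj => h j (Finset.mem_insert_of_mem hj))

lemma of_forall_add (h : ∀ δ > 0, DerivBound N f (B + δ)) : DerivBound N f B := by
  induction N generalizing f with
  | zero => exact fun p => le_of_forall_pos_le_add fun δ hδ => h δ hδ p
  | succ N ih =>
    exact ⟨fun p => le_of_forall_pos_le_add fun δ hδ => (h δ hδ).1 p, (h 1 one_pos).2.1,
      fun A => ih fun δ hδ => (h δ hδ).2.2 A⟩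

end DerivBound

section Compactness

variable {N : ℕ} {T t : ℝ} {u : ℝ → S3 → ℝ}

lemma SlabC.exists_abs_le (h : SlabC 0 T u) (ht : t ∈ Ico 0 T) :
    ∃ B, ∀ s ∈ Icc 0 t, ∀ p, |u s p| ≤ B := by
  have hslab : ContinuousOn (homExt u) (slab T) := ContDiffOn.continuousOn h
  have hcont : ContinuousOn (fun q : ℝ × S3 => u q.1 (radial (q.2 : E4))) (Icc 0 t ×ˢ univ) :=
    hslab.comp (f := fun q : ℝ × S3 => (q.1, (q.2 : E4))) (by fun_prop)
      fun q hq => mem_slab (Icc_subset_Ico_right ht.2 hq.1) q.2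
  simp only [radial_coe] at hcont
  obtain ⟨B, hB⟩ := (isCompact_Icc.prod isCompact_univ).exists_bound_of_continuousOn hcont
  exact ⟨B, fun s hs p => hB (s, p) ⟨hs, mem_univ p⟩⟩

lemma SlabC.exists_derivBound (h : SlabC N T u) (ht : t ∈ Ico 0 T) :
    ∃ B, ∀ s ∈ Icc 0 t, DerivBound N (u s) B := by
  induction N generalizing u with
  | zero => exact h.exists_abs_le ht
  | succ N ih =>
    obtain ⟨B, hB⟩ := (h.of_le (Nat.zero_le _)).exists_abs_le ht
    choose B' hB' using fun A => ih (h.zder A)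
    refine ⟨|B| + ∑ A, |B' A|, fun s hs =>
      ⟨fun p => ?_, h.sphereDiff (Icc_subset_Ico_right ht.2 hs), fun A => ?_⟩⟩
    · exact (hB s hs p).trans ((le_abs_self B).trans
        (le_add_of_nonneg_right (Finset.sum_nonneg fun _ _ => abs_nonneg _)))
    · refine (hB' A s hs).mono ((le_abs_self _).trans ?_)
      exact (Finset.single_le_sum (f := fun A => |B' A|) (fun _ _ => abs_nonneg _)
        (Finset.mem_univ A)).trans (le_add_of_nonneg_left (abs_nonneg B))

end Compactness

section Comparison

variable {T t : ℝ} {f f' β β' : ℝ → ℝ}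

lemma le_of_hasDerivWithinAt_le (hf : ∀ t ∈ Ico 0 T, HasDerivWithinAt f (f' t) (Ico 0 T) t)
    (hβ : ∀ t ∈ Ico 0 T, HasDerivWithinAt β (β' t) (Ico 0 T) t)
    (ht : t ∈ Ico 0 T) (h0 : f 0 ≤ β 0) (h : ∀ s ∈ Icc 0 t, f' s ≤ β' s) : f t ≤ β t := by
  have hsub : Icc 0 t ⊆ Ico 0 T := Icc_subset_Ico_right ht.2
  have hnhds : ∀ s ∈ Ico 0 t, Ico 0 T ∈ nhdsWithin s (Ici s) := fun s hs =>
    Filter.mem_of_superset (Ico_mem_nhdsGE (hs.2.trans ht.2)) (Ico_subset_Ico_left hs.1)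
  exact image_le_of_deriv_right_le_deriv_boundary (f := f) (f' := f')
    (fun s hs => (hf s (hsub hs)).continuousWithinAt.mono hsub)
    (fun s hs => (hf s (hsub (Ico_subset_Icc_self hs))).mono_of_mem_nhdsWithin (hnhds s hs))
    h0
    (fun s hs => (hβ s (hsub hs)).continuousWithinAt.mono hsub)
    (fun s hs => (hβ s (hsub (Ico_subset_Icc_self hs))).mono_of_mem_nhdsWithin (hnhds s hs))
    (fun s hs => h s (Ico_subset_Icc_self hs)) ⟨ht.1, le_rfl⟩

lemma abs_le_of_hasDerivWithinAt_le (hf : ∀ t ∈ Ico 0 T, HasDerivWithinAt f (f' t) (Ico 0 T) t)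
    (hβ : ∀ t ∈ Ico 0 T, HasDerivWithinAt β (β' t) (Ico 0 T) t)
    (ht : t ∈ Ico 0 T) (h0 : |f 0| ≤ β 0) (h : ∀ s ∈ Icc 0 t, |f' s| ≤ β' s) : |f t| ≤ β t :=
  abs_le'.mpr ⟨le_of_hasDerivWithinAt_le hf hβ ht ((le_abs_self _).trans h0)
      fun s hs => (le_abs_self _).trans (h s hs),
    le_of_hasDerivWithinAt_le (fun s hs => (hf s hs).neg) hβ ht ((neg_le_abs _).trans h0)
      fun s hs => (neg_le_abs _).trans (h s hs)⟩

end Comparison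

lemma DerivBound.integrate {N : ℕ} {T t : ℝ} {u : ℝ → S3 → ℝ} (hu : SlabC (N + 1) T u)
    {β β' : ℝ → ℝ} (hβ : ∀ t ∈ Ico 0 T, HasDerivWithinAt β (β' t) (Ico 0 T) t)
    (ht : t ∈ Ico 0 T) (h0 : DerivBound N (u 0) (β 0))
    (h : ∀ s ∈ Icc 0 t, DerivBound N (fun p => dt T (fun s => u s p) s) (β' s)) :
    DerivBound N (u t) (β t) := by
  have hpointwise (p : S3) : |u t p| ≤ β t :=
    abs_le_of_hasDerivWithinAt_le (fun s hs => hu.hasDerivWithinAt_dt hs p) hβ ht (h0.abs_le p)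
      fun s hs => (h s hs).abs_le p
  induction N generalizing u with
  | zero => exact hpointwise
  | succ N ih =>
    have hcomm {s : ℝ} (hs : s ∈ Icc 0 t) (A : Fin 3) :
        (fun p => dt T (fun r => Zder A (u r) p) s) = Zder A (fun p => dt T (fun r => u r p) s) :=
      funext fun p => (hu.of_le (by lia)).dt_Zder ⟨hs.1, hs.2.trans_lt ht.2⟩ A p
    have hrate (A : Fin 3) : ∀ s ∈ Icc 0 t,
        DerivBound N (fun p => dt T (fun r => Zder A (u r) p) s) (β' s) := fun s hs => by
      rw [hcomm hs A]
      exact (h s hs).zder A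
    exact ⟨hpointwise, hu.sphereDiff ht, fun A => ih (hu.zder A) (h0.zder A) (hrate A) fun p =>
      abs_le_of_hasDerivWithinAt_le (fun s hs => (hu.zder A).hasDerivWithinAt_dt hs p) hβ ht
        ((h0.zder A).abs_le p) fun s hs => (hrate A s hs).abs_le p⟩

lemma forall_pos_of_halving {P : ℝ → Prop} {b m : ℝ} (hb : 0 ≤ b) (hm : 0 ≤ m) (h : P m)
    (hmono : ∀ m m', m ≤ m' → P m → P m') (hhalf : ∀ m, 0 ≤ m → P m → P (b + m / 2)) :
    ∀ δ > 0, P (2 * b + δ) := by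
  intro δ hδ
  have hiter (j : ℕ) : P (2 * b + m * (1 / 2) ^ j) := by
    induction j with
    | zero => exact hmono m _ (by linarith) h
    | succ j ih =>
      convert hhalf _ (by positivity) ih using 1
      ring
  obtain ⟨j, hj⟩ := exists_pow_lt_of_lt_one (show 0 < δ / (m + 1) by positivity)
    (show (1 / 2 : ℝ) < 1 by norm_num)
  refine hmono _ _ (add_le_add_right ?_ _) (hiter j)
  calc m * (1 / 2) ^ j ≤ (m + 1) * (1 / 2) ^ j := by gcongr; linarith
    _ ≤ δ := by rw [mul_comm]; exact ((lt_div_iff₀ (by positivity)).mp hj).le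

section Gronwall

variable {ι : Type*} {N : ℕ} {T t : ℝ} {u : ι → ℝ → S3 → ℝ} {β β' : ℝ → ℝ} {b₀ q κ : ℝ}

lemma DerivBound.gronwall_step (hu : ∀ i, SlabC (N + 1) T (u i))
    (hβ : ∀ t ∈ Ico 0 T, HasDerivWithinAt β (β' t) (Ico 0 T) t) (hβ0 : ∀ t ∈ Ico 0 T, 0 ≤ β t)
    (hβ' : ∀ t ∈ Ico 0 T, 0 ≤ β' t) (hb₀ : 0 ≤ b₀) (h0 : ∀ i, DerivBound N (u i 0) b₀)
    (hq : 0 ≤ q) (hκ : 0 ≤ κ) (hκ' : κ ≤ 1 / 2)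
    (h : ∀ t ∈ Ico 0 T, ∀ b, 0 ≤ b → (∀ i, DerivBound N (u i t) b) → ∀ i,
      DerivBound N (fun p => dt T (fun s => u i s p) t) (κ * q * β' t * (1 + b)))
    (ht : t ∈ Ico 0 T) {m : ℝ} (hm : 0 ≤ m)
    (hum : ∀ s ∈ Icc 0 t, ∀ i, DerivBound N (u i s) (m * Real.exp (q * β s))) (i : ι) :
    DerivBound N (u i t) ((b₀ + κ + m / 2) * Real.exp (q * β t)) := by
  have hone {s : ℝ} (hs : s ∈ Ico 0 T) : 1 ≤ Real.exp (q * β s) :=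
    Real.one_le_exp (mul_nonneg hq (hβ0 s hs))
  have hint : DerivBound N (u i t) (b₀ + κ * (1 + m) * Real.exp (q * β t)) := by
    refine DerivBound.integrate (hu i) (β := fun t => b₀ + κ * (1 + m) * Real.exp (q * β t))
      (fun t ht => (((hβ t ht).const_mul q).exp.const_mul _).const_add _) ht
      ((h0 i).mono (le_add_of_nonneg_right (by positivity))) fun s hs => ?_
    have hs' := Icc_subset_Ico_right ht.2 hs
    have hβs := hβ' s hs'
    refine (h s hs' _ (by positivity) (hum s hs) i).mono ?_
    calc κ * q * β' s * (1 + m * Real.exp (q * β s))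
        ≤ κ * q * β' s * (Real.exp (q * β s) + m * Real.exp (q * β s)) := by
          gcongr
          exact hone hs'
      _ = κ * (1 + m) * (Real.exp (q * β s) * (q * β' s)) := by ring
  refine hint.mono ?_
  calc b₀ + κ * (1 + m) * Real.exp (q * β t)
      ≤ b₀ * Real.exp (q * β t) + (κ + 1 / 2 * m) * Real.exp (q * β t) := by
        rw [mul_add, mul_one]
        gcongr
        exact le_mul_of_one_le_right hb₀ (hone ht)
    _ = _ := by ring

lemma DerivBound.gronwall [Finite ι] (hu : ∀ i, SlabC (N + 1) T (u i))
    (hβ : ∀ t ∈ Ico 0 T, HasDerivWithinAt β (β' t) (Ico 0 T) t) (hβ0 : ∀ t ∈ Ico 0 T, 0 ≤ β t)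
    (hβ' : ∀ t ∈ Ico 0 T, 0 ≤ β' t) (hb₀ : 0 ≤ b₀) (h0 : ∀ i, DerivBound N (u i 0) b₀)
    (hq : 0 ≤ q) (hκ : 0 ≤ κ) (hκ' : κ ≤ 1 / 2)
    (h : ∀ t ∈ Ico 0 T, ∀ b, 0 ≤ b → (∀ i, DerivBound N (u i t) b) → ∀ i,
      DerivBound N (fun p => dt T (fun s => u i s p) t) (κ * q * β' t * (1 + b)))
    (ht : t ∈ Ico 0 T) (i : ι) :
    DerivBound N (u i t) (2 * (b₀ + κ) * Real.exp (q * β t)) := by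
  have hsub : Icc 0 t ⊆ Ico 0 T := Icc_subset_Ico_right ht.2
  let P (m : ℝ) : Prop := ∀ s ∈ Icc 0 t, ∀ i, DerivBound N (u i s) (m * Real.exp (q * β s))
  have hmono (m m' : ℝ) (hmm' : m ≤ m') (hP : P m) : P m' := fun s hs i =>
    (hP s hs i).mono (mul_le_mul_of_nonneg_right hmm' (Real.exp_pos _).le)
  have hbounded : ∃ m, 0 ≤ m ∧ P m := by
    choose B hB using fun i => ((hu i).of_le N.le_succ).exists_derivBound ht
    obtain ⟨m, hm⟩ := (Set.finite_range B).bddAbove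
    refine ⟨|m|, abs_nonneg m, fun s hs i => (hB i s hs).mono ?_⟩
    calc B i ≤ |m| := (hm (mem_range_self i)).trans (le_abs_self m)
      _ ≤ _ := le_mul_of_one_le_right (abs_nonneg m)
        (Real.one_le_exp (mul_nonneg hq (hβ0 s (hsub hs))))
  obtain ⟨m, hm, hPm⟩ := hbounded
  have hP := forall_pos_of_halving (add_nonneg hb₀ hκ) hm hPm hmono fun m hm hPm s hs i =>
    DerivBound.gronwall_step hu hβ hβ0 hβ' hb₀ h0 hq hκ hκ' h (hsub hs) hm
      (fun r hr => hPm r ⟨hr.1, hr.2.trans hs.2⟩) i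
  refine DerivBound.of_forall_add fun δ hδ =>
    (hP (δ * (Real.exp (q * β t))⁻¹) (by positivity) t ⟨ht.1, le_rfl⟩ i).mono (le_of_eq ?_)
  rw [add_mul, inv_mul_cancel_right₀ (Real.exp_pos _).ne']

end Gronwall

/-! ### Lie derivatives and frame derivatives of components -/

lemma abs_structConst_le (A B C : Fin 3) : |structConst A B C| ≤ 1 := by
  fin_cases A <;> fin_cases B <;> fin_cases C <;> norm_num [structConst, eps, abs_le]

/-- All components of `ξ` have frame derivatives of order at most `N` bounded by `B`. -/
def TensorBound {l m : ℕ} (N : ℕ) (ξ : Tensor l m) (B : ℝ) : Prop :=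
  ∀ I J, DerivBound N (ξ I J) B

/-- The growth factor of component bounds under a Lie derivative. -/
def lieFactor (l m : ℕ) : ℝ := 1 + 3 * l + 3 * m

/-- The zeroth-order part of the Lie derivative along `Z_C` coming from the upper indices. -/
def lieUpper {l m : ℕ} (C : Fin 3) (ξ : Tensor l m) : Tensor l m := fun A B p =>
  ∑ i : Fin l, ∑ D : Fin 3, structConst C D (A i) * ξ (Function.update A i D) B p

/-- The zeroth-order part of the Lie derivative along `Z_C` coming from the lower indices, up to
sign. -/
def lieLower {l m : ℕ} (C : Fin 3) (ξ : Tensor l m) : Tensor l m := fun A B p =>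
  ∑ j : Fin m, ∑ D : Fin 3, structConst C (B j) D * ξ A (Function.update B j D) p

section LieDerivative

variable {l m M N : ℕ} {T t B b : ℝ}

lemma lieZ_apply (C : Fin 3) (ξ : Tensor l m) (I : Fin l → Fin 3) (J : Fin m → Fin 3) :
    lieZ C ξ I J = fun p => Zder C (ξ I J) p + lieUpper C ξ I J p - lieLower C ξ I J p := rfl

lemma one_le_lieFactor (l m : ℕ) : 1 ≤ lieFactor l m := by
  unfold lieFactor
  linarith [(Nat.cast_nonneg l : (0 : ℝ) ≤ l), (Nat.cast_nonneg m : (0 : ℝ) ≤ m)]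

lemma DerivBound.sum_structConst {k : ℕ} {f : Fin k → Fin 3 → S3 → ℝ} {c : Fin k → Fin 3 → ℝ}
    (hc : ∀ i D, |c i D| ≤ 1) (h : ∀ i D, DerivBound N (f i D) B) :
    DerivBound N (fun p => ∑ i, ∑ D, c i D * f i D p) (3 * k * B) := by
  refine (DerivBound.sum fun i _ => DerivBound.sum fun D _ => ((h i D).const_mul (c i D)).mono
    (mul_le_of_le_one_left (h i D).nonneg (hc i D))).mono ?_
  simp only [Finset.sum_const, Finset.card_univ, Fintype.card_fin, nsmul_eq_mul]
  exact le_of_eq (by push_cast; ring)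

namespace TensorBound

variable {ξ : Tensor l m}

lemma lieUpper (h : TensorBound N ξ B) (C : Fin 3) : TensorBound N (lieUpper C ξ) (3 * l * B) :=
  fun _ _ => DerivBound.sum_structConst (fun _ _ => abs_structConst_le _ _ _) fun _ _ => h _ _

lemma lieLower (h : TensorBound N ξ B) (C : Fin 3) : TensorBound N (lieLower C ξ) (3 * m * B) :=
  fun _ _ => DerivBound.sum_structConst (fun _ _ => abs_structConst_le _ _ _) fun _ _ => h _ _

lemma of_succ (h : TensorBound (N + 1) ξ B) : TensorBound N ξ B := fun I J => (h I J).of_succ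

lemma lieZ (h : TensorBound (N + 1) ξ B) (C : Fin 3) :
    TensorBound N (lieZ C ξ) (lieFactor l m * B) := fun I J => by
  refine ((((h I J).zder C).add (h.of_succ.lieUpper C I J)).sub
    (h.of_succ.lieLower C I J)).mono (le_of_eq ?_)
  unfold lieFactor
  ring

lemma foldr_lieZ (L : List (Fin 3)) (h : TensorBound (N + L.length) ξ B) :
    TensorBound N (L.foldr EinsteinScalar.lieZ ξ) (lieFactor l m ^ L.length * B) := by
  induction L generalizing N with
  | nil => simpa using h
  | cons C L ih =>
    rw [List.length_cons, Nat.add_comm L.length, ← Nat.add_assoc] at h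
    rw [List.foldr_cons, List.length_cons, pow_succ', mul_assoc]
    exact (ih h).lieZ C

lemma lieI (I : Fin M → Fin 3) (h : TensorBound (N + M) ξ B) :
    TensorBound N (lieI I ξ) (lieFactor l m ^ M * B) := by
  have hfoldr := foldr_lieZ (N := N) (List.ofFn I) (ξ := ξ) (B := B) (by simpa using h)
  rwa [List.length_ofFn] at hfoldr

end TensorBound

lemma Zder_eq_lieZ (C : Fin 3) (ξ : Tensor l m) (I : Fin l → Fin 3) (J : Fin m → Fin 3) :
    Zder C (ξ I J) = fun p => lieZ C ξ I J p - lieUpper C ξ I J p + lieLower C ξ I J p := by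
  funext p
  simp only [lieZ_apply]
  ring

lemma SlabC.sum_const_mul {k : ℕ} {u : Fin k → Fin 3 → ℝ → S3 → ℝ} (c : Fin k → Fin 3 → ℝ)
    (h : ∀ i D, SlabC N T (u i D)) : SlabC N T (fun t p => ∑ i, ∑ D, c i D * u i D t p) :=
  SlabC.sum fun i _ => SlabC.sum fun D _ => (SlabC.const N T _).mul (h i D)

lemma SlabC.lieZ {ξ : ℝ → Tensor l m} (h : ∀ I J, SlabC (N + 1) T (fun t => ξ t I J))
    (C : Fin 3) (I : Fin l → Fin 3) (J : Fin m → Fin 3) :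
    SlabC N T (fun t => lieZ C (ξ t) I J) :=
  (((h I J).zder C).add (SlabC.sum_const_mul _ fun _ _ => (h _ _).of_le (Nat.le_succ N))).sub
    (SlabC.sum_const_mul _ fun _ _ => (h _ _).of_le (Nat.le_succ N))

lemma TensorBound.of_foldr_lieZ {ξ : Tensor l m} (hξ : ∀ I J, SlabC M 1 (fun _ => ξ I J))
    (h : ∀ L : List (Fin 3), L.length ≤ M → ∀ I J p, |L.foldr EinsteinScalar.lieZ ξ I J p| ≤ b) :
    TensorBound M ξ (lieFactor l m ^ M * b) := by
  have hb : 0 ≤ b := (abs_nonneg _).trans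
    (h [] (Nat.zero_le M) (fun _ => 0) (fun _ => 0) (radial 0))
  induction M generalizing ξ with
  | zero => exact fun I J p => by simpa using h [] le_rfl I J p
  | succ M ih =>
    have hlower : TensorBound M ξ (lieFactor l m ^ M * b) :=
      ih (fun I J => (hξ I J).of_le (Nat.le_succ M)) fun L hL => h L (hL.trans (Nat.le_succ M))
    have hLie (C : Fin 3) : TensorBound M (EinsteinScalar.lieZ C ξ) (lieFactor l m ^ M * b) :=
      ih (SlabC.lieZ (ξ := fun _ => ξ) hξ C) fun L hL I J p => by
        simpa using h (L ++ [C]) (by simpa using hL) I J p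
    refine fun I J => ⟨fun p => (h [] (Nat.zero_le _) I J p).trans ?_, (hξ I J).sphereDiff
      (t := 0) ⟨le_rfl, one_pos⟩, fun C => ?_⟩
    · exact le_mul_of_one_le_left hb (one_le_pow₀ (one_le_lieFactor l m))
    · rw [Zder_eq_lieZ]
      refine (((hLie C I J).sub (hlower.lieUpper C I J)).add
        (hlower.lieLower C I J)).mono (le_of_eq ?_)
      unfold lieFactor
      ring

lemma TensorBound.of_lieI {ξ : Tensor l m} (hξ : ∀ I J, SlabC M 1 (fun _ => ξ I J))
    (h : ∀ N ≤ M, ∀ W : Fin N → Fin 3, ∀ I J p, |EinsteinScalar.lieI W ξ I J p| ≤ b) :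
    TensorBound M ξ (lieFactor l m ^ M * b) :=
  TensorBound.of_foldr_lieZ hξ fun L hL I J p => by
    simpa only [EinsteinScalar.lieI, List.ofFn_get] using h L.length hL L.get I J p

variable {ξ : ℝ → Tensor l m}

lemma timeDeriv_lieZ (h : ∀ I J, SlabC 2 T (fun t => ξ t I J)) (ht : t ∈ Ico 0 T) (C : Fin 3) :
    timeDeriv T (fun s => lieZ C (ξ s)) t = lieZ C (timeDeriv T ξ t) := by
  funext I J p
  have hcomp (I J) : HasDerivWithinAt (fun s => ξ s I J p) (timeDeriv T ξ t I J p) (Ico 0 T) t :=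
    SlabC.hasDerivWithinAt_dt (N := 1) (h I J) ht p
  have hsum {k : ℕ} (c : Fin k → Fin 3 → ℝ) (I : Fin k → Fin 3 → Fin l → Fin 3)
      (J : Fin k → Fin 3 → Fin m → Fin 3) :
      HasDerivWithinAt (fun s => ∑ i, ∑ D, c i D * ξ s (I i D) (J i D) p)
        (∑ i, ∑ D, c i D * timeDeriv T ξ t (I i D) (J i D) p) (Ico 0 T) t :=
    HasDerivWithinAt.fun_sum fun i _ => HasDerivWithinAt.fun_sum fun D _ =>
      (hcomp _ _).const_mul _
  have hZ := SlabC.hasDerivWithinAt_dt (N := 0) (SlabC.zder (N := 1) (h I J) C) ht p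
  rw [SlabC.dt_Zder (h I J) ht C p] at hZ
  exact dt_eq ((hZ.add (hsum _ _ _)).sub (hsum _ _ _)) ht

lemma SlabC.foldr_lieZ (L : List (Fin 3))
    (h : ∀ I J, SlabC (N + L.length) T (fun t => ξ t I J)) (I : Fin l → Fin 3)
    (J : Fin m → Fin 3) : SlabC N T (fun t => L.foldr EinsteinScalar.lieZ (ξ t) I J) := by
  induction L generalizing N I J with
  | nil => simpa using h I J
  | cons C L ih =>
    exact SlabC.lieZ (fun I J => ih (N := N + 1)
      (fun I J => (h I J).of_le (by rw [List.length_cons]; lia)) I J) C I J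

lemma timeDeriv_foldr_lieZ (L : List (Fin 3))
    (h : ∀ I J, SlabC (L.length + 1) T (fun t => ξ t I J)) (ht : t ∈ Ico 0 T) :
    timeDeriv T (fun s => L.foldr lieZ (ξ s)) t = L.foldr lieZ (timeDeriv T ξ t) := by
  induction L with
  | nil => rfl
  | cons C L ih =>
    have hreg (I J) : SlabC 2 T (fun t => L.foldr lieZ (ξ t) I J) :=
      SlabC.foldr_lieZ L (fun I J => (h I J).of_le (by rw [List.length_cons]; lia)) I J
    simp only [List.foldr_cons]
    rw [timeDeriv_lieZ (ξ := fun t => L.foldr lieZ (ξ t)) hreg ht C,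
      ih fun I J => (h I J).of_le (by rw [List.length_cons]; lia)]

lemma timeDeriv_lieI (W : Fin M → Fin 3) (h : ∀ I J, SlabC (M + 1) T (fun t => ξ t I J))
    (ht : t ∈ Ico 0 T) : timeDeriv T (fun s => lieI W (ξ s)) t = lieI W (timeDeriv T ξ t) :=
  timeDeriv_foldr_lieZ (List.ofFn W) (fun I J => by simpa using h I J) ht

end LieDerivative

/-! ### Pointwise norms -/

/-- The frame components of `h` and of its inverse are bounded by `H`, and `1 ≤ H`. -/
structure FrameBounded (H : ℝ) (h : MatrixField) : Prop where
  one_le : 1 ≤ H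
  abs_le : ∀ p A B, |h p A B| ≤ H
  abs_inv_le : ∀ p A B, |(h p)⁻¹ A B| ≤ H

lemma FrameBounded.round : FrameBounded 1 St := by
  have hone (A B : Fin 3) : |(1 : Matrix (Fin 3) (Fin 3) ℝ) A B| ≤ 1 := by
    rw [Matrix.one_apply]
    split_ifs <;> simp
  exact ⟨le_rfl, fun _ => hone, fun _ A B => by simpa [St] using hone A B⟩

lemma prod_one_apply {k : ℕ} (I I' : Fin k → Fin 3) :
    ∏ i, (1 : Matrix (Fin 3) (Fin 3) ℝ) (I i) (I' i) = if I = I' then 1 else 0 := by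
  simp only [Matrix.one_apply, Finset.prod_ite_zero, Finset.prod_const_one, funext_iff,
    Finset.mem_univ, true_implies]

section Norms

variable {l m M N : ℕ} {s : Finset ℕ} {h : MatrixField} {ξ : Tensor l m} {p : S3}
  {H B b T t : ℝ}

lemma pnorm_St (ξ : Tensor l m) (p : S3) :
    pnorm St ξ p = Real.sqrt (∑ I, ∑ J, ξ I J p ^ 2) := by
  simp only [pnorm, St, inv_one, prod_one_apply, ite_mul, mul_ite, one_mul, zero_mul, mul_zero,
    Finset.sum_ite_irrel, Finset.sum_const_zero, Finset.sum_ite_eq, Finset.mem_univ, if_true, sq]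

lemma abs_le_pnorm_St (ξ : Tensor l m) (I : Fin l → Fin 3) (J : Fin m → Fin 3)
    (p : S3) : |ξ I J p| ≤ pnorm St ξ p := by
  rw [pnorm_St]
  refine Real.abs_le_sqrt ?_
  calc ξ I J p ^ 2 ≤ ∑ J, ξ I J p ^ 2 :=
        Finset.single_le_sum (f := fun J => ξ I J p ^ 2) (fun _ _ => sq_nonneg _)
          (Finset.mem_univ J)
    _ ≤ ∑ I, ∑ J, ξ I J p ^ 2 :=
        Finset.single_le_sum (f := fun I => ∑ J, ξ I J p ^ 2)
          (fun _ _ => Finset.sum_nonneg fun _ _ => sq_nonneg _) (Finset.mem_univ I)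

lemma abs_prod_le_pow {k : ℕ} {c : Fin k → ℝ} (hc : ∀ i, |c i| ≤ H) : |∏ i, c i| ≤ H ^ k := by
  rw [Finset.abs_prod]
  simpa using Finset.prod_le_prod (s := Finset.univ) (fun i _ => abs_nonneg (c i))
    fun i _ => hc i

lemma FrameBounded.pnorm_le (hh : FrameBounded H h) (hξ : ∀ I J, |ξ I J p| ≤ B) :
    pnorm h ξ p ≤ 3 ^ (l + m) * H ^ (l + m) * B := by
  have hB : 0 ≤ B := (abs_nonneg _).trans (hξ (fun _ => 0) (fun _ => 0))
  have hH : 0 ≤ H := zero_le_one.trans hh.one_le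
  have hterm : ∀ I I' J J', (∏ i, h p (I i) (I' i)) * (∏ j, (h p)⁻¹ (J j) (J' j)) * ξ I J p
      * ξ I' J' p ≤ H ^ l * H ^ m * B * B := fun I I' J J' => by
    refine (le_abs_self _).trans ?_
    rw [abs_mul, abs_mul, abs_mul]
    gcongr
    exacts [abs_prod_le_pow fun i => hh.abs_le p _ _, abs_prod_le_pow fun j => hh.abs_inv_le p _ _,
      hξ I J, hξ I' J']
  refine Real.sqrt_le_iff.mpr ⟨by positivity, ?_⟩
  calc _ ≤ ∑ _ : Fin l → Fin 3, ∑ _ : Fin l → Fin 3, ∑ _ : Fin m → Fin 3, ∑ _ : Fin m → Fin 3,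
        H ^ l * H ^ m * B * B :=
        Finset.sum_le_sum fun I _ => Finset.sum_le_sum fun I' _ => Finset.sum_le_sum fun J _ =>
          Finset.sum_le_sum fun J' _ => hterm I I' J J'
    _ = (3 ^ (l + m)) ^ 2 * (H ^ (l + m) * B ^ 2) := by
        simp only [Finset.sum_const, Finset.card_univ, Fintype.card_fun, Fintype.card_fin,
          nsmul_eq_mul]
        push_cast
        ring
    _ ≤ (3 ^ (l + m)) ^ 2 * (H ^ (l + m) * (H ^ (l + m) * B ^ 2)) := by
        gcongr
        exact le_mul_of_one_le_left (by positivity) (one_le_pow₀ hh.one_le)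
    _ = _ := by ring

lemma supNorm_le (hξ : ∀ p, pnorm h ξ p ≤ B) : supNorm h ξ ≤ B :=
  have : Nonempty S3 := ⟨radial 0⟩
  ciSup_le hξ

lemma abs_le_supNorm_St (hξ : ∀ I J p, |ξ I J p| ≤ B) (I : Fin l → Fin 3) (J : Fin m → Fin 3)
    (p : S3) : |ξ I J p| ≤ supNorm St ξ := by
  refine (abs_le_pnorm_St ξ I J p).trans (le_ciSup (f := fun p => pnorm St ξ p) ?_ p)
  refine ⟨3 ^ (l + m) * 1 ^ (l + m) * B, ?_⟩
  rintro _ ⟨q, rfl⟩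
  exact FrameBounded.round.pnorm_le fun I J => hξ I J q

/-- The combinatorial factor by which a bound for the components of a tensor field of type
`(l, m)` is multiplied in the resulting bound for `sumSup`. -/
def sumFactor (l m : ℕ) (s : Finset ℕ) : ℝ :=
  ∑ N ∈ s, 3 ^ N * (3 ^ (l + m) * lieFactor l m ^ N)

lemma sumFactor_nonneg (l m : ℕ) (s : Finset ℕ) : 0 ≤ sumFactor l m s := by
  have := zero_le_one.trans (one_le_lieFactor l m)
  exact Finset.sum_nonneg fun N _ => by positivity

lemma FrameBounded.sumSup_le (hh : FrameBounded H h) (hs : ∀ N ∈ s, N ≤ M)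
    (hξ : TensorBound M ξ B) : sumSup h s ξ ≤ sumFactor l m s * (H ^ (l + m) * B) := by
  unfold sumSup sumFactor
  rw [Finset.sum_mul]
  refine Finset.sum_le_sum fun N hN => ?_
  have hLie (W : Fin N → Fin 3) : TensorBound 0 (lieI W ξ) (lieFactor l m ^ N * B) :=
    TensorBound.lieI (N := 0) W fun I J => (hξ I J).of_le (by simpa using hs N hN)
  calc _ ≤ ∑ _ : Fin N → Fin 3, 3 ^ (l + m) * H ^ (l + m) * (lieFactor l m ^ N * B) :=
        Finset.sum_le_sum fun W _ => supNorm_le fun p =>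
          hh.pnorm_le fun I J => (hLie W I J).abs_le p
    _ = _ := by
        simp only [Finset.sum_const, Finset.card_univ, Fintype.card_fun, Fintype.card_fin,
          nsmul_eq_mul]
        push_cast
        ring

lemma sumSup_St_le (hs : ∀ N ∈ s, N ≤ M) (hξ : TensorBound M ξ B) :
    sumSup St s ξ ≤ sumFactor l m s * B := by
  simpa only [one_pow, one_mul] using FrameBounded.round.sumSup_le hs hξ

lemma sumSupDt_St_le {ξ : ℝ → Tensor l m} (hr : ∀ I J, SlabC (M + 1) T (fun t => ξ t I J))
    (ht : t ∈ Ico 0 T) (hs : ∀ N ∈ s, N ≤ M) (hξ : TensorBound M (timeDeriv T ξ t) B) :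
    sumSupDt T St s ξ t ≤ sumFactor l m s * B := by
  have hcomm : sumSupDt T St s ξ t = sumSup St s (timeDeriv T ξ t) :=
    Finset.sum_congr rfl fun N hN => Finset.sum_congr rfl fun W _ => by
      rw [timeDeriv_lieI W (fun I J => (hr I J).of_le (Nat.succ_le_succ (hs N hN))) ht]
  exact hcomm.trans_le (sumSup_St_le hs hξ)

lemma exists_tensorBound_of_slabC (hξ : ∀ I J, SlabC M 1 (fun _ => ξ I J)) :
    ∃ B, TensorBound M ξ B := by
  choose B hB using fun I J => (hξ I J).exists_derivBound ⟨le_rfl, one_pos⟩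
  refine ⟨∑ I, ∑ J, |B I J|, fun I J =>
    (hB I J 0 ⟨le_rfl, le_rfl⟩).mono ?_⟩
  calc B I J ≤ |B I J| := le_abs_self _
    _ ≤ ∑ J, |B I J| := Finset.single_le_sum (f := fun J => |B I J|)
        (fun _ _ => abs_nonneg _) (Finset.mem_univ J)
    _ ≤ ∑ I, ∑ J, |B I J| := Finset.single_le_sum (f := fun I => ∑ J, |B I J|)
        (fun _ _ => Finset.sum_nonneg fun _ _ => abs_nonneg _) (Finset.mem_univ I)

lemma supNorm_lieI_le_normC (hN : N ≤ M) (ξ : Tensor l m) (W : Fin N → Fin 3) :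
    supNorm St (lieI W ξ) ≤ normC M ξ := by
  refine (le_abs_self _).trans (Real.abs_le_sqrt ?_)
  calc _ ≤ ∑ W : Fin N → Fin 3, supNorm St (lieI W ξ) ^ 2 :=
        Finset.single_le_sum (f := fun W : Fin N → Fin 3 => supNorm St (lieI W ξ) ^ 2)
          (fun _ _ => sq_nonneg _) (Finset.mem_univ W)
    _ ≤ _ := Finset.single_le_sum
          (f := fun N => ∑ W : Fin N → Fin 3, supNorm St (lieI W ξ) ^ 2)
          (fun _ _ => Finset.sum_nonneg fun _ _ => sq_nonneg _)
          (Finset.mem_range.mpr (Nat.lt_succ_of_le hN))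

lemma TensorBound.of_normC (hξ : ∀ I J, SlabC M 1 (fun _ => ξ I J)) (hb : normC M ξ ≤ b) :
    TensorBound M ξ (lieFactor l m ^ M * b) := by
  obtain ⟨B, hB⟩ := exists_tensorBound_of_slabC hξ
  refine TensorBound.of_lieI hξ fun N hN W I J p => ?_
  have hLie : TensorBound 0 (EinsteinScalar.lieI W ξ) (lieFactor l m ^ N * B) :=
    TensorBound.lieI (N := 0) W fun I J => (hB I J).of_le (by simpa using hN)
  exact (abs_le_supNorm_St (fun I J p => (hLie I J).abs_le p) I J p).trans
    ((supNorm_lieI_le_normC hN ξ W).trans hb)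

end Norms

/-! ### The scale factor -/

/-- A time function comparable with `-log (a t)`. Its derivative dominates `1 / a` also near
`t = 0`, where that of `-log a` vanishes. -/
def logTime (a : ℝ → ℝ) (t : ℝ) : ℝ := t - Real.log (a t)

namespace IsScaleFactor

variable {T t θ : ℝ} {a : ℝ → ℝ}

lemma hasDerivWithinAt (h : IsScaleFactor T a) (ht : t ∈ Ico 0 T) :
    HasDerivWithinAt a (dt T a t) (Ico 0 T) t := (h.diff t ht).hasDerivWithinAt

lemma hasDerivWithinAt_rpow (h : IsScaleFactor T a) (ht : t ∈ Ico 0 T) (q : ℝ) :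
    HasDerivWithinAt (fun s => a s ^ q) (q * a t ^ (q - 1) * dt T a t) (Ico 0 T) t := by
  convert (h.hasDerivWithinAt ht).rpow_const (p := q) (Or.inl (h.pos t ht).ne') using 1
  ring

lemma contDiffOn_and_contDiffOn_dt (h : IsScaleFactor T a) (N : ℕ) :
    ContDiffOn ℝ N a (Ico 0 T) ∧ ContDiffOn ℝ N (dt T a) (Ico 0 T) := by
  have hu := uniqueDiffOn_Ico (0 : ℝ) T
  induction N with
  | zero =>
    exact ⟨contDiffOn_zero.mpr h.diff.continuousOn,
      contDiffOn_zero.mpr fun t ht => (h.ode t ht).continuousWithinAt⟩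
  | succ N ih =>
    push_cast
    rw [contDiffOn_succ_iff_derivWithin hu, contDiffOn_succ_iff_derivWithin hu]
    have hrhs : ContDiffOn ℝ N (fun t => -(2 / 3) * a t ^ (1 / 3 : ℝ)) (Ico 0 T) :=
      contDiffOn_const.mul (ih.1.rpow_const_of_ne fun t ht => (h.pos t ht).ne')
    exact ⟨⟨h.diff, by simp, ih.2⟩, fun t ht => (h.ode t ht).differentiableWithinAt, by simp,
      hrhs.congr fun t ht => (h.ode t ht).derivWithin (hu t ht)⟩

lemma contDiffOn (h : IsScaleFactor T a) (N : ℕ) : ContDiffOn ℝ N a (Ico 0 T) :=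
  (h.contDiffOn_and_contDiffOn_dt N).1

lemma contDiffOn_rpow (h : IsScaleFactor T a) (N : ℕ) (q : ℝ) :
    ContDiffOn ℝ N (fun t => a t ^ q) (Ico 0 T) :=
  (h.contDiffOn N).rpow_const_of_ne fun t ht => (h.pos t ht).ne'

lemma dt_sq (h : IsScaleFactor T a) (ht : t ∈ Ico 0 T) :
    dt T a t ^ 2 = 1 - a t ^ (4 / 3 : ℝ) := by
  have henergy : ∀ t ∈ Ico 0 T, HasDerivWithinAt
      (fun t => dt T a t ^ 2 + a t ^ (4 / 3 : ℝ) - 1) 0 (Ico 0 T) t := fun t ht => by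
    refine (((h.ode t ht).pow 2).add (h.hasDerivWithinAt_rpow ht (4 / 3))).sub_const 1
      |>.congr_deriv ?_
    rw [show (4 / 3 : ℝ) - 1 = 1 / 3 by norm_num]
    push_cast
    ring
  have hconst := abs_nonpos_iff.mp <| abs_le_of_hasDerivWithinAt_le henergy
    (fun t _ => hasDerivWithinAt_const t _ (0 : ℝ)) ht (by simp [h.init, h.init_deriv]) (by simp)
  linarith

lemma dt_nonpos (h : IsScaleFactor T a) (ht : t ∈ Ico 0 T) : dt T a t ≤ 0 :=
  le_of_hasDerivWithinAt_le h.ode (fun t _ => hasDerivWithinAt_const t _ (0 : ℝ)) ht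
    h.init_deriv.le fun s hs => by
      have := Real.rpow_nonneg (h.pos s ⟨hs.1, hs.2.trans_lt ht.2⟩).le (1 / 3 : ℝ)
      linarith

lemma le_one (h : IsScaleFactor T a) (ht : t ∈ Ico 0 T) : a t ≤ 1 :=
  le_of_hasDerivWithinAt_le (fun _ ht => h.hasDerivWithinAt ht)
    (fun t _ => hasDerivWithinAt_const t _ (1 : ℝ)) ht
    h.init.le fun _ hs => h.dt_nonpos ⟨hs.1, hs.2.trans_lt ht.2⟩

lemma abs_dt_le_one (h : IsScaleFactor T a) (ht : t ∈ Ico 0 T) : |dt T a t| ≤ 1 := by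
  rw [← sq_le_one_iff_abs_le_one, h.dt_sq ht]
  linarith [Real.rpow_nonneg (h.pos t ht).le (4 / 3 : ℝ)]

lemma rpow_le_rpow (h : IsScaleFactor T a) (ht : t ∈ Ico 0 T) {q r : ℝ} (hqr : r ≤ q) :
    a t ^ q ≤ a t ^ r :=
  Real.rpow_le_rpow_of_exponent_ge (h.pos t ht) (h.le_one ht) hqr

/- Sturm comparison with `s ↦ cos (4 s / 5)`: as `(4 / 5)² ≤ 2 / 3` and `a ≤ a ^ (1 / 3)`, the
quantity `a' cos (4 s / 5) + (4 / 5) a sin (4 s / 5)` is non-increasing up to `s = 5 π / 8`. -/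
lemma sturm_le_zero (h : IsScaleFactor T a) (ht : t ∈ Ico 0 T) (htπ : t ≤ 5 * Real.pi / 8) :
    dt T a t * Real.cos (4 / 5 * t) + 4 / 5 * (a t * Real.sin (4 / 5 * t)) ≤ 0 := by
  have hcos (s : ℝ) : HasDerivAt (fun s => Real.cos (4 / 5 * s))
      (-Real.sin (4 / 5 * s) * (4 / 5)) s := by
    simpa using ((hasDerivAt_id s).const_mul (4 / 5)).cos
  have hsin (s : ℝ) : HasDerivAt (fun s => Real.sin (4 / 5 * s))
      (Real.cos (4 / 5 * s) * (4 / 5)) s := by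
    simpa using ((hasDerivAt_id s).const_mul (4 / 5)).sin
  refine le_of_hasDerivWithinAt_le
    (f := fun s => dt T a s * Real.cos (4 / 5 * s) + 4 / 5 * (a s * Real.sin (4 / 5 * s)))
    (fun s hs => ((h.ode s hs).mul (hcos s).hasDerivWithinAt).add
      (((h.hasDerivWithinAt hs).mul (hsin s).hasDerivWithinAt).const_mul (4 / 5)))
    (fun t _ => hasDerivWithinAt_const t _ (0 : ℝ)) ht (by simp [h.init_deriv]) fun s hs => ?_
  have hs' : s ∈ Ico 0 T := ⟨hs.1, hs.2.trans_lt ht.2⟩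
  have hcos_nonneg : 0 ≤ Real.cos (4 / 5 * s) :=
    Real.cos_nonneg_of_neg_pi_div_two_le_of_le (by linarith [hs.1, Real.pi_pos])
      (by linarith [hs.2])
  have hroot : a s ≤ a s ^ (1 / 3 : ℝ) := by
    simpa using h.rpow_le_rpow hs' (show (1 / 3 : ℝ) ≤ 1 by norm_num)
  have hdefect : 0 ≤ Real.cos (4 / 5 * s) * (2 / 3 * a s ^ (1 / 3 : ℝ) - 16 / 25 * a s) :=
    mul_nonneg hcos_nonneg (by linarith [h.pos s hs'])
  linarith

lemma le_two (h : IsScaleFactor T a) (ht : t ∈ Ico 0 T) : t ≤ 2 := by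
  by_contra! hlt
  have hmem : 5 * Real.pi / 8 ∈ Ico 0 T := ⟨by positivity, by linarith [ht.2, Real.pi_lt_d2]⟩
  have hsturm := h.sturm_le_zero hmem le_rfl
  rw [show (4 / 5 : ℝ) * (5 * Real.pi / 8) = Real.pi / 2 by ring, Real.cos_pi_div_two,
    Real.sin_pi_div_two] at hsturm
  linarith [h.pos _ hmem]

lemma hasDerivWithinAt_logTime (h : IsScaleFactor T a) (ht : t ∈ Ico 0 T) :
    HasDerivWithinAt (logTime a) (1 - dt T a t / a t) (Ico 0 T) t :=
  (hasDerivWithinAt_id t _).sub ((h.hasDerivWithinAt ht).log (h.pos t ht).ne')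

lemma inv_le_deriv_logTime (h : IsScaleFactor T a) (ht : t ∈ Ico 0 T) :
    (a t)⁻¹ ≤ 1 - dt T a t / a t := by
  have ha := h.pos t ht
  have hpow : a t ^ (4 / 3 : ℝ) ≤ a t := by
    simpa using h.rpow_le_rpow ht (show (1 : ℝ) ≤ 4 / 3 by norm_num)
  have hdt : 1 - a t ≤ -dt T a t :=
    (abs_le_of_sq_le_sq' (by nlinarith [h.dt_sq ht, h.le_one ht])
      (by linarith [h.dt_nonpos ht])).2
  calc (a t)⁻¹ ≤ (a t - dt T a t) / a t := by
        rw [inv_eq_one_div]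
        gcongr
        linarith
    _ = 1 - dt T a t / a t := by rw [sub_div, div_self ha.ne']

lemma logTime_zero (h : IsScaleFactor T a) : logTime a 0 = 0 := by
  simp [logTime, h.init]

lemma logTime_nonneg (h : IsScaleFactor T a) (ht : t ∈ Ico 0 T) : 0 ≤ logTime a t :=
  sub_nonneg.mpr ((Real.log_nonpos (h.pos t ht).le (h.le_one ht)).trans ht.1)

lemma exp_mul_logTime_le (h : IsScaleFactor T a) (ht : t ∈ Ico 0 T) (hθ : 0 ≤ θ) :
    Real.exp (θ * logTime a t) ≤ Real.exp (2 * θ) * a t ^ (-θ) := by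
  rw [Real.rpow_def_of_pos (h.pos t ht), ← Real.exp_add, logTime]
  exact Real.exp_le_exp.mpr (by nlinarith [h.le_two ht])

lemma rpow_neg_le_exp (h : IsScaleFactor T a) (ht : t ∈ Ico 0 T) (hθ : 0 ≤ θ) :
    a t ^ (-θ) ≤ Real.exp (θ * logTime a t) := by
  rw [Real.rpow_def_of_pos (h.pos t ht), logTime]
  exact Real.exp_le_exp.mpr (by nlinarith [ht.1])

end IsScaleFactor

/-! ### Constant rescalings of the metric -/

lemma hess_eq (h : MatrixField) (f : S3 → ℝ) (A B : Fin 3) (p : S3) :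
    hess h f A B p = Zder A (Zder B f) p - ∑ D, conn h A D B p * Zder D f p := by
  have hformT : formT (fun A => Zder A f) ![] ![B] = Zder B f := rfl
  simp [hess, covD, dT, hformT]
  simp [formT]

section ConstSMul

variable {c : ℝ} {h : MatrixField}

lemma inv_const_smul (hc : c ≠ 0) {M : Matrix (Fin 3) (Fin 3) ℝ} (hM : IsUnit M.det) :
    (c • M)⁻¹ = c⁻¹ • M⁻¹ :=
  Matrix.inv_smul' M (Units.mk0 c hc) hM

lemma gammaLow_const_smul (c : ℝ) (h : MatrixField) (A C B : Fin 3) (p : S3) :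
    gammaLow (fun p => c • h p) A C B p = c * gammaLow h A C B p := by
  simp only [gammaLow, Matrix.smul_apply, smul_eq_mul, Zder_const_mul, Fin.sum_univ_three]
  ring

lemma conn_const_smul (hc : c ≠ 0) (hh : ∀ p, IsUnit (h p).det) (A D B : Fin 3) :
    conn (fun p => c • h p) A D B = conn h A D B := by
  funext p
  simp only [conn, gammaLow_const_smul, inv_const_smul hc (hh p), Matrix.smul_apply, smul_eq_mul]
  refine Finset.sum_congr rfl fun C _ => ?_
  field_simp

lemma RicSharp_const_smul (hc : c ≠ 0) (hh : ∀ p, IsUnit (h p).det) (p : S3) :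
    RicSharp (fun p => c • h p) p = c⁻¹ • RicSharp h p := by
  have hRic : Ric (fun p => c • h p) p = Ric h p := by
    ext B C
    simp only [Ric, curv, conn_const_smul hc hh]
  rw [RicSharp, RicSharp, hRic, inv_const_smul hc (hh p), Matrix.smul_mul]

lemma hess_const_smul (hc : c ≠ 0) (hh : ∀ p, IsUnit (h p).det) (f : S3 → ℝ) (A B : Fin 3)
    (p : S3) : hess (fun p => c • h p) f A B p = hess h f A B p := by
  simp only [hess_eq, conn_const_smul hc hh]

lemma lap_const_smul (hc : c ≠ 0) (hh : ∀ p, IsUnit (h p).det) (f : S3 → ℝ) (p : S3) :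
    lap (fun p => c • h p) f p = c⁻¹ * lap h f p := by
  simp only [lap, hess_const_smul hc hh, inv_const_smul hc (hh p), Matrix.smul_apply, smul_eq_mul,
    Finset.mul_sum, mul_assoc]

lemma gradInner_const_smul (hc : c ≠ 0) (hh : ∀ p, IsUnit (h p).det) (f f' : S3 → ℝ) (p : S3) :
    gradInner (fun p => c • h p) f f' p = c⁻¹ * gradInner h f f' p := by
  simp only [gradInner, inv_const_smul hc (hh p), Matrix.smul_apply, smul_eq_mul,
    Finset.mul_sum, mul_assoc]

end ConstSMul

lemma Zder_affine (c b : ℝ) (f : S3 → ℝ) (A : Fin 3) :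
    Zder A (fun p => c + b * f p) = fun p => b * Zder A f p := by
  rw [← Zder_const_mul, ← Zder_sub_const (-c) (fun p => b * f p)]
  congr 1
  funext p
  ring

lemma hess_affine (h : MatrixField) (c b : ℝ) (f : S3 → ℝ) (A B : Fin 3) (p : S3) :
    hess h (fun p => c + b * f p) A B p = b * hess h f A B p := by
  simp only [hess_eq, Zder_affine, Zder_const_mul, mul_sub, Finset.mul_sum, mul_left_comm]

lemma lap_affine (h : MatrixField) (c b : ℝ) (f : S3 → ℝ) (p : S3) :
    lap h (fun p => c + b * f p) p = b * lap h f p := by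
  simp only [lap, hess_affine, Finset.mul_sum, mul_left_comm]

lemma gradInner_affine_left (h : MatrixField) (c b : ℝ) (f f' : S3 → ℝ) (p : S3) :
    gradInner h (fun p => c + b * f p) f' p = b * gradInner h f f' p := by
  simp only [gradInner, Zder_affine, Finset.mul_sum]
  refine Finset.sum_congr rfl fun A _ => Finset.sum_congr rfl fun B _ => ?_
  ring

/-! ### Regularity of the rescaled variables -/

namespace SlabC

variable {N : ℕ} {T : ℝ} {M : ℝ → MatrixField}

lemma prod {ι : Type*} {s : Finset ι} {u : ι → ℝ → S3 → ℝ} (hu : ∀ i ∈ s, SlabC N T (u i)) :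
    SlabC N T (fun t p => ∏ i ∈ s, u i t p) :=
  contDiffOn_prod hu

lemma det (h : ∀ A B, SlabC N T (fun t p => M t p A B)) : SlabC N T (fun t p => (M t p).det) := by
  simp only [Matrix.det_apply']
  exact SlabC.sum fun σ _ => (SlabC.const N T _).mul (SlabC.prod fun i _ => h _ _)

lemma matrix_inv (h : ∀ A B, SlabC N T (fun t p => M t p A B))
    (hd : ∀ t ∈ Ico 0 T, ∀ p, (M t p).det ≠ 0) (A B : Fin 3) :
    SlabC N T (fun t p => (M t p)⁻¹ A B) := by
  simp only [Matrix.inv_def, Matrix.smul_apply, smul_eq_mul, Ring.inverse_eq_inv',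
    Matrix.adjugate_apply]
  refine ((SlabC.det h).inv hd).mul (SlabC.det (M := fun t p =>
    (M t p).updateRow B (Pi.single A 1)) fun C D => ?_)
  obtain rfl | hC := eq_or_ne C B
  · simp only [Matrix.updateRow_self]
    exact SlabC.const N T _
  · simp only [Matrix.updateRow_ne hC]
    exact h C D

end SlabC

namespace IsSolution

variable {T t : ℝ} {a : ℝ → ℝ} {g k : ℝ → MatrixField} {n φ : ℝ → S3 → ℝ}

lemma slabC_resMetric (h : IsSolution T a g k n φ) (ha : IsScaleFactor T a) (A B : Fin 3) :
    SlabC 17 T (fun t p => resMetric a g t p A B) :=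
  (SlabC.of_time (ha.contDiffOn_rpow 17 _)).mul (h.reg_g A B)

lemma isUnit_det_metric (h : IsSolution T a g k n φ) (ht : t ∈ Ico 0 T) (p : S3) :
    IsUnit (g t p).det := (h.metric t ht p).det_pos.ne'.isUnit

lemma isUnit_det_resMetric (h : IsSolution T a g k n φ) (ha : IsScaleFactor T a)
    (ht : t ∈ Ico 0 T) (p : S3) : IsUnit (resMetric a g t p).det := by
  rw [resMetric, Matrix.det_smul]
  exact (mul_ne_zero (pow_ne_zero _ (Real.rpow_pos_of_pos (ha.pos t ht) _).ne')
    (h.isUnit_det_metric ht p).ne_zero).isUnit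

lemma slabC_resInv (h : IsSolution T a g k n φ) (ha : IsScaleFactor T a) (A B : Fin 3) :
    SlabC 17 T (fun t p => resInv a g t p A B) :=
  SlabC.matrix_inv (h.slabC_resMetric ha)
    (fun _ ht p => (h.isUnit_det_resMetric ha ht p).ne_zero) A B

lemma slabC_resK (h : IsSolution T a g k n φ) (ha : IsScaleFactor T a) (A B : Fin 3) :
    SlabC 16 T (fun t p => resK a k t p A B) := by
  have htrace : SlabC 16 T (fun t p => (k t p).trace) := SlabC.sum fun C _ => h.reg_k C C
  exact (SlabC.of_time (ha.contDiffOn 16)).mul ((h.reg_k A B).sub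
    (((SlabC.const 16 T (1 / 3)).mul htrace).mul (SlabC.const 16 T _)))

lemma slabC_resLapse (h : IsSolution T a g k n φ) (ha : IsScaleFactor T a) :
    SlabC 18 T (resLapse a n) :=
  (SlabC.of_time (ha.contDiffOn_rpow 18 _)).mul (h.reg_n.sub (SlabC.const 18 T 1))

lemma slabC_normalDeriv (h : IsSolution T a g k n φ) :
    SlabC 16 T (fun t p => normalDeriv T n φ t p) :=
  ((h.reg_n.of_le (by norm_num)).inv fun t ht p => (h.lapse_pos t ht p).ne').mul
    (SlabC.dt (N := 16) h.reg_φ)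

lemma slabC_timeScalar (h : IsSolution T a g k n φ) (ha : IsScaleFactor T a) :
    SlabC 16 T (fun t p => timeScalar T a n φ t p) :=
  ((SlabC.of_time (ha.contDiffOn 16)).mul h.slabC_normalDeriv).sub (SlabC.const 16 T _)

lemma slabC_dT (h : IsSolution T a g k n φ) (A : Fin 3) : SlabC 16 T (fun t => Zder A (φ t)) :=
  SlabC.zder (N := 16) h.reg_φ A

end IsSolution

/-! ### Evolution equations of the rescaled variables -/

/-- The cube root of the scale factor. -/
def cbrt (a : ℝ → ℝ) (t : ℝ) : ℝ := a t ^ (1 / 3 : ℝ)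

namespace IsScaleFactor

variable {T t : ℝ} {a : ℝ → ℝ}

lemma cbrt_pos (ha : IsScaleFactor T a) (ht : t ∈ Ico 0 T) : 0 < cbrt a t :=
  Real.rpow_pos_of_pos (ha.pos t ht) _

lemma cbrt_le_one (ha : IsScaleFactor T a) (ht : t ∈ Ico 0 T) : cbrt a t ≤ 1 :=
  Real.rpow_le_one (ha.pos t ht).le (ha.le_one ht) (by norm_num)

lemma rpow_eq_cbrt_pow (ha : IsScaleFactor T a) (ht : t ∈ Ico 0 T) {q : ℝ} (m : ℕ)
    (hq : 3 * q = m) : a t ^ q = cbrt a t ^ m := by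
  rw [cbrt, ← Real.rpow_natCast, ← Real.rpow_mul (ha.pos t ht).le, ← hq]
  congr 1
  ring

lemma rpow_neg_eq_inv_cbrt_pow (ha : IsScaleFactor T a) (ht : t ∈ Ico 0 T) {q : ℝ} (m : ℕ)
    (hq : 3 * q = m) : a t ^ (-q) = (cbrt a t ^ m)⁻¹ := by
  rw [Real.rpow_neg (ha.pos t ht).le, ha.rpow_eq_cbrt_pow ht m hq]

lemma eq_cbrt_pow (ha : IsScaleFactor T a) (ht : t ∈ Ico 0 T) : a t = cbrt a t ^ 3 := by
  simpa using ha.rpow_eq_cbrt_pow ht (q := 1) 3 (by norm_num)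

lemma dt_sq_cbrt (ha : IsScaleFactor T a) (ht : t ∈ Ico 0 T) :
    dt T a t ^ 2 = 1 - cbrt a t ^ 4 := by
  rw [ha.dt_sq ht, ha.rpow_eq_cbrt_pow ht 4 (by norm_num)]

lemma hubble_sq (ha : IsScaleFactor T a) (ht : t ∈ Ico 0 T) :
    hubble T a t ^ 2 = (cbrt a t ^ 6)⁻¹ - (cbrt a t ^ 2)⁻¹ := by
  have hx := ha.cbrt_pos ht
  rw [hubble, div_pow, ha.dt_sq_cbrt ht, ha.eq_cbrt_pow ht]
  field_simp

lemma dt_hubble (ha : IsScaleFactor T a) (ht : t ∈ Ico 0 T) :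
    dt T (hubble T a) t = -(2 / 3) * (cbrt a t ^ 2)⁻¹ - hubble T a t ^ 2 := by
  have hx := ha.cbrt_pos ht
  refine (dt_eq ((ha.ode t ht).div (ha.hasDerivWithinAt ht) (ha.pos t ht).ne') ht).trans ?_
  change (-(2 / 3) * cbrt a t * _ - _) / _ = _
  rw [hubble, ha.eq_cbrt_pow ht]
  field_simp

lemma lapse_eq (ha : IsScaleFactor T a) (ht : t ∈ Ico 0 T) (n : ℝ → S3 → ℝ) :
    n t = fun p => 1 + cbrt a t ^ 4 * resLapse a n t p := by
  funext p
  have hx := ha.cbrt_pos ht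
  rw [resLapse, ha.rpow_neg_eq_inv_cbrt_pow ht 4 (by norm_num)]
  field_simp
  ring

lemma resMetric_eq (ha : IsScaleFactor T a) (ht : t ∈ Ico 0 T) (g : ℝ → MatrixField) :
    resMetric a g t = fun p => (cbrt a t ^ 2)⁻¹ • g t p := by
  funext p
  rw [resMetric, ha.rpow_neg_eq_inv_cbrt_pow ht 2 (by norm_num)]

end IsScaleFactor

lemma SlabC.dt_matrix_inv {N : ℕ} {T t : ℝ} {M : ℝ → MatrixField}
    (h : ∀ A B, SlabC (N + 1) T (fun t p => M t p A B))
    (hd : ∀ t ∈ Ico 0 T, ∀ p, IsUnit (M t p).det) (ht : t ∈ Ico 0 T) (p : S3) :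
    Matrix.of (fun A B => dt T (fun s => (M s p)⁻¹ A B) t)
      = -((M t p)⁻¹ * Matrix.of (fun A B => dt T (fun s => M s p A B) t) * (M t p)⁻¹) := by
  set M' : Matrix (Fin 3) (Fin 3) ℝ := Matrix.of fun A B => dt T (fun s => M s p A B) t
  set D : Matrix (Fin 3) (Fin 3) ℝ := Matrix.of fun A B => dt T (fun s => (M s p)⁻¹ A B) t
  have hprod : M' * (M t p)⁻¹ + M t p * D = 0 := by
    ext A B
    have hderiv := HasDerivWithinAt.fun_sum fun (C : Fin 3) (_ : C ∈ Finset.univ) =>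
      ((h A C).hasDerivWithinAt_dt ht p).mul
        ((SlabC.matrix_inv h (fun t ht p => (hd t ht p).ne_zero) C B).hasDerivWithinAt_dt ht p)
    have hconst : dt T (fun s => ∑ C, M s p A C * (M s p)⁻¹ C B) t = 0 :=
      (dt_congr (fun s hs => by rw [← Matrix.mul_apply, Matrix.mul_nonsing_inv _ (hd s hs p)])
        ht).trans (dt_eq (hasDerivWithinAt_const t _ _) ht)
    rw [Matrix.add_apply, Matrix.mul_apply, Matrix.mul_apply, ← Finset.sum_add_distrib]
    exact (dt_eq hderiv ht).symm.trans hconst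
  calc D = (M t p)⁻¹ * (M t p * D) := by
        rw [← Matrix.mul_assoc, Matrix.nonsing_inv_mul _ (hd t ht p), Matrix.one_mul]
    _ = -((M t p)⁻¹ * M' * (M t p)⁻¹) := by
        rw [eq_neg_of_add_eq_zero_right hprod, Matrix.mul_neg, Matrix.mul_assoc]

lemma trace_mul_self_eq (k : MatrixField) (p : S3) :
    (k p * k p).trace = (traceFree k p * traceFree k p).trace + (1 / 3) * (k p).trace ^ 2 := by
  simp only [traceFree, Matrix.trace_fin_three, Matrix.mul_apply, Fin.sum_univ_three,
    Matrix.sub_apply, Matrix.smul_apply, Matrix.one_apply, smul_eq_mul]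
  simp
  ring

/-- The logarithmic rate of change of the rescaled metric, multiplied by the scale factor. -/
def metricRate (T : ℝ) (a : ℝ → ℝ) (k : ℝ → MatrixField) (n : ℝ → S3 → ℝ) (t : ℝ) :
    MatrixField := fun p =>
  (-2 * n t p) • resK a k t p + (2 / 3 * cbrt a t ^ 4 * dt T a t * resLapse a n t p) • 1

namespace IsSolution

variable {T t : ℝ} {a : ℝ → ℝ} {g k : ℝ → MatrixField} {n φ : ℝ → S3 → ℝ}

section Rescaling

lemma resInv_eq (h : IsSolution T a g k n φ) (ha : IsScaleFactor T a) (ht : t ∈ Ico 0 T)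
    (p : S3) : resInv a g t p = cbrt a t ^ 2 • (g t p)⁻¹ := by
  have hx := ha.cbrt_pos ht
  rw [resInv, ha.resMetric_eq ht, inv_const_smul (by positivity) (h.isUnit_det_metric ht p),
    inv_inv]

lemma RicSharp_resMetric (h : IsSolution T a g k n φ) (ha : IsScaleFactor T a)
    (ht : t ∈ Ico 0 T) (p : S3) :
    RicSharp (resMetric a g t) p = cbrt a t ^ 2 • RicSharp (g t) p := by
  have hx := ha.cbrt_pos ht
  rw [ha.resMetric_eq ht, RicSharp_const_smul (by positivity) (h.isUnit_det_metric ht), inv_inv]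

lemma lap_eq (h : IsSolution T a g k n φ) (ha : IsScaleFactor T a) (ht : t ∈ Ico 0 T)
    (f : S3 → ℝ) (p : S3) : lap (g t) f p = (cbrt a t ^ 2)⁻¹ * lap (resMetric a g t) f p := by
  have hx := ha.cbrt_pos ht
  rw [ha.resMetric_eq ht, lap_const_smul (by positivity) (h.isUnit_det_metric ht)]
  field_simp

lemma gradInner_eq (h : IsSolution T a g k n φ) (ha : IsScaleFactor T a) (ht : t ∈ Ico 0 T)
    (f f' : S3 → ℝ) (p : S3) :
    gradInner (g t) f f' p = (cbrt a t ^ 2)⁻¹ * gradInner (resMetric a g t) f f' p := by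
  have hx := ha.cbrt_pos ht
  rw [ha.resMetric_eq ht, gradInner_const_smul (by positivity) (h.isUnit_det_metric ht)]
  field_simp

lemma hess_lapse (h : IsSolution T a g k n φ) (ha : IsScaleFactor T a) (ht : t ∈ Ico 0 T)
    (A B : Fin 3) (p : S3) : hess (g t) (n t) A B p
      = cbrt a t ^ 4 * hess (resMetric a g t) (resLapse a n t) A B p := by
  have hx := ha.cbrt_pos ht
  rw [ha.resMetric_eq ht, hess_const_smul (by positivity) (h.isUnit_det_metric ht),
    ha.lapse_eq ht n, hess_affine]

lemma lap_lapse (h : IsSolution T a g k n φ) (ha : IsScaleFactor T a) (ht : t ∈ Ico 0 T)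
    (p : S3) :
    lap (g t) (n t) p = cbrt a t ^ 2 * lap (resMetric a g t) (resLapse a n t) p := by
  have hx := ha.cbrt_pos ht
  rw [h.lap_eq ha ht, ha.lapse_eq ht n, lap_affine]
  field_simp

lemma gradInner_lapse (h : IsSolution T a g k n φ) (ha : IsScaleFactor T a) (ht : t ∈ Ico 0 T)
    (f : S3 → ℝ) (p : S3) : gradInner (g t) (n t) f p
      = cbrt a t ^ 2 * gradInner (resMetric a g t) (resLapse a n t) f p := by
  have hx := ha.cbrt_pos ht
  rw [h.gradInner_eq ha ht, ha.lapse_eq ht n, gradInner_affine_left]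
  field_simp

lemma resK_apply (h : IsSolution T a g k n φ) (ha : IsScaleFactor T a) (ht : t ∈ Ico 0 T)
    (p : S3) (A B : Fin 3) :
    resK a k t p A B = a t * k t p A B + (1 / 3) * dt T a t * (1 : Matrix _ _ ℝ) A B := by
  have hpos := ha.pos t ht
  simp only [resK, traceFree, h.cmc t ht p, hubble, Matrix.smul_apply, Matrix.sub_apply,
    smul_eq_mul]
  field_simp
  ring

end Rescaling

lemma evol_resMetric (h : IsSolution T a g k n φ) (ha : IsScaleFactor T a) (ht : t ∈ Ico 0 T)
    (p : S3) (A B : Fin 3) :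
    dt T (fun s => resMetric a g s p A B) t
      = (a t)⁻¹ * (resMetric a g t p * metricRate T a k n t p) A B := by
  have hx := ha.cbrt_pos ht
  have hpos := ha.pos t ht
  have hderiv := (ha.hasDerivWithinAt_rpow ht (-(2 / 3))).mul
    (SlabC.hasDerivWithinAt_dt (N := 16) (h.reg_g A B) ht p)
  have hpow : a t ^ (-(2 / 3) - 1 : ℝ) = (cbrt a t ^ 5)⁻¹ := by
    rw [← ha.rpow_neg_eq_inv_cbrt_pow ht (q := 5 / 3) 5 (by norm_num)]
    norm_num
  have hk : k t p = (a t)⁻¹ • resK a k t p - ((1 / 3) * (a t)⁻¹ * dt T a t) • 1 := by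
    ext C D
    simp only [Matrix.sub_apply, Matrix.smul_apply, smul_eq_mul, h.resK_apply ha ht]
    field_simp
    ring
  rw [h.evol_g t ht p A B, ← Matrix.mul_apply, hpow,
    ha.rpow_neg_eq_inv_cbrt_pow ht 2 (by norm_num)] at hderiv
  refine (dt_eq hderiv ht).trans ?_
  have hn := congrFun (ha.lapse_eq ht n) p
  rw [ha.resMetric_eq ht, metricRate, hk, ha.eq_cbrt_pow ht]
  simp only [Matrix.mul_add, Matrix.mul_sub, Matrix.mul_smul, Matrix.smul_mul, Matrix.mul_one,
    Matrix.add_apply, Matrix.sub_apply, Matrix.smul_apply, smul_eq_mul]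
  generalize resLapse a n t p = ν at hn ⊢
  rw [hn]
  field_simp
  ring

lemma evol_resInv (h : IsSolution T a g k n φ) (ha : IsScaleFactor T a) (ht : t ∈ Ico 0 T)
    (p : S3) (A B : Fin 3) :
    dt T (fun s => resInv a g s p A B) t
      = -((a t)⁻¹ * (metricRate T a k n t p * resInv a g t p) A B) := by
  have hG : Matrix.of (fun A B => dt T (fun s => resMetric a g s p A B) t)
      = (a t)⁻¹ • (resMetric a g t p * metricRate T a k n t p) := by
    ext C D
    exact h.evol_resMetric ha ht p C D
  have hGi := SlabC.dt_matrix_inv (N := 16) (h.slabC_resMetric ha)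
    (fun _ hs => h.isUnit_det_resMetric ha hs) ht p
  rw [hG, Matrix.mul_smul, ← Matrix.mul_assoc,
    Matrix.nonsing_inv_mul _ (h.isUnit_det_resMetric ha ht p), Matrix.one_mul,
    Matrix.smul_mul] at hGi
  exact congrFun (congrFun hGi A) B

lemma evol_resK (h : IsSolution T a g k n φ) (ha : IsScaleFactor T a) (ht : t ∈ Ico 0 T)
    (p : S3) (A B : Fin 3) :
    dt T (fun s => resK a k s p A B) t
      = -(cbrt a t * dt T a t * (resLapse a n t p * resK a k t p A B))
        + cbrt a t * ((1 / 3) * dt T a t ^ 2 * (1 : Matrix _ _ ℝ) A B * resLapse a n t p)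
        - cbrt a t ^ 5 * ∑ C, resInv a g t p A C * hess (resMetric a g t) (resLapse a n t) C B p
        + cbrt a t * (n t p * (RicSharp (resMetric a g t) p A B
            - (2 / 9) * (1 : Matrix _ _ ℝ) A B))
        + cbrt a t ^ 5 * ((2 / 9) * (1 : Matrix _ _ ℝ) A B * resLapse a n t p)
        - cbrt a t * (n t p * ((∑ C, resInv a g t p A C * Zder C (φ t) p) * Zder B (φ t) p)) := by
  have hx := ha.cbrt_pos ht
  have hderiv := ((ha.hasDerivWithinAt ht).mul
    (SlabC.hasDerivWithinAt_dt (N := 15) (h.reg_k A B) ht p)).add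
      (((ha.ode t ht).const_mul (1 / 3)).mul_const ((1 : Matrix (Fin 3) (Fin 3) ℝ) A B))
  refine ((dt_congr (fun s hs => h.resK_apply ha hs p A B) ht).trans (dt_eq hderiv ht)).trans ?_
  have hK := h.resK_apply ha ht p A B
  have hn := congrFun (ha.lapse_eq ht n) p
  simp only [h.evol_k t ht p A B, h.hess_lapse ha ht, h.resInv_eq ha ht, h.RicSharp_resMetric ha ht,
    hubble, Matrix.smul_apply, smul_eq_mul]
  generalize resLapse a n t p = ν at hn ⊢
  rw [hn, hK]
  simp only [mul_assoc, ← Finset.mul_sum, mul_left_comm ((g t p)⁻¹ _ _)]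
  rw [show a t ^ (1 / 3 : ℝ) = cbrt a t from rfl, ha.eq_cbrt_pow ht]
  field_simp
  ring

lemma dt_normalDeriv (h : IsSolution T a g k n φ) (ha : IsScaleFactor T a) (ht : t ∈ Ico 0 T)
    (p : S3) :
    dt T (fun s => normalDeriv T n φ s p) t
      = n t p * ((cbrt a t ^ 2)⁻¹ * lap (resMetric a g t) (φ t) p
          - dt T a t / a t * normalDeriv T n φ t p)
        + cbrt a t ^ 2 * gradInner (resMetric a g t) (resLapse a n t) (φ t) p := by
  have hwave := h.wave t ht p
  rw [h.lap_eq ha ht, h.gradInner_lapse ha ht, hubble] at hwave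
  have hcancel := mul_inv_cancel₀ (h.lapse_pos t ht p).ne'
  linear_combination (-n t p) * hwave - (dt T (fun s => normalDeriv T n φ s p) t
    - cbrt a t ^ 2 * gradInner (resMetric a g t) (resLapse a n t) (φ t) p) * hcancel

lemma evol_timeScalar (h : IsSolution T a g k n φ) (ha : IsScaleFactor T a) (ht : t ∈ Ico 0 T)
    (p : S3) :
    dt T (fun s => timeScalar T a n φ s p) t
      = -(cbrt a t * dt T a t * (resLapse a n t p * (timeScalar T a n φ t p + Real.sqrt (2 / 3))))
        + cbrt a t * (n t p * lap (resMetric a g t) (φ t) p)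
        + cbrt a t ^ 5 * gradInner (resMetric a g t) (resLapse a n t) (φ t) p := by
  have hx := ha.cbrt_pos ht
  have hderiv := ((ha.hasDerivWithinAt ht).mul
    (SlabC.hasDerivWithinAt_dt (N := 15) h.slabC_normalDeriv ht p)).sub_const (Real.sqrt (2 / 3))
  refine (dt_eq hderiv ht).trans ?_
  have hn := congrFun (ha.lapse_eq ht n) p
  rw [h.dt_normalDeriv ha ht, timeScalar]
  generalize resLapse a n t p = ν at hn ⊢
  rw [hn, ha.eq_cbrt_pow ht]
  field_simp
  ring

lemma evol_dT (h : IsSolution T a g k n φ) (ha : IsScaleFactor T a) (ht : t ∈ Ico 0 T)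
    (A : Fin 3) (p : S3) :
    dt T (fun s => Zder A (φ s) p) t = (a t)⁻¹ *
      Zder A (fun p => n t p * (timeScalar T a n φ t p + Real.sqrt (2 / 3))) p := by
  rw [SlabC.dt_Zder (h.reg_φ.of_le (by norm_num)) ht, ← congrFun (Zder_const_mul _ _ _) p]
  congr 1
  funext q
  have hnpos := h.lapse_pos t ht q
  have hpos := ha.pos t ht
  rw [timeScalar, normalDeriv]
  field_simp
  ring

/- The Hamiltonian constraint removes `k̂` and `∂ₜφ` from the lapse equation, so that no term
quadratic in them is left. -/
lemma resLapse_elliptic (h : IsSolution T a g k n φ) (ha : IsScaleFactor T a) (ht : t ∈ Ico 0 T)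
    (p : S3) :
    (1 - cbrt a t ^ 4 / 3) * resLapse a n t p
      = cbrt a t ^ 4 * lap (resMetric a g t) (resLapse a n t) p
        - n t p * (((RicSharp (resMetric a g t) p).trace - 2 / 3)
          - gradInner (resMetric a g t) (φ t) (φ t) p) := by
  have hx := ha.cbrt_pos ht
  have hham := h.hamiltonian t ht p
  have hlapse := h.lapse t ht p
  have hn := congrFun (ha.lapse_eq ht n) p
  have hcancel := mul_inv_cancel₀ (pow_pos hx 2).ne'
  have hhubble : cbrt a t ^ 6 * hubble T a t ^ 2 = 1 - cbrt a t ^ 4 := by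
    rw [ha.hubble_sq ht]
    field_simp
  rw [scalarCurv, trace_mul_self_eq, h.cmc t ht p, h.gradInner_eq ha ht] at hham
  rw [h.lap_lapse ha ht, ha.dt_hubble ht] at hlapse
  rw [h.RicSharp_resMetric ha ht, Matrix.trace_smul, smul_eq_mul]
  linear_combination (-cbrt a t ^ 2) * hlapse + n t p * cbrt a t ^ 2 * hham
    - (2 / 3 + cbrt a t ^ 2 * hubble T a t ^ 2) * hn
    - resLapse a n t p * hhubble
    + (2 / 3 + n t p * gradInner (resMetric a g t) (φ t) (φ t) p) * hcancel

lemma transpose_resMetric_mul_resK (h : IsSolution T a g k n φ) (ht : t ∈ Ico 0 T) (p : S3) :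
    (resMetric a g t p * resK a k t p).transpose = resMetric a g t p * resK a k t p := by
  have hg_symm : ∀ s ∈ Ico 0 T, ∀ A B, g s p A B = g s p B A := fun s hs A B => by
    simpa using (h.metric s hs p).1.apply B A
  have hgk_symm (A B : Fin 3) : (g t p * k t p) A B = (g t p * k t p) B A := by
    have hdt := dt_congr (fun s hs => hg_symm s hs A B) ht
    rw [h.evol_g t ht p A B, h.evol_g t ht p B A] at hdt
    have hn := (h.lapse_pos t ht p).ne'
    rw [Matrix.mul_apply, Matrix.mul_apply]
    exact mul_left_cancel₀ (mul_ne_zero (by norm_num) hn) hdt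
  ext A B
  simp only [Matrix.transpose_apply, resMetric, resK, traceFree, Matrix.smul_mul, Matrix.mul_smul,
    Matrix.mul_sub, Matrix.mul_one, Matrix.smul_apply, Matrix.sub_apply, smul_eq_mul]
  rw [hgk_symm B A, hg_symm t ht B A]

end IsSolution

/-! ### Uniform bounds for families of functions -/

/-- A family of scales: bounds are to hold along the filter `l`, up to a constant, the factor `s`
and a power of the factor `ρ`. -/
structure Gauge (X : Type*) where
  l : Filter X
  ρ : X → ℝ
  s : X → ℝ
  one_le_ρ : ∀ x, 1 ≤ ρ x
  s_nonneg : ∀ x, 0 ≤ s x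
  s_le_one : ∀ x, s x ≤ 1

namespace Gauge

variable {X : Type*} {γ : Gauge X}

/-- The scales without the small factor. -/
def one (γ : Gauge X) : Gauge X :=
  { γ with s := fun _ => 1, s_nonneg := fun _ => zero_le_one, s_le_one := fun _ => le_rfl }

/-- The family `f` is, together with its frame derivatives of order at most `N`, bounded by a
constant times `s ρ ^ c`, for some `c`. -/
def Small (γ : Gauge X) (N : ℕ) (f : X → S3 → ℝ) : Prop :=
  ∃ (C : ℝ) (c : ℕ), 0 ≤ C ∧ ∀ᶠ x in γ.l, DerivBound N (f x) (C * γ.s x * γ.ρ x ^ c)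

/-- The family `f` agrees with the constant `c` up to a small family. -/
def Near (γ : Gauge X) (N : ℕ) (f : X → S3 → ℝ) (c : ℝ) : Prop :=
  γ.Small N fun x p => f x p - c

/-- The family of metrics (or inverse metrics) `h` agrees with the round one up to a small
family. -/
def NearRound (γ : Gauge X) (N : ℕ) (h : X → MatrixField) : Prop :=
  ∀ A B, γ.Near N (fun x p => h x p A B) ((1 : Matrix _ _ ℝ) A B)

namespace Small

variable {M N : ℕ} {f g : X → S3 → ℝ}

lemma of_le (h : γ.Small N f) (hMN : M ≤ N) : γ.Small M f := by
  obtain ⟨C, c, hC, h⟩ := h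
  exact ⟨C, c, hC, h.mono fun x hx => hx.of_le hMN⟩

lemma bdd (h : γ.Small N f) : γ.one.Small N f := by
  obtain ⟨C, c, hC, h⟩ := h
  refine ⟨C, c, hC, h.mono fun x hx => hx.mono ?_⟩
  have hρ := pow_nonneg (zero_le_one.trans (γ.one_le_ρ x)) c
  exact mul_le_mul_of_nonneg_right (mul_le_mul_of_nonneg_left (γ.s_le_one x) hC) hρ

lemma mono_exponent {C : ℝ} (hC : 0 ≤ C) {c c' : ℕ} (hc : c ≤ c') (x : X) :
    C * γ.s x * γ.ρ x ^ c ≤ C * γ.s x * γ.ρ x ^ c' :=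
  mul_le_mul_of_nonneg_left (pow_le_pow_right₀ (γ.one_le_ρ x) hc)
    (mul_nonneg hC (γ.s_nonneg x))

lemma add (hf : γ.Small N f) (hg : γ.Small N g) : γ.Small N fun x p => f x p + g x p := by
  obtain ⟨C, c, hC, hf⟩ := hf
  obtain ⟨C', c', hC', hg⟩ := hg
  refine ⟨C + C', max c c', add_nonneg hC hC', ?_⟩
  filter_upwards [hf, hg] with x hfx hgx
  refine ((hfx.mono (mono_exponent hC (le_max_left c c') x)).add
    (hgx.mono (mono_exponent hC' (le_max_right c c') x))).mono (le_of_eq ?_)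
  ring

lemma mul (hf : γ.Small N f) (hg : γ.one.Small N g) : γ.Small N fun x p => f x p * g x p := by
  obtain ⟨C, c, hC, hf⟩ := hf
  obtain ⟨C', c', hC', hg⟩ := hg
  refine ⟨2 ^ N * (C * C'), c + c', by positivity, ?_⟩
  filter_upwards [hf, hg] with x hfx hgx
  refine (hfx.mul hgx).mono (le_of_eq ?_)
  simp only [one]
  ring

lemma time_mul (hf : γ.Small N f) {b : X → ℝ} {K : ℝ} (hb : ∀ x, |b x| ≤ K) :
    γ.Small N fun x p => b x * f x p := by
  obtain ⟨C, c, hC, hf⟩ := hf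
  refine ⟨|K| * C, c, by positivity, hf.mono fun x hx => (hx.const_mul (b x)).mono ?_⟩
  calc |b x| * (C * γ.s x * γ.ρ x ^ c) ≤ |K| * (C * γ.s x * γ.ρ x ^ c) :=
        mul_le_mul_of_nonneg_right ((hb x).trans (le_abs_self K)) hx.nonneg
    _ = _ := by ring

lemma const_mul (hf : γ.Small N f) (b : ℝ) : γ.Small N fun x p => b * f x p :=
  hf.time_mul (b := fun _ => b) (K := |b|) fun _ => le_rfl

lemma sub (hf : γ.Small N f) (hg : γ.Small N g) : γ.Small N fun x p => f x p - g x p := by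
  simpa [sub_eq_add_neg] using hf.add (hg.const_mul (-1))

lemma zero : γ.Small N fun _ _ => 0 :=
  ⟨0, 0, le_rfl, Filter.Eventually.of_forall fun _ => DerivBound.zero N (by simp)⟩

lemma sum {ι : Type*} {s : Finset ι} {f : ι → X → S3 → ℝ} (h : ∀ i ∈ s, γ.Small N (f i)) :
    γ.Small N fun x p => ∑ i ∈ s, f i x p := by
  classical
  induction s using Finset.induction_on with
  | empty => simpa using zero
  | insert i s hi ih =>
    simp only [Finset.sum_insert hi]
    exact (h i (Finset.mem_insert_self i s)).add
      (ih fun j hj => h j (Finset.mem_insert_of_mem hj))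

lemma zder (h : γ.Small (N + 1) f) (A : Fin 3) : γ.Small N fun x => Zder A (f x) := by
  obtain ⟨C, c, hC, h⟩ := h
  exact ⟨C, c, hC, h.mono fun x hx => hx.zder A⟩

lemma near (h : γ.Small N f) : γ.Near N f 0 := by
  simpa [Near] using h

end Small

lemma bdd_const (N : ℕ) (c : ℝ) : γ.one.Small N fun _ _ => c :=
  ⟨|c|, 0, abs_nonneg c, Filter.Eventually.of_forall fun _ =>
    (DerivBound.const N c).mono (by simp [one])⟩

namespace Near

variable {M N : ℕ} {f g : X → S3 → ℝ} {c c' : ℝ}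

lemma small (h : γ.Near N f 0) : γ.Small N f := by
  simpa [Near] using h

lemma of_le (h : γ.Near N f c) (hMN : M ≤ N) : γ.Near M f c := Small.of_le h hMN

lemma bdd (h : γ.Near N f c) : γ.one.Small N f := by
  simpa using (Small.bdd h).add (bdd_const N c)

lemma congr_const (h : γ.Near N f c) (hc : c = c') : γ.Near N f c' := hc ▸ h

lemma const (N : ℕ) (c : ℝ) : γ.Near N (fun _ _ => c) c := by
  simpa [Near] using Small.zero

lemma add (hf : γ.Near N f c) (hg : γ.Near N g c') :
    γ.Near N (fun x p => f x p + g x p) (c + c') := by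
  simpa only [Near, add_sub_add_comm] using Small.add hf hg

lemma sub (hf : γ.Near N f c) (hg : γ.Near N g c') :
    γ.Near N (fun x p => f x p - g x p) (c - c') := by
  simpa only [Near, sub_sub_sub_comm] using Small.sub hf hg

lemma const_mul (hf : γ.Near N f c) (b : ℝ) : γ.Near N (fun x p => b * f x p) (b * c) := by
  simpa only [Near, mul_sub] using Small.const_mul hf b

lemma mul (hf : γ.Near N f c) (hg : γ.Near N g c') :
    γ.Near N (fun x p => f x p * g x p) (c * c') := by
  have h := (Small.mul hf hg.bdd).add (Small.const_mul hg c)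
  unfold Near
  convert h using 3
  ring

lemma sum {ι : Type*} {s : Finset ι} {f : ι → X → S3 → ℝ} {c : ι → ℝ}
    (h : ∀ i ∈ s, γ.Near N (f i) (c i)) :
    γ.Near N (fun x p => ∑ i ∈ s, f i x p) (∑ i ∈ s, c i) := by
  simpa only [Near, Finset.sum_sub_distrib] using Small.sum h

lemma zder (h : γ.Near (N + 1) f c) (A : Fin 3) : γ.Near N (fun x => Zder A (f x)) 0 := by
  have hsub := Small.zder h A
  simp only [Zder_sub_const] at hsub
  exact hsub.near

end Near

/-! ### Curvature of metrics close to the round one -/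

section Curvature

variable {M N : ℕ} {h : X → MatrixField}

lemma NearRound.of_le (hh : γ.NearRound N h) (hMN : M ≤ N) : γ.NearRound M h :=
  fun A B => (hh A B).of_le hMN

lemma NearRound.gammaLow (hh : γ.NearRound (N + 1) h) (A C B : Fin 3) :
    γ.Near N (fun x => gammaLow (h x) A C B) (structConst A B C / 2) := by
  have hcontract (A B C : Fin 3) :
      γ.Near N (fun x p => ∑ D, structConst A B D * h x p D C) (structConst A B C) :=
    (Near.sum fun D _ => ((hh D C).of_le (Nat.le_succ N)).const_mul
      (structConst A B D)).congr_const (by simp [Matrix.one_apply])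
  refine ((((((hh B C).zder A).add ((hh A C).zder B)).sub ((hh A B).zder C)).add
    (hcontract A B C)).sub (hcontract A C B) |>.sub (hcontract B C A)
    |>.const_mul (1 / 2)).congr_const ?_
  simp only [structConst, eps]
  ring

lemma NearRound.conn (hh : γ.NearRound (N + 1) h) (hi : γ.NearRound N fun x p => (h x p)⁻¹)
    (A D B : Fin 3) : γ.Near N (fun x => conn (h x) A D B) (structConst A B D / 2) :=
  (Near.sum fun C _ => (hi C D).mul (hh.gammaLow A C B)).congr_const
    (by simp [Matrix.one_apply])

lemma NearRound.Ric (hh : γ.NearRound (N + 2) h) (hi : γ.NearRound (N + 1) fun x p => (h x p)⁻¹)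
    (B C : Fin 3) :
    γ.Near N (fun x p => Ric (h x) p B C) ((2 / 9) * (1 : Matrix _ _ ℝ) B C) := by
  have hconn := hh.conn hi
  have hconn' (A D B : Fin 3) := (hconn A D B).of_le (Nat.le_succ N)
  refine (Near.sum (s := Finset.univ) fun A _ =>
    (((hconn B A C).zder A).sub ((hconn A A C).zder B)).add
      (Near.sum (s := Finset.univ) fun F _ => ((hconn' B F C).mul (hconn' A A F)).sub
        ((hconn' A F C).mul (hconn' B A F)))
    |>.sub (Near.sum (s := Finset.univ) fun F _ =>
      (hconn' F A C).const_mul (structConst A B F))).congr_const ?_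
  fin_cases B <;> fin_cases C <;> simp [structConst, eps, Fin.sum_univ_three] <;> norm_num

lemma NearRound.RicSharp (hh : γ.NearRound (N + 2) h)
    (hi : γ.NearRound (N + 1) fun x p => (h x p)⁻¹) (A B : Fin 3) :
    γ.Near N (fun x p => RicSharp (h x) p A B) ((2 / 9) * (1 : Matrix _ _ ℝ) A B) := by
  simp only [EinsteinScalar.RicSharp, Matrix.mul_apply]
  refine (Near.sum fun C _ =>
    ((hi A C).of_le (Nat.le_succ N)).mul (hh.Ric hi C B)).congr_const ?_
  simp [Matrix.one_apply]

lemma small_hess {f : X → S3 → ℝ} (hf : ∀ A, γ.Small (N + 1) fun x => Zder A (f x))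
    (hh : γ.NearRound (N + 1) h) (hi : γ.NearRound N fun x p => (h x p)⁻¹) (A B : Fin 3) :
    γ.Small N fun x => hess (h x) (f x) A B := by
  have hexpand : (fun x => hess (h x) (f x) A B) = fun x p => Zder A (Zder B (f x)) p
      - ∑ D, Zder D (f x) p * conn (h x) A D B p := by
    funext x p
    simp only [hess_eq, mul_comm]
  rw [hexpand]
  exact ((hf B).zder A).sub (Small.sum fun D _ =>
    ((hf D).of_le (Nat.le_succ N)).mul (hh.conn hi A D B).bdd)

lemma small_lap {f : X → S3 → ℝ} (hf : ∀ A, γ.Small (N + 1) fun x => Zder A (f x))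
    (hh : γ.NearRound (N + 1) h) (hi : γ.NearRound N fun x p => (h x p)⁻¹) :
    γ.Small N fun x => lap (h x) (f x) := by
  have hexpand : (fun x => lap (h x) (f x))
      = fun x p => ∑ A, ∑ B, hess (h x) (f x) A B p * (h x p)⁻¹ A B := by
    funext x p
    simp only [lap, mul_comm]
  rw [hexpand]
  exact Small.sum fun A _ => Small.sum fun B _ => (small_hess hf hh hi A B).mul (hi A B).bdd

lemma small_gradInner {f f' : X → S3 → ℝ} (hf : ∀ A, γ.Small N fun x => Zder A (f x))
    (hf' : ∀ A, γ.one.Small N fun x => Zder A (f' x))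
    (hi : γ.NearRound N fun x p => (h x p)⁻¹) :
    γ.Small N fun x => gradInner (h x) (f x) (f' x) := by
  have hexpand : (fun x => gradInner (h x) (f x) (f' x)) = fun x p => ∑ A, ∑ B,
      Zder A (f x) p * (h x p)⁻¹ A B * Zder B (f' x) p := by
    funext x p
    simp only [gradInner, mul_comm ((h x p)⁻¹ _ _)]
  rw [hexpand]
  exact Small.sum fun A _ => Small.sum fun B _ => ((hf A).mul (hi A B).bdd).mul (hf' B)

end Curvature

end Gauge

/-! ### Solutions obeying the bootstrap assumptions -/

/-- A solution obeying the bootstrap assumptions with parameters `ε`, `σ`. -/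
structure Datum where
  (ε σ T : ℝ)
  a : ℝ → ℝ
  (g k : ℝ → MatrixField)
  (n φ : ℝ → S3 → ℝ)
  ε_pos : 0 < ε
  sqrt_le : Real.sqrt ε ≤ σ
  σ_le_one : σ ≤ 1
  T_pos : 0 < T
  scale : IsScaleFactor T a
  sol : IsSolution T a g k n φ
  init : highNorm T a g k n φ 0 ≤ ε ^ 2
  bootstrap : ∀ t ∈ Ico 0 T, highNorm T a g k n φ t ≤ ε * a t ^ (-σ)

/-- A time slice of a solution obeying the bootstrap assumptions. Uniformity of a bound in the
solution and in time is expressed as a statement about families over this type. -/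
structure Slice where
  d : Datum
  t : ℝ
  ht : t ∈ Ico 0 d.T

namespace Datum

variable (d : Datum)

lemma sqrt_pos : 0 < Real.sqrt d.ε := Real.sqrt_pos.mpr d.ε_pos

lemma σ_pos : 0 < d.σ := d.sqrt_pos.trans_le d.sqrt_le

lemma sqrt_le_one : Real.sqrt d.ε ≤ 1 := d.sqrt_le.trans d.σ_le_one

lemma sqrt_mul_sqrt : Real.sqrt d.ε * Real.sqrt d.ε = d.ε := Real.mul_self_sqrt d.ε_pos.le

lemma ε_le_sqrt : d.ε ≤ Real.sqrt d.ε :=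
  calc d.ε = Real.sqrt d.ε * Real.sqrt d.ε := d.sqrt_mul_sqrt.symm
    _ ≤ Real.sqrt d.ε := mul_le_of_le_one_right d.sqrt_pos.le d.sqrt_le_one

lemma ε_le_one : d.ε ≤ 1 := d.ε_le_sqrt.trans d.sqrt_le_one

/-- The slice at time zero. -/
def initial : Slice := ⟨d, 0, le_rfl, d.T_pos⟩

end Datum

namespace Slice

/-- The rescaled metric of the slice. -/
abbrev G (x : Slice) : MatrixField := resMetric x.d.a x.d.g x.t

/-- The inverse rescaled metric of the slice. -/
abbrev Gi (x : Slice) : MatrixField := resInv x.d.a x.d.g x.t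

/-- The rescaled second fundamental form of the slice. -/
abbrev K (x : Slice) : MatrixField := resK x.d.a x.d.k x.t

/-- The rescaled lapse of the slice. -/
abbrev ν (x : Slice) : S3 → ℝ := resLapse x.d.a x.d.n x.t

/-- The rescaled time derivative of the scalar field on the slice. -/
abbrev Ψ (x : Slice) : S3 → ℝ := timeScalar x.d.T x.d.a x.d.n x.d.φ x.t

/-- The logarithmic rate of change of the metric of the slice, multiplied by the scale factor. -/
abbrev κ (x : Slice) : MatrixField := metricRate x.d.T x.d.a x.d.k x.d.n x.t

/-- The solution norm on the slice. -/
abbrev solNorm (x : Slice) : ℝ := highNorm x.d.T x.d.a x.d.g x.d.k x.d.n x.d.φ x.t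

/-- The scale factor at the time of the slice. -/
abbrev a (x : Slice) : ℝ := x.d.a x.t

/-- The time derivative of the scale factor at the time of the slice. -/
abbrev a' (x : Slice) : ℝ := dt x.d.T x.d.a x.t

/-- The cube root of the scale factor of the slice. -/
abbrev r (x : Slice) : ℝ := cbrt x.d.a x.t

/-- The logarithmic time of the slice. -/
abbrev τ (x : Slice) : ℝ := logTime x.d.a x.t

variable (x : Slice)

lemma a_pos : 0 < x.a := x.d.scale.pos x.t x.ht

lemma a_le_one : x.a ≤ 1 := x.d.scale.le_one x.ht

lemma abs_a'_le_one : |x.a'| ≤ 1 := x.d.scale.abs_dt_le_one x.ht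

lemma τ_nonneg : 0 ≤ x.τ := x.d.scale.logTime_nonneg x.ht

lemma one_le_exp_mul_τ {θ : ℝ} (hθ : 0 ≤ θ) : 1 ≤ Real.exp (θ * x.τ) :=
  Real.one_le_exp (mul_nonneg hθ x.τ_nonneg)

lemma r_pos : 0 < x.r := x.d.scale.cbrt_pos x.ht

lemma r_pow_le_one (m : ℕ) : x.r ^ m ≤ 1 := pow_le_one₀ x.r_pos.le (x.d.scale.cbrt_le_one x.ht)

lemma abs_r_pow_le_one (m : ℕ) : |x.r ^ m| ≤ 1 :=
  (abs_of_pos (pow_pos x.r_pos m)).trans_le (x.r_pow_le_one m)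

lemma r_mul_exp_le {c : ℕ} (hc : c * x.d.σ ≤ 1 / 3) :
    x.r * Real.exp (x.d.σ * x.τ) ^ c ≤ Real.exp 1 := by
  have hlog : Real.log x.a ≤ 0 := Real.log_nonpos x.a_pos.le x.a_le_one
  change x.a ^ (1 / 3 : ℝ) * _ ≤ _
  rw [Real.rpow_def_of_pos x.a_pos, ← Real.exp_nat_mul, ← Real.exp_add, Real.exp_le_exp]
  calc Real.log x.a * (1 / 3) + c * (x.d.σ * x.τ)
      = (1 / 3 - c * x.d.σ) * Real.log x.a + c * x.d.σ * x.t := by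
        simp only [τ, logTime, a]
        ring
    _ ≤ 0 + 1 / 3 * 2 := add_le_add (mul_nonpos_of_nonneg_of_nonpos (sub_nonneg.mpr hc) hlog)
        (mul_le_mul hc (x.d.scale.le_two x.ht) x.ht.1 (by norm_num))
    _ ≤ 1 := by norm_num

lemma lapse_eq : x.d.n x.t = fun p => 1 + x.r ^ 4 * x.ν p := x.d.scale.lapse_eq x.ht _

end Slice

/-! ### Scales of smallness -/

/-- The filter of small parameters `σ`, hence also of small `ε ≤ σ ^ 2`. -/
def smallParam : Filter Slice := Filter.comap (fun x => x.d.σ) (nhds 0)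

lemma eventually_smallParam {P : Slice → Prop} :
    (∀ᶠ x in smallParam, P x) ↔ ∃ δ > 0, ∀ x : Slice, x.d.σ < δ → P x := by
  rw [smallParam, Filter.eventually_comap, Metric.eventually_nhds_iff]
  constructor
  · rintro ⟨δ, hδ, h⟩
    exact ⟨δ, hδ, fun x hx => h (by simpa [abs_of_pos x.d.σ_pos] using hx) x rfl⟩
  · rintro ⟨δ, hδ, h⟩
    refine ⟨δ, hδ, fun y hy x hxy => h x ?_⟩
    subst hxy
    simpa [abs_of_pos x.d.σ_pos] using hy

lemma eventually_mul_σ_le (c : ℝ) {b : ℝ} (hb : 0 < b) : ∀ᶠ x in smallParam, c * x.d.σ ≤ b := by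
  refine eventually_smallParam.mpr ⟨b / (|c| + 1), by positivity, fun x hx => ?_⟩
  calc c * x.d.σ ≤ (|c| + 1) * x.d.σ :=
        mul_le_mul_of_nonneg_right ((le_abs_self c).trans (by linarith)) x.d.σ_pos.le
    _ ≤ b := by
        rw [mul_comm]
        exact ((lt_div_iff₀ (by positivity)).mp hx).le

/-- The scale of the bootstrap assumptions. -/
def crude : Gauge Slice where
  l := smallParam
  ρ x := Real.exp (x.d.σ * x.τ)
  s x := x.d.ε
  one_le_ρ x := x.one_le_exp_mul_τ x.d.σ_pos.le
  s_nonneg x := x.d.ε_pos.le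
  s_le_one x := x.d.ε_le_one

/-- The scale of the improved bounds. -/
def sharp : Gauge Slice where
  l := smallParam
  ρ x := Real.exp (Real.sqrt x.d.ε * x.τ)
  s x := Real.sqrt x.d.ε
  one_le_ρ x := x.one_le_exp_mul_τ x.d.sqrt_pos.le
  s_nonneg x := x.d.sqrt_pos.le
  s_le_one x := x.d.sqrt_le_one

/-- The scale of the improved bounds, with the smallness of the bootstrap assumptions. -/
def sharpSmall : Gauge Slice :=
  { sharp with
    s := fun x => x.d.ε
    s_nonneg := fun x => x.d.ε_pos.le
    s_le_one := fun x => x.d.ε_le_one }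

/-- The scale of bounds without loss. -/
def lossless : Gauge Slice where
  l := smallParam
  ρ _ := 1
  s x := x.d.ε
  one_le_ρ _ := le_rfl
  s_nonneg x := x.d.ε_pos.le
  s_le_one x := x.d.ε_le_one

namespace Gauge.Small

variable {N : ℕ} {f : Slice → S3 → ℝ}

lemma lossless_of_crude (h : crude.Small N f) : lossless.Small N fun x p => x.r * f x p := by
  obtain ⟨C, c, hC, h⟩ := h
  refine ⟨C * Real.exp 1, 0, by positivity, ?_⟩
  filter_upwards [h, eventually_mul_σ_le c (show (0 : ℝ) < 1 / 3 by norm_num)] with x hx hcx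
  refine (hx.const_mul x.r).mono ?_
  rw [abs_of_pos x.r_pos]
  simp only [lossless, crude, pow_zero, mul_one]
  calc x.r * (C * x.d.ε * Real.exp (x.d.σ * x.τ) ^ c)
      = C * x.d.ε * (x.r * Real.exp (x.d.σ * x.τ) ^ c) := by ring
    _ ≤ C * x.d.ε * Real.exp 1 :=
        mul_le_mul_of_nonneg_left (x.r_mul_exp_le hcx) (mul_nonneg hC x.d.ε_pos.le)
    _ = _ := by ring

lemma sharp_of_lossless (h : lossless.Small N f) : sharp.Small N f := by
  obtain ⟨C, c, hC, h⟩ := h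
  refine ⟨C, 0, hC, h.mono fun x hx => hx.mono ?_⟩
  simpa [lossless, sharp] using mul_le_mul_of_nonneg_left x.d.ε_le_sqrt hC

lemma sharpSmall_of_lossless (h : lossless.Small N f) : sharpSmall.Small N f := by
  obtain ⟨C, c, hC, h⟩ := h
  exact ⟨C, 0, hC, h.mono fun x hx => hx.mono (by simp [lossless, sharpSmall])⟩

end Gauge.Small

/-! ### Consequences of a bound of the solution norm -/

lemma normC_le_highNorm {T : ℝ} {a : ℝ → ℝ} {t : ℝ} (ha : 0 ≤ a t) (g k : ℝ → MatrixField)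
    (n φ : ℝ → S3 → ℝ) :
    normC 14 (mixedT (resK a k t)) ≤ highNorm T a g k n φ t ∧
    normC 14 (covT (resMetric a g t - St)) ≤ highNorm T a g k n φ t ∧
    normC 14 (contraT (resInv a g t - St)) ≤ highNorm T a g k n φ t ∧
    normC 12 (scalarT (resLapse a n t)) ≤ highNorm T a g k n φ t ∧
    normC 14 (scalarT (timeScalar T a n φ t)) ≤ highNorm T a g k n φ t ∧
    normC 13 (dT (φ t)) ≤ highNorm T a g k n φ t := by
  have hC {l m : ℕ} (M : ℕ) (ξ : Tensor l m) : 0 ≤ normC M ξ := Real.sqrt_nonneg _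
  have hH {l m : ℕ} (M : ℕ) (ξ : Tensor l m) : 0 ≤ normH M ξ := Real.sqrt_nonneg _
  have hHdot {l m : ℕ} (q : ℝ) (M : ℕ) (ξ : Tensor l m) : 0 ≤ a t ^ q * normHdot M ξ :=
    mul_nonneg (Real.rpow_nonneg ha q) (Real.sqrt_nonneg _)
  have hlapse : 0 ≤ ∑ L ∈ Finset.Icc (1 : ℕ) 4,
      a t ^ ((2 / 3 : ℝ) * (L : ℝ)) * normHdot (14 + L) (scalarT (resLapse a n t)) :=
    Finset.sum_nonneg fun L _ => hHdot _ _ _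
  unfold highNorm
  refine ⟨?_, ?_, ?_, ?_, ?_, ?_⟩ <;>
  linarith [hH 16 (mixedT (resK a k t)), hHdot (2 / 3) 17 (covT (resMetric a g t)),
    hH 16 (covT (resMetric a g t - St)), hH 16 (contraT (resInv a g t - St)),
    hH 14 (scalarT (resLapse a n t)), hH 16 (scalarT (timeScalar T a n φ t)),
    mul_nonneg (Real.rpow_nonneg ha (2 / 3)) (hH 16 (dT (φ t))), hH 15 (dT (φ t)),
    hC 14 (mixedT (resK a k t)), hC 14 (covT (resMetric a g t - St)),
    hC 14 (contraT (resInv a g t - St)), hC 12 (scalarT (resLapse a n t)),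
    hC 14 (scalarT (timeScalar T a n φ t)), hC 13 (dT (φ t))]

lemma derivBound_of_normC_le {l m M : ℕ} {ξ : Tensor l m} {b : ℝ} (hlm : l + m ≤ 2) (hM : M ≤ 14)
    (hξ : ∀ I J, SlabC M 1 (fun _ => ξ I J)) (hb : normC M ξ ≤ b) (I : Fin l → Fin 3)
    (J : Fin m → Fin 3) : DerivBound M (ξ I J) (7 ^ 14 * b) := by
  have hfactor : lieFactor l m ≤ 7 := by
    have hlm' : (l : ℝ) + m ≤ 2 := mod_cast hlm
    unfold lieFactor
    linarith
  refine (TensorBound.of_normC hξ hb I J).mono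
    (mul_le_mul_of_nonneg_right ?_ ((Real.sqrt_nonneg _).trans hb))
  calc lieFactor l m ^ M ≤ 7 ^ M :=
        pow_le_pow_left₀ (zero_le_one.trans (one_le_lieFactor l m)) hfactor M
    _ ≤ 7 ^ 14 := pow_le_pow_right₀ (by norm_num) hM

namespace Slice

variable {x : Slice} {b : ℝ}

lemma derivBound_K (hb : x.solNorm ≤ b) (A B : Fin 3) :
    DerivBound 14 (fun p => x.K p A B) (7 ^ 14 * b) :=
  derivBound_of_normC_le (by norm_num) le_rfl
    (fun I J => ((x.d.sol.slabC_resK x.d.scale (I 0) (J 0)).of_le (by norm_num)).slice x.ht 1)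
    ((normC_le_highNorm x.a_pos.le _ _ _ _).1.trans hb) ![A] ![B]

lemma derivBound_G (hb : x.solNorm ≤ b) (A B : Fin 3) :
    DerivBound 14 (fun p => x.G p A B - (1 : Matrix _ _ ℝ) A B) (7 ^ 14 * b) :=
  derivBound_of_normC_le (by norm_num) le_rfl
    (fun _ J => ((x.d.sol.slabC_resMetric x.d.scale (J 0) (J 1)).of_le
      (by norm_num)).slice x.ht 1 |>.sub (SlabC.const 14 1 _))
    ((normC_le_highNorm x.a_pos.le _ _ _ _).2.1.trans hb) ![] ![A, B]

lemma derivBound_Gi (hb : x.solNorm ≤ b) (A B : Fin 3) :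
    DerivBound 14 (fun p => x.Gi p A B - (1 : Matrix _ _ ℝ) A B) (7 ^ 14 * b) :=
  derivBound_of_normC_le (by norm_num) le_rfl
    (fun I _ => ((x.d.sol.slabC_resInv x.d.scale (I 0) (I 1)).of_le
      (by norm_num)).slice x.ht 1 |>.sub (SlabC.const 14 1 _))
    ((normC_le_highNorm x.a_pos.le _ _ _ _).2.2.1.trans hb) ![A, B] ![]

lemma derivBound_ν (hb : x.solNorm ≤ b) : DerivBound 12 x.ν (7 ^ 14 * b) :=
  derivBound_of_normC_le (by norm_num) (by norm_num)
    (fun _ _ => ((x.d.sol.slabC_resLapse x.d.scale).of_le (by norm_num)).slice x.ht 1)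
    ((normC_le_highNorm x.a_pos.le _ _ _ _).2.2.2.1.trans hb) ![] ![]

lemma derivBound_Ψ (hb : x.solNorm ≤ b) : DerivBound 14 x.Ψ (7 ^ 14 * b) :=
  derivBound_of_normC_le (by norm_num) le_rfl
    (fun _ _ => ((x.d.sol.slabC_timeScalar x.d.scale).of_le (by norm_num)).slice x.ht 1)
    ((normC_le_highNorm x.a_pos.le _ _ _ _).2.2.2.2.1.trans hb) ![] ![]

lemma derivBound_dT (hb : x.solNorm ≤ b) (A : Fin 3) :
    DerivBound 13 (Zder A (x.d.φ x.t)) (7 ^ 14 * b) :=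
  derivBound_of_normC_le (by norm_num) (by norm_num)
    (fun _ J => ((x.d.sol.slabC_dT (J 0)).of_le (by norm_num)).slice x.ht 1)
    ((normC_le_highNorm x.a_pos.le _ _ _ _).2.2.2.2.2.trans hb) ![] ![A]

end Slice

lemma Datum.solNorm_initial_le (d : Datum) : d.initial.solNorm ≤ d.ε :=
  d.init.trans (pow_le_of_le_one d.ε_pos.le d.ε_le_one two_ne_zero)

lemma Slice.solNorm_le (x : Slice) : x.solNorm ≤ x.d.ε * Real.exp (x.d.σ * x.τ) :=
  (x.d.bootstrap x.t x.ht).trans (mul_le_mul_of_nonneg_left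
    (x.d.scale.rpow_neg_le_exp x.ht x.d.σ_pos.le) x.d.ε_pos.le)

lemma crude_of_solNorm_le {N : ℕ} {f : Slice → S3 → ℝ}
    (h : ∀ (x : Slice) (b : ℝ), x.solNorm ≤ b → DerivBound N (f x) (7 ^ 14 * b)) :
    crude.Small N f :=
  ⟨7 ^ 14, 1, by positivity, Filter.Eventually.of_forall fun x =>
    (h x _ x.solNorm_le).mono (le_of_eq (by simp only [crude]; ring))⟩

lemma crude_K (A B : Fin 3) : crude.Small 14 fun x p => x.K p A B :=
  crude_of_solNorm_le fun _ _ hb => Slice.derivBound_K hb A B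

lemma crude_G : crude.NearRound 14 Slice.G := fun A B =>
  crude_of_solNorm_le fun _ _ hb => Slice.derivBound_G hb A B

lemma crude_Gi : crude.NearRound 14 Slice.Gi := fun A B =>
  crude_of_solNorm_le fun _ _ hb => Slice.derivBound_Gi hb A B

lemma crude_ν : crude.Small 12 Slice.ν := crude_of_solNorm_le fun _ _ => Slice.derivBound_ν

lemma crude_Ψ : crude.Small 14 Slice.Ψ := crude_of_solNorm_le fun _ _ => Slice.derivBound_Ψ

lemma crude_dT (A : Fin 3) : crude.Small 13 fun x => Zder A (x.d.φ x.t) :=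
  crude_of_solNorm_le fun _ _ hb => Slice.derivBound_dT hb A

/-! ### Integration in time -/

section IntegrationInTime

variable {N : ℕ} {C₀ : ℝ}

lemma lossless_of_rate {u : Datum → ℝ → S3 → ℝ} (hu : ∀ d, SlabC (N + 1) d.T (u d))
    (hC₀ : 0 ≤ C₀) (h0 : ∀ d, DerivBound N (u d 0) (C₀ * d.ε))
    (h : lossless.Small N fun x p => dt x.d.T (fun s => u x.d s p) x.t) :
    lossless.Small N fun x => u x.d x.t := by
  obtain ⟨C, c, hC, h⟩ := h
  obtain ⟨δ, hδ, hrate⟩ := eventually_smallParam.mp h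
  refine ⟨C₀ + 2 * C, 0, by positivity, eventually_smallParam.mpr ⟨δ, hδ, fun x hx => ?_⟩⟩
  have hbound := DerivBound.integrate (hu x.d) (β := fun t => C₀ * x.d.ε + C * x.d.ε * t)
    (β' := fun _ => C * x.d.ε) (fun t _ => by
      simpa using ((hasDerivWithinAt_id t _).const_mul (C * x.d.ε)).const_add (C₀ * x.d.ε))
    x.ht ((h0 x.d).mono (by simp)) fun s hs => by
      simpa [lossless] using hrate ⟨x.d, s, hs.1, hs.2.trans_lt x.ht.2⟩ hx
  refine hbound.mono ?_
  calc C₀ * x.d.ε + C * x.d.ε * x.t ≤ C₀ * x.d.ε + C * x.d.ε * 2 :=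
        add_le_add_right (mul_le_mul_of_nonneg_left (x.d.scale.le_two x.ht)
          (mul_nonneg hC x.d.ε_pos.le)) _
    _ = (C₀ + 2 * C) * lossless.s x * lossless.ρ x ^ 0 := by
        simp only [lossless]
        ring

lemma Slice.add_ε_mul_τ_le (x : Slice) {C : ℝ} (hC₀ : 0 ≤ C₀) (hC : 0 ≤ C) :
    C₀ * x.d.ε + C * x.d.ε * x.τ
      ≤ (C₀ + C) * Real.sqrt x.d.ε * Real.exp (Real.sqrt x.d.ε * x.τ) := by
  have hη := x.d.sqrt_pos.le
  have hinit : C₀ * x.d.ε ≤ C₀ * Real.sqrt x.d.ε * Real.exp (Real.sqrt x.d.ε * x.τ) :=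
    calc C₀ * x.d.ε ≤ C₀ * Real.sqrt x.d.ε := mul_le_mul_of_nonneg_left x.d.ε_le_sqrt hC₀
      _ ≤ _ := le_mul_of_one_le_right (mul_nonneg hC₀ hη) (x.one_le_exp_mul_τ hη)
  have hgrowth : C * x.d.ε * x.τ ≤ C * Real.sqrt x.d.ε * Real.exp (Real.sqrt x.d.ε * x.τ) :=
    calc C * x.d.ε * x.τ = C * Real.sqrt x.d.ε * (Real.sqrt x.d.ε * x.τ) := by
          linear_combination (-C * x.τ) * x.d.sqrt_mul_sqrt
      _ ≤ _ := mul_le_mul_of_nonneg_left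
          ((le_add_of_nonneg_right zero_le_one).trans (Real.add_one_le_exp _))
          (mul_nonneg hC hη)
  linarith

lemma sharp_of_rate {u : Datum → ℝ → S3 → ℝ} (hu : ∀ d, SlabC (N + 1) d.T (u d))
    (hC₀ : 0 ≤ C₀) (h0 : ∀ d, DerivBound N (u d 0) (C₀ * d.ε)) {E : Slice → S3 → ℝ}
    (hE : lossless.Small N E)
    (h : ∀ x p, dt x.d.T (fun s => u x.d s p) x.t = x.a⁻¹ * E x p) :
    sharp.Small N fun x => u x.d x.t := by
  obtain ⟨C, c, hC, hE⟩ := hE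
  obtain ⟨δ, hδ, hE⟩ := eventually_smallParam.mp hE
  refine ⟨C₀ + C, 1, by positivity, eventually_smallParam.mpr ⟨δ, hδ, fun x hx => ?_⟩⟩
  have hrate : ∀ s ∈ Icc 0 x.t, DerivBound N (fun p => dt x.d.T (fun s => u x.d s p) s)
      (C * x.d.ε * (1 - dt x.d.T x.d.a s / x.d.a s)) := by
    intro s hs
    let y : Slice := ⟨x.d, s, hs.1, hs.2.trans_lt x.ht.2⟩
    have hdt : (fun p => dt x.d.T (fun s => u x.d s p) s) = fun p => y.a⁻¹ * E y p :=
      funext (h y)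
    rw [hdt]
    refine ((hE y hx).const_mul y.a⁻¹).mono ?_
    rw [abs_of_pos (inv_pos.mpr y.a_pos), mul_comm]
    simp only [lossless, one_pow, mul_one]
    exact mul_le_mul_of_nonneg_left (y.d.scale.inv_le_deriv_logTime y.ht)
      (mul_nonneg hC x.d.ε_pos.le)
  refine (DerivBound.integrate (hu x.d)
    (β := fun t => C₀ * x.d.ε + C * x.d.ε * logTime x.d.a t)
    (fun t ht => ((x.d.scale.hasDerivWithinAt_logTime ht).const_mul _).const_add _)
    x.ht ((h0 x.d).mono ?_) hrate).mono ?_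
  · simp only [x.d.scale.logTime_zero, mul_zero, add_zero, le_refl]
  · simpa only [sharp, pow_one] using x.add_ε_mul_τ_le hC₀ hC

lemma sharp_near_of_linear_rate {ι : Type*} [Finite ι] {u : ι → Datum → ℝ → S3 → ℝ}
    (hu : ∀ i d, SlabC (N + 1) d.T (u i d)) {c₀ : ι → ℝ} (hC₀ : 0 ≤ C₀)
    (h0 : ∀ i d, DerivBound N (fun p => u i d 0 p - c₀ i) (C₀ * d.ε)) {L : ℝ} (hL : 0 ≤ L)
    (h : ∀ᶠ x in smallParam, ∀ b, 0 ≤ b →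
      (∀ i, DerivBound N (fun p => u i x.d x.t p - c₀ i) b) → ∀ i,
        DerivBound N (fun p => dt x.d.T (fun s => u i x.d s p) x.t)
          (L * x.d.ε * x.a⁻¹ * (1 + b))) (i : ι) :
    sharp.Near N (fun x => u i x.d x.t) (c₀ i) := by
  obtain ⟨δ, hδ, hrate⟩ := eventually_smallParam.mp h
  refine ⟨2 * (C₀ + L), 1, by positivity, ?_⟩
  filter_upwards [eventually_smallParam.mpr ⟨δ, hδ, fun _ hx => hx⟩,
    eventually_mul_σ_le L one_half_pos] with x hx hLσ
  have hη := x.d.sqrt_pos.le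
  have hstep : ∀ t ∈ Ico 0 x.d.T, ∀ b, 0 ≤ b →
      (∀ i, DerivBound N (fun p => u i x.d t p - c₀ i) b) → ∀ i,
        DerivBound N (fun p => dt x.d.T (fun s => u i x.d s p - c₀ i) t)
          (L * Real.sqrt x.d.ε * Real.sqrt x.d.ε * (1 - dt x.d.T x.d.a t / x.d.a t)
            * (1 + b)) := by
    intro t ht b hb hbound j
    have hdt : (fun p => dt x.d.T (fun s => u j x.d s p - c₀ j) t)
        = fun p => dt x.d.T (fun s => u j x.d s p) t :=
      funext fun p => derivWithin_sub_const (f := fun s => u j x.d s p) (c₀ j)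
    rw [hdt, mul_assoc L, x.d.sqrt_mul_sqrt]
    refine (hrate ⟨x.d, t, ht⟩ hx b hb hbound j).mono (mul_le_mul_of_nonneg_right
      (mul_le_mul_of_nonneg_left (x.d.scale.inv_le_deriv_logTime ht)
        (mul_nonneg hL x.d.ε_pos.le)) (by positivity))
  refine (DerivBound.gronwall (fun j => (hu j x.d).sub (SlabC.const _ _ (c₀ j)))
    (fun t ht => x.d.scale.hasDerivWithinAt_logTime ht)
    (fun t ht => x.d.scale.logTime_nonneg ht)
    (fun t ht => (inv_nonneg.mpr (x.d.scale.pos t ht).le).trans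
      (x.d.scale.inv_le_deriv_logTime ht)) (mul_nonneg hC₀ x.d.ε_pos.le) (fun j => h0 j x.d)
    hη (mul_nonneg hL hη) ((mul_le_mul_of_nonneg_left x.d.sqrt_le hL).trans hLσ)
    hstep x.ht i).mono ?_
  simp only [sharp, pow_one]
  refine mul_le_mul_of_nonneg_right ?_ (Real.exp_pos _).le
  linarith [mul_le_mul_of_nonneg_left x.d.ε_le_sqrt hC₀]

end IntegrationInTime

/-! ### Improved bounds -/

open Gauge Filter

section ImprovedBounds

variable (A B : Fin 3)

lemma Gauge.Small.uniform {X ι : Type*} [Finite ι] {γ : Gauge X} {N : ℕ} {f : ι → X → S3 → ℝ}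
    (h : ∀ i, γ.Small N (f i)) : ∃ (C : ℝ) (c : ℕ), 0 ≤ C ∧
      ∀ᶠ x in γ.l, ∀ i, DerivBound N (f i x) (C * γ.s x * γ.ρ x ^ c) := by
  cases nonempty_fintype ι
  choose C c hC h using h
  refine ⟨∑ i, C i, ∑ i, c i, Finset.sum_nonneg fun i _ => hC i, ?_⟩
  filter_upwards [eventually_all.mpr h] with x hx i
  have hρ := pow_nonneg (zero_le_one.trans (γ.one_le_ρ x)) (∑ i, c i)
  have hc : c i ≤ ∑ i, c i :=
    Finset.single_le_sum (f := c) (fun _ _ => Nat.zero_le _) (Finset.mem_univ i)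
  have hCi : C i ≤ ∑ i, C i := Finset.single_le_sum (fun i _ => hC i) (Finset.mem_univ i)
  exact (hx i).mono ((Small.mono_exponent (hC i) hc x).trans
    (mul_le_mul_of_nonneg_right (mul_le_mul_of_nonneg_right hCi (γ.s_nonneg x)) hρ))

lemma crude_n : crude.one.Small 12 fun x => x.d.n x.t := by
  simp only [Slice.lapse_eq]
  exact (bdd_const 12 1).add (crude_ν.time_mul fun x => x.abs_r_pow_le_one 4).bdd

lemma crude_lapse_source : crude.Small 10 fun x p =>
    -x.a' * (x.ν p * x.K p A B) + x.a' ^ 2 * ((1 / 3 * (1 : Matrix _ _ ℝ) A B) * x.ν p)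
      + x.r ^ 4 * (2 / 9 * (1 : Matrix _ _ ℝ) A B * x.ν p)
      - x.r ^ 4 * ∑ C, hess x.G x.ν C B p * x.Gi p A C := by
  have hν := crude_ν.of_le (show 10 ≤ 12 by norm_num)
  have hK := (crude_K A B).of_le (show 10 ≤ 14 by norm_num)
  have hi := crude_Gi.of_le (show 10 ≤ 14 by norm_num)
  have ha (x : Slice) : |-x.a'| ≤ 1 := (abs_neg _).trans_le x.abs_a'_le_one
  have ha2 (x : Slice) : |x.a' ^ 2| ≤ 1 :=
    (abs_pow _ _).trans_le (pow_le_one₀ (abs_nonneg _) x.abs_a'_le_one)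
  have hhess (C : Fin 3) : crude.Small 10 fun x => hess x.G x.ν C B :=
    small_hess (fun A => crude_ν.zder A |>.of_le (by norm_num)) (crude_G.of_le (by norm_num)) hi C B
  exact ((((hν.mul hK.bdd).time_mul ha).add ((hν.const_mul _).time_mul ha2)).add
    ((hν.const_mul _).time_mul fun x => x.abs_r_pow_le_one 4)).sub
    ((Small.sum fun C _ => (hhess C).mul (hi A C).bdd).time_mul fun x => x.abs_r_pow_le_one 4)

lemma crude_curvature_source : crude.Small 10 fun x p =>
    (RicSharp x.G p A B - 2 / 9 * (1 : Matrix _ _ ℝ) A B) * x.d.n x.t p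
      - (∑ C, Zder C (x.d.φ x.t) p * x.Gi p A C) * Zder B (x.d.φ x.t) p * x.d.n x.t p := by
  have hn := crude_n.of_le (show 10 ≤ 12 by norm_num)
  have hω (C : Fin 3) := (crude_dT C).of_le (show 10 ≤ 13 by norm_num)
  have hi (C : Fin 3) := (crude_Gi A C).of_le (show 10 ≤ 14 by norm_num)
  have hRic : crude.Near 10 (fun x p => RicSharp x.G p A B) (2 / 9 * (1 : Matrix _ _ ℝ) A B) :=
    NearRound.RicSharp (crude_G.of_le (by norm_num)) (crude_Gi.of_le (by norm_num)) A B
  exact (Small.mul hRic hn).sub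
    (((Small.sum fun C _ => (hω C).mul (hi C).bdd).mul (hω B).bdd).mul hn)

lemma exists_crude_rate_K : ∃ E : Slice → S3 → ℝ, crude.Small 10 E ∧
    ∀ x p, dt x.d.T (fun s => resK x.d.a x.d.k s p A B) x.t = x.r * E x p := by
  refine ⟨_, (crude_lapse_source A B).add (crude_curvature_source A B), fun x p => ?_⟩
  have hcomm (f : Fin 3 → ℝ) : ∑ C, f C * x.Gi p A C = ∑ C, x.Gi p A C * f C :=
    Finset.sum_congr rfl fun C _ => mul_comm _ _
  rw [x.d.sol.evol_resK x.d.scale x.ht p A B, hcomm, hcomm]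
  ring

lemma exists_crude_rate_Ψ : ∃ E : Slice → S3 → ℝ, crude.Small 10 E ∧
    ∀ x p, dt x.d.T (fun s => timeScalar x.d.T x.d.a x.d.n x.d.φ s p) x.t = x.r * E x p := by
  have hν := crude_ν.of_le (show 10 ≤ 12 by norm_num)
  have hΨ := (crude_Ψ.of_le (show 10 ≤ 14 by norm_num)).bdd.add (bdd_const _ (Real.sqrt (2 / 3)))
  have hn := crude_n.of_le (show 10 ≤ 12 by norm_num)
  have hi := crude_Gi.of_le (show 10 ≤ 14 by norm_num)
  have hlap : crude.Small 10 fun x => lap x.G (x.d.φ x.t) :=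
    small_lap (fun A => (crude_dT A).of_le (by norm_num)) (crude_G.of_le (by norm_num)) hi
  have hgrad : crude.Small 10 fun x => gradInner x.G x.ν (x.d.φ x.t) :=
    small_gradInner (fun A => (crude_ν.zder A).of_le (by norm_num))
      (fun A => ((crude_dT A).of_le (by norm_num)).bdd) hi
  refine ⟨_, (((hν.mul hΨ).time_mul (K := 1) fun x =>
    (abs_neg x.a').trans_le x.abs_a'_le_one).add (hlap.mul hn)).add
    (hgrad.time_mul fun x => x.abs_r_pow_le_one 4), fun x p => ?_⟩
  rw [x.d.sol.evol_timeScalar x.d.scale x.ht p]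
  ring

lemma lossless_K : lossless.Small 10 fun x p => x.K p A B := by
  obtain ⟨E, hE, hrate⟩ := exists_crude_rate_K A B
  refine lossless_of_rate (u := fun d t p => resK d.a d.k t p A B)
    (fun d => (d.sol.slabC_resK d.scale A B).of_le (by norm_num)) (by positivity)
    (fun d => (Slice.derivBound_K d.solNorm_initial_le A B).of_le (by norm_num)) ?_
  simp only [hrate]
  exact hE.lossless_of_crude

lemma lossless_Ψ : lossless.Small 10 Slice.Ψ := by
  obtain ⟨E, hE, hrate⟩ := exists_crude_rate_Ψ
  refine lossless_of_rate (u := fun d t p => timeScalar d.T d.a d.n d.φ t p)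
    (fun d => (d.sol.slabC_timeScalar d.scale).of_le (by norm_num)) (by positivity)
    (fun d => (Slice.derivBound_Ψ d.solNorm_initial_le).of_le (by norm_num)) ?_
  simp only [hrate]
  exact hE.lossless_of_crude

lemma lossless_n : lossless.Near 12 (fun x => x.d.n x.t) 1 := by
  have hν := crude_ν.lossless_of_crude.time_mul fun x => x.abs_r_pow_le_one 3
  unfold Near
  convert hν using 3 with x p
  simp only [x.lapse_eq]
  ring

lemma lossless_κ : lossless.Small 10 fun x p => x.κ p A B := by
  have hK := ((lossless_K A B).mul (lossless_n.bdd.of_le (show 10 ≤ 12 by norm_num))).const_mul (-2)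
  have hν := ((crude_ν.of_le (show 10 ≤ 12 by norm_num)).lossless_of_crude.time_mul
    (b := fun x => x.r ^ 3 * x.a') (K := 1) fun x => by
      rw [abs_mul]
      exact mul_le_one₀ (x.abs_r_pow_le_one 3) (abs_nonneg _) x.abs_a'_le_one).const_mul
      (2 / 3 * (1 : Matrix _ _ ℝ) A B)
  convert hK.add hν using 3 with x p
  simp only [metricRate, Matrix.add_apply, Matrix.smul_apply, smul_eq_mul]
  ring

lemma exists_derivBound_κ : ∃ C : ℝ, 0 ≤ C ∧ ∀ᶠ x in smallParam, ∀ A B,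
    DerivBound 10 (fun p => x.κ p A B) (C * x.d.ε) := by
  obtain ⟨C, c, hC, h⟩ := Small.uniform (ι := Fin 3 × Fin 3)
    (f := fun i (x : Slice) p => x.κ p i.1 i.2) fun i => lossless_κ i.1 i.2
  exact ⟨C, hC, h.mono fun x hx A B => (hx (A, B)).mono (by simp [lossless])⟩

lemma DerivBound.of_sub_one_apply {N : ℕ} {f : S3 → ℝ} {b : ℝ} {A B : Fin 3}
    (h : DerivBound N (fun p => f p - (1 : Matrix (Fin 3) (Fin 3) ℝ) A B) b) :
    DerivBound N f (1 + b) := by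
  have hone : |(1 : Matrix (Fin 3) (Fin 3) ℝ) A B| ≤ 1 := by
    rw [Matrix.one_apply]
    split_ifs <;> simp
  have hf := h.add (DerivBound.const N ((1 : Matrix (Fin 3) (Fin 3) ℝ) A B))
  simp only [sub_add_cancel] at hf
  exact hf.mono (by linarith)

lemma sharp_G : sharp.NearRound 10 Slice.G := by
  intro A B
  obtain ⟨C, hC, hκ⟩ := exists_derivBound_κ
  refine sharp_near_of_linear_rate (ι := Fin 3 × Fin 3) (L := 3 * (2 ^ 10 * C))
    (u := fun i d t p => resMetric d.a d.g t p i.1 i.2) (c₀ := fun i => (1 : Matrix _ _ ℝ) i.1 i.2)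
    (fun i d => (d.sol.slabC_resMetric d.scale i.1 i.2).of_le (by norm_num)) (by positivity)
    (fun i d => (Slice.derivBound_G d.solNorm_initial_le i.1 i.2).of_le (by norm_num))
    (by positivity) (hκ.mono fun x hx b _ hu i => ?_) (A, B)
  simp only [x.d.sol.evol_resMetric x.d.scale x.ht, Matrix.mul_apply]
  refine ((DerivBound.sum (s := Finset.univ) fun D _ =>
    (hu (i.1, D)).of_sub_one_apply.mul (hx D i.2)).const_mul x.a⁻¹).mono (le_of_eq ?_)
  rw [abs_of_pos (inv_pos.mpr x.a_pos)]
  simp only [Finset.sum_const, Finset.card_univ, Fintype.card_fin, nsmul_eq_mul]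
  push_cast
  ring

lemma sharp_Gi : sharp.NearRound 10 Slice.Gi := by
  intro A B
  obtain ⟨C, hC, hκ⟩ := exists_derivBound_κ
  refine sharp_near_of_linear_rate (ι := Fin 3 × Fin 3) (L := 3 * (2 ^ 10 * C))
    (u := fun i d t p => resInv d.a d.g t p i.1 i.2) (c₀ := fun i => (1 : Matrix _ _ ℝ) i.1 i.2)
    (fun i d => (d.sol.slabC_resInv d.scale i.1 i.2).of_le (by norm_num)) (by positivity)
    (fun i d => (Slice.derivBound_Gi d.solNorm_initial_le i.1 i.2).of_le (by norm_num))
    (by positivity) (hκ.mono fun x hx b _ hu i => ?_) (A, B)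
  simp only [x.d.sol.evol_resInv x.d.scale x.ht, Matrix.mul_apply, ← neg_mul]
  refine ((DerivBound.sum (s := Finset.univ) fun D _ =>
    (hx i.1 D).mul (hu (D, i.2)).of_sub_one_apply).const_mul (-x.a⁻¹)).mono (le_of_eq ?_)
  rw [abs_neg, abs_of_pos (inv_pos.mpr x.a_pos)]
  simp only [Finset.sum_const, Finset.card_univ, Fintype.card_fin, nsmul_eq_mul]
  push_cast
  ring

lemma sharp_dT : sharp.Small 9 fun x => Zder A (x.d.φ x.t) :=
  sharp_of_rate (u := fun d t => Zder A (d.φ t))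
    (fun d => (d.sol.slabC_dT A).of_le (by norm_num)) (by positivity)
    (fun d => (Slice.derivBound_dT d.solNorm_initial_le A).of_le (by norm_num))
    (((lossless_n.of_le (show 9 + 1 ≤ 12 by norm_num)).mul
      (lossless_Ψ.near.add (Near.const 10 (Real.sqrt (2 / 3))))).zder A).small
    fun x p => x.d.sol.evol_dT x.d.scale x.ht A p

lemma sharp_RicSharp :
    sharp.Near 8 (fun x p => RicSharp x.G p A B) ((2 / 9) * (1 : Matrix _ _ ℝ) A B) :=
  sharp_G.RicSharp (sharp_Gi.of_le (by norm_num)) A B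

/-- The zeroth order term of the elliptic equation for the lapse dominates: the Laplacian of the
lapse carries a power of the scale factor that absorbs the loss in the bootstrap assumptions. -/
lemma sharp_ν : sharp.Small 8 Slice.ν := by
  have hi := sharp_Gi.of_le (show 8 ≤ 10 by norm_num)
  have hω (A : Fin 3) := (sharp_dT A).of_le (show 8 ≤ 9 by norm_num)
  have hlap : sharp.Small 8 fun x p => x.r ^ 3 * (x.r * lap x.G x.ν p) :=
    (small_lap (fun A => (crude_ν.zder A).of_le (by norm_num)) (crude_G.of_le (by norm_num))
      (crude_Gi.of_le (by norm_num))).lossless_of_crude.sharp_of_lossless.time_mul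
      fun x => x.abs_r_pow_le_one 3
  have hR : sharp.Small 8 fun x p => (RicSharp x.G p).trace - 2 / 3 :=
    (Near.sum (s := Finset.univ) fun A _ => sharp_RicSharp A A).congr_const
      (by simp; norm_num)
  have hn : sharp.one.Small 8 fun x => x.d.n x.t := by
    simpa using ((Small.sharp_of_lossless lossless_n).bdd.add (bdd_const 12 1)).of_le
      (show 8 ≤ 12 by norm_num)
  have hpos (x : Slice) : 0 < 1 - x.r ^ 4 / 3 := by linarith [x.r_pow_le_one 4]
  have hinv (x : Slice) : |(1 - x.r ^ 4 / 3)⁻¹| ≤ 3 / 2 := by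
    rw [abs_of_pos (inv_pos.mpr (hpos x)), inv_le_comm₀ (hpos x) (by norm_num)]
    linarith [x.r_pow_le_one 4]
  convert (hlap.sub ((hR.sub (small_gradInner hω (fun A => (hω A).bdd) hi)).mul hn)).time_mul hinv
    using 3 with x p
  rw [eq_inv_mul_iff_mul_eq₀ (hpos x).ne']
  refine (x.d.sol.resLapse_elliptic x.d.scale x.ht p).trans ?_
  ring

end ImprovedBounds

/-! ### Norms of tensors which are symmetric with respect to the metric -/

section SymmetricTensors

open Matrix

lemma sum_fin_two_arrow {ι R : Type*} [Fintype ι] [AddCommMonoid R] (F : ι → ι → R) :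
    ∑ A : Fin 2 → ι, F (A 0) (A 1) = ∑ a, ∑ b, F a b := by
  rw [← Fintype.sum_prod_type' F]
  exact Fintype.sum_equiv (finTwoArrowEquiv ι) _ _ fun _ => rfl

lemma sum_quadratic_eq_trace {ι R : Type*} [Fintype ι] [CommSemiring R] (P Q S : Matrix ι ι R) :
    ∑ a, ∑ a', ∑ b, ∑ b', P a a' * Q b b' * S a b * S a' b' = (Sᵀ * (P * S * Qᵀ)).trace := by
  simp only [trace, diag, mul_apply, transpose_apply, Finset.mul_sum, Finset.sum_mul]
  conv_rhs => rw [Finset.sum_comm]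
  refine Finset.sum_congr rfl fun a _ => ?_
  rw [Finset.sum_comm]
  refine Finset.sum_congr rfl fun b _ => ?_
  rw [Finset.sum_comm]
  refine Finset.sum_congr rfl fun b' _ => Finset.sum_congr rfl fun a' _ => ?_
  ring

lemma sum_two_index_eq_trace {ι R : Type*} [Fintype ι] [CommSemiring R] (P S : Matrix ι ι R) :
    ∑ A : Fin 2 → ι, ∑ B : Fin 2 → ι,
      P (A 0) (B 0) * P (A 1) (B 1) * S (A 0) (A 1) * S (B 0) (B 1)
      = (Sᵀ * (P * S * Pᵀ)).trace := by
  rw [← sum_quadratic_eq_trace, sum_fin_two_arrow fun a b => ∑ B : Fin 2 → ι,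
    P a (B 0) * P b (B 1) * S a b * S (B 0) (B 1)]
  refine Finset.sum_congr rfl fun a _ => ?_
  conv_rhs => rw [Finset.sum_comm]
  exact Finset.sum_congr rfl fun b _ =>
    sum_fin_two_arrow fun a' b' => P a a' * P b b' * S a b * S a' b'

section TensorNorms

variable (h S : MatrixField) (p : S3)

lemma pnorm_mixedT : pnorm h (mixedT S) p = √((S p)ᵀ * (h p * S p * (h p)⁻¹ᵀ)).trace := by
  rw [← sum_quadratic_eq_trace]
  simp only [pnorm, mixedT, Fin.prod_univ_one]
  congr 1

lemma pnorm_covT : pnorm h (covT S) p = √((S p)ᵀ * ((h p)⁻¹ * S p * (h p)⁻¹ᵀ)).trace := by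
  simp only [← sum_two_index_eq_trace, pnorm, covT, Fin.prod_univ_two, Finset.univ_unique,
    Finset.sum_singleton, Finset.univ_eq_empty, Finset.prod_empty, one_mul]

lemma pnorm_contraT : pnorm h (contraT S) p = √((S p)ᵀ * (h p * S p * (h p)ᵀ)).trace := by
  simp only [← sum_two_index_eq_trace, pnorm, contraT, Fin.prod_univ_two, Finset.univ_unique,
    Finset.sum_singleton, Finset.univ_eq_empty, Finset.prod_empty, mul_one]

end TensorNorms

lemma sqrt_trace_mul_self_le {ι : Type*} [Fintype ι] {M : Matrix ι ι ℝ} {B : ℝ} (hB : 0 ≤ B)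
    (h : ∀ a b, |M a b| ≤ B) : √(M * M).trace ≤ Fintype.card ι * B := by
  refine Real.sqrt_le_iff.mpr ⟨by positivity, ?_⟩
  calc (M * M).trace = ∑ a, ∑ b, M a b * M b a := by simp only [trace, diag, mul_apply]
    _ ≤ ∑ _a : ι, ∑ _b : ι, B * B :=
        Finset.sum_le_sum fun a _ => Finset.sum_le_sum fun b _ => by
          refine (le_abs_self _).trans ?_
          rw [abs_mul]
          exact mul_le_mul (h a b) (h b a) (abs_nonneg _) hB
    _ = (Fintype.card ι * B) ^ 2 := by
        simp only [Finset.sum_const, Finset.card_univ, nsmul_eq_mul]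
        ring

section Symmetric

variable {ι R : Type*} [Fintype ι] [DecidableEq ι] [CommRing R] {H M : Matrix ι ι R}

lemma trace_mixed_of_isSymm (hH : H.IsSymm) (hdet : IsUnit H.det) (hM : (H * M).IsSymm) :
    (Mᵀ * (H * M * H⁻¹ᵀ)).trace = (M * M).trace := by
  rw [transpose_nonsing_inv, hH.eq, ← hM.eq, transpose_mul, hH.eq, Matrix.mul_assoc,
    mul_nonsing_inv _ hdet, Matrix.mul_one, ← transpose_mul, trace_transpose]

lemma trace_cov_of_isSymm (hH : H.IsSymm) (hdet : IsUnit H.det) (hM : (H * M).IsSymm) :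
    ((H * M)ᵀ * (H⁻¹ * (H * M) * H⁻¹ᵀ)).trace = (M * M).trace := by
  rw [transpose_nonsing_inv, hH.eq, hM.eq, ← Matrix.mul_assoc H⁻¹, nonsing_inv_mul _ hdet,
    Matrix.one_mul, ← Matrix.mul_assoc, trace_mul_comm, ← Matrix.mul_assoc, ← Matrix.mul_assoc,
    nonsing_inv_mul _ hdet, Matrix.one_mul]

lemma isSymm_mul_inv (hH : H.IsSymm) (hdet : IsUnit H.det) (hM : (H * M).IsSymm) :
    (M * H⁻¹).IsSymm := by
  have hMH : Mᵀ * H = H * M := by rw [← hM.eq, transpose_mul, hH.eq]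
  rw [IsSymm, transpose_mul, transpose_nonsing_inv, hH.eq]
  calc H⁻¹ * Mᵀ = H⁻¹ * (Mᵀ * H) * H⁻¹ := by
        rw [Matrix.mul_assoc, Matrix.mul_assoc, mul_nonsing_inv _ hdet, Matrix.mul_one]
    _ = M * H⁻¹ := by rw [hMH, ← Matrix.mul_assoc, nonsing_inv_mul _ hdet, Matrix.one_mul]

lemma trace_contra_of_isSymm (hH : H.IsSymm) (hdet : IsUnit H.det) (hM : (H * M).IsSymm) :
    ((M * H⁻¹)ᵀ * (H * (M * H⁻¹) * Hᵀ)).trace = (M * M).trace := by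
  rw [(isSymm_mul_inv hH hdet hM).eq, hH.eq, Matrix.mul_assoc H, Matrix.mul_assoc M H⁻¹ H,
    nonsing_inv_mul _ hdet, Matrix.mul_one, Matrix.mul_assoc, ← Matrix.mul_assoc H⁻¹,
    nonsing_inv_mul _ hdet, Matrix.one_mul]

end Symmetric

namespace Slice

variable (x : Slice)

lemma isSymm_G (p : S3) : (x.G p).IsSymm := by
  refine IsSymm.ext fun A B => ?_
  have hg := (x.d.sol.metric x.t x.ht p).1.apply A B
  simp only [star_trivial] at hg
  simp [Slice.G, resMetric, hg]

lemma isUnit_det_G (p : S3) : IsUnit (x.G p).det := x.d.sol.isUnit_det_resMetric x.d.scale x.ht p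

lemma isSymm_G_mul_K (p : S3) : (x.G p * x.K p).IsSymm :=
  x.d.sol.transpose_resMetric_mul_resK x.ht p

lemma isSymm_G_mul_κ (b : ℝ) (p : S3) : (x.G p * (b • x.κ p)).IsSymm := by
  rw [Matrix.mul_smul]
  refine IsSymm.smul ?_ b
  simp only [κ, metricRate, Matrix.mul_add, Matrix.mul_smul, Matrix.mul_one]
  exact ((x.isSymm_G_mul_K p).smul _).add ((x.isSymm_G p).smul _)

variable {x} {B : ℝ} {p : S3}

lemma pnorm_K_le (hB : 0 ≤ B) (h : ∀ a b, |x.K p a b| ≤ B) :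
    pnorm x.G (mixedT x.K) p ≤ 3 * B := by
  rw [pnorm_mixedT,
    trace_mixed_of_isSymm (x.isSymm_G p) (x.isUnit_det_G p) (x.isSymm_G_mul_K p)]
  exact_mod_cast sqrt_trace_mul_self_le hB h

lemma sqrt_trace_smul_κ_le (hB : 0 ≤ B) (h : ∀ a b, |x.κ p a b| ≤ B) {b : ℝ}
    (hb : |b| = x.a⁻¹) : √((b • x.κ p) * (b • x.κ p)).trace ≤ 3 * (B * x.a⁻¹) := by
  have ha := inv_nonneg.mpr x.a_pos.le
  refine mod_cast sqrt_trace_mul_self_le (mul_nonneg hB ha) fun i j => ?_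
  rw [Matrix.smul_apply, smul_eq_mul, abs_mul, hb, mul_comm]
  exact mul_le_mul_of_nonneg_right (h i j) ha

lemma pnorm_dt_G_le (hB : 0 ≤ B) (h : ∀ a b, |x.κ p a b| ≤ B) :
    pnorm x.G (timeDeriv x.d.T (fun s => covT (resMetric x.d.a x.d.g s)) x.t) p
      ≤ 3 * (B * x.a⁻¹) := by
  have hdt : timeDeriv x.d.T (fun s => covT (resMetric x.d.a x.d.g s)) x.t
      = covT (fun p => x.G p * (x.a⁻¹ • x.κ p)) := by
    funext I J q
    refine (x.d.sol.evol_resMetric x.d.scale x.ht q (J 0) (J 1)).trans ?_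
    rw [covT, Matrix.mul_smul]
    rfl
  rw [hdt, pnorm_covT,
    trace_cov_of_isSymm (x.isSymm_G p) (x.isUnit_det_G p) (x.isSymm_G_mul_κ _ p)]
  exact sqrt_trace_smul_κ_le hB h (abs_of_pos (inv_pos.mpr x.a_pos))

lemma pnorm_dt_Gi_le (hB : 0 ≤ B) (h : ∀ a b, |x.κ p a b| ≤ B) :
    pnorm x.G (timeDeriv x.d.T (fun s => contraT (resInv x.d.a x.d.g s)) x.t) p
      ≤ 3 * (B * x.a⁻¹) := by
  have hdt : timeDeriv x.d.T (fun s => contraT (resInv x.d.a x.d.g s)) x.t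
      = contraT (fun p => (-x.a⁻¹ • x.κ p) * (x.G p)⁻¹) := by
    funext I J q
    refine (x.d.sol.evol_resInv x.d.scale x.ht q (I 0) (I 1)).trans ?_
    rw [contraT, Matrix.smul_mul, ← neg_mul]
    rfl
  rw [hdt, pnorm_contraT,
    trace_contra_of_isSymm (x.isSymm_G p) (x.isUnit_det_G p) (x.isSymm_G_mul_κ _ p)]
  exact sqrt_trace_smul_κ_le hB h (by rw [abs_neg, abs_of_pos (inv_pos.mpr x.a_pos)])

end Slice

end SymmetricTensors

/-! ### Bounds of the sup-norms -/

section SupNorms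

variable {X : Type*} {γ : Gauge X} {h : X → MatrixField} {l m M : ℕ} {s : Finset ℕ}
  {ξ : X → Tensor l m}

lemma Gauge.Small.exists_tensorBound (hξ : ∀ I J, γ.Small M fun x => ξ x I J) :
    ∃ (C : ℝ) (c : ℕ), 0 ≤ C ∧ ∀ᶠ x in γ.l, TensorBound M (ξ x) (C * γ.s x * γ.ρ x ^ c) := by
  obtain ⟨C, c, hC, hbound⟩ := Small.uniform (ι := (Fin l → Fin 3) × (Fin m → Fin 3))
    (f := fun i x => ξ x i.1 i.2) fun i => hξ i.1 i.2
  exact ⟨C, c, hC, hbound.mono fun x hx I J => hx (I, J)⟩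

lemma Gauge.Small.exists_abs_le (hh : ∀ A B, γ.Small M fun x p => h x p A B) :
    ∃ (C : ℝ) (c : ℕ), 0 ≤ C ∧ ∀ᶠ x in γ.l, ∀ p A B,
      |h x p A B| ≤ C * γ.s x * γ.ρ x ^ c := by
  obtain ⟨C, c, hC, hbound⟩ := Small.uniform (ι := Fin 3 × Fin 3)
    (f := fun i x p => h x p i.1 i.2) fun i => hh i.1 i.2
  exact ⟨C, c, hC, hbound.mono fun x hx p A B => (hx (A, B)).abs_le p⟩

lemma Gauge.Small.exists_frameBounded (hh : ∀ A B, γ.one.Small 0 fun x p => h x p A B)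
    (hinv : ∀ A B, γ.one.Small 0 fun x p => (h x p)⁻¹ A B) :
    ∃ (C : ℝ) (c : ℕ), 0 ≤ C ∧ ∀ᶠ x in γ.l, FrameBounded (C * γ.ρ x ^ c) (h x) := by
  obtain ⟨C₁, c₁, hC₁, hbound⟩ := exists_abs_le hh
  obtain ⟨C₂, c₂, hC₂, hbound_inv⟩ := exists_abs_le (h := fun x p => (h x p)⁻¹) hinv
  refine ⟨1 + C₁ + C₂, c₁ + c₂, by positivity, ?_⟩
  simp only [one, mul_one] at hbound hbound_inv
  filter_upwards [hbound, hbound_inv] with x hx hx_inv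
  have hρ := γ.one_le_ρ x
  have hle {C : ℝ} {c : ℕ} (hC : 0 ≤ C) (hC' : C ≤ 1 + C₁ + C₂) (hc : c ≤ c₁ + c₂) :
      C * γ.ρ x ^ c ≤ (1 + C₁ + C₂) * γ.ρ x ^ (c₁ + c₂) :=
    mul_le_mul hC' (pow_le_pow_right₀ hρ hc) (pow_nonneg (zero_le_one.trans hρ) c)
      (hC.trans hC')
  exact ⟨by simpa using hle zero_le_one (by linarith) (Nat.zero_le _),
    fun p A B => (hx p A B).trans (hle hC₁ (by linarith) (Nat.le_add_right _ _)),
    fun p A B => (hx_inv p A B).trans (hle hC₂ (by linarith) (Nat.le_add_left _ _))⟩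

lemma exists_sumSup_le (hh : ∀ A B, γ.one.Small 0 fun x p => h x p A B)
    (hinv : ∀ A B, γ.one.Small 0 fun x p => (h x p)⁻¹ A B)
    (hξ : ∀ I J, γ.Small M fun x => ξ x I J) (hs : ∀ N ∈ s, N ≤ M) :
    ∃ (C : ℝ) (c : ℕ), 0 ≤ C ∧ ∀ᶠ x in γ.l, sumSup (h x) s (ξ x) ≤ C * γ.s x * γ.ρ x ^ c := by
  obtain ⟨H, c, hH, hframe⟩ := Small.exists_frameBounded hh hinv
  obtain ⟨C, c', hC, hbound⟩ := Small.exists_tensorBound hξ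
  refine ⟨sumFactor l m s * (H ^ (l + m) * C), c * (l + m) + c',
    mul_nonneg (sumFactor_nonneg l m s) (by positivity), ?_⟩
  filter_upwards [hframe, hbound] with x hx hx'
  refine (hx.sumSup_le hs hx').trans (le_of_eq ?_)
  rw [mul_pow, ← pow_mul, pow_add]
  ring

lemma exists_sumSup_St_le (hξ : ∀ I J, γ.Small M fun x => ξ x I J) (hs : ∀ N ∈ s, N ≤ M) :
    ∃ (C : ℝ) (c : ℕ), 0 ≤ C ∧ ∀ᶠ x in γ.l, sumSup St s (ξ x) ≤ C * γ.s x * γ.ρ x ^ c := by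
  obtain ⟨C, c, hC, hbound⟩ := Small.exists_tensorBound hξ
  refine ⟨sumFactor l m s * C, c, mul_nonneg (sumFactor_nonneg l m s) hC, ?_⟩
  filter_upwards [hbound] with x hx
  exact (sumSup_St_le hs hx).trans (le_of_eq (by ring))

lemma exists_sumSupDt_St_le {u : Datum → ℝ → Tensor l m}
    (hu : ∀ d I J, SlabC (M + 1) d.T (fun t => u d t I J))
    (hrate : ∀ I J, ∃ E : Slice → S3 → ℝ, crude.Small M E ∧
      ∀ x p, dt x.d.T (fun s => u x.d s I J p) x.t = x.r * E x p) (hs : ∀ N ∈ s, N ≤ M) :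
    ∃ (C : ℝ) (c : ℕ), 0 ≤ C ∧ ∀ᶠ x in smallParam,
      sumSupDt x.d.T St s (u x.d) x.t
        ≤ C * x.d.ε * (x.r * Real.exp (x.d.σ * x.τ) ^ c) := by
  choose E hE hrate using hrate
  obtain ⟨C, c, hC, hbound⟩ := Small.exists_tensorBound (ξ := fun x I J => E I J x) hE
  refine ⟨sumFactor l m s * C, c, mul_nonneg (sumFactor_nonneg l m s) hC, ?_⟩
  filter_upwards [hbound] with x hx
  have hdt : TensorBound M (timeDeriv x.d.T (u x.d) x.t)
      (x.r * (C * x.d.ε * Real.exp (x.d.σ * x.τ) ^ c)) := fun I J => by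
    have hfun : timeDeriv x.d.T (u x.d) x.t I J = fun p => x.r * E I J x p :=
      funext fun p => hrate I J x p
    rw [hfun]
    exact ((hx I J).const_mul x.r).mono (le_of_eq (by rw [abs_of_pos x.r_pos]; rfl))
  exact (sumSupDt_St_le (hu x.d) x.ht hs hdt).trans (le_of_eq (by ring))

end SupNorms

/-! ### Conversion to powers of the scale factor -/

lemma Slice.mul_exp_pow_le (x : Slice) {θ C K s : ℝ} {c : ℕ} (hθ : 0 ≤ θ) (hθ1 : θ ≤ 1)
    (hC : 0 ≤ C) (hs : 0 ≤ s) (hc : (c : ℝ) ≤ K) (hCK : C * Real.exp (2 * c) ≤ K) :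
    C * s * Real.exp (θ * x.τ) ^ c ≤ K * s * x.a ^ (-(K * θ)) := by
  have hexp : Real.exp (2 * (c * θ)) ≤ Real.exp (2 * c) := Real.exp_le_exp.mpr
    (mul_le_mul_of_nonneg_left (mul_le_of_le_one_right c.cast_nonneg hθ1) zero_le_two)
  have hrpow : x.a ^ (-(c * θ)) ≤ x.a ^ (-(K * θ)) :=
    Real.rpow_le_rpow_of_exponent_ge x.a_pos x.a_le_one
      (neg_le_neg (mul_le_mul_of_nonneg_right hc hθ))
  have ha (e : ℝ) : 0 ≤ x.a ^ e := Real.rpow_nonneg x.a_pos.le e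
  calc C * s * Real.exp (θ * x.τ) ^ c = C * s * Real.exp (c * θ * x.τ) := by
        rw [← Real.exp_nat_mul, mul_assoc (c : ℝ)]
    _ ≤ C * s * (Real.exp (2 * (c * θ)) * x.a ^ (-(c * θ))) := mul_le_mul_of_nonneg_left
        (x.d.scale.exp_mul_logTime_le x.ht (mul_nonneg c.cast_nonneg hθ)) (mul_nonneg hC hs)
    _ ≤ C * s * (Real.exp (2 * c) * x.a ^ (-(K * θ))) := mul_le_mul_of_nonneg_left
        (mul_le_mul hexp hrpow (ha _) (Real.exp_pos _).le) (mul_nonneg hC hs)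
    _ = C * Real.exp (2 * c) * s * x.a ^ (-(K * θ)) := by ring
    _ ≤ K * s * x.a ^ (-(K * θ)) :=
        mul_le_mul_of_nonneg_right (mul_le_mul_of_nonneg_right hCK hs) (ha _)

section Conversion

variable {f s : Slice → ℝ}

lemma eventually_le_rpow (hs : ∀ x, 0 ≤ s x) (h : ∃ (C : ℝ) (c : ℕ), 0 ≤ C ∧
      ∀ᶠ x in smallParam, f x ≤ C * s x * Real.exp (Real.sqrt x.d.ε * x.τ) ^ c) :
    ∀ᶠ K in atTop, ∀ᶠ x in smallParam, f x ≤ K * s x * x.a ^ (-K * Real.sqrt x.d.ε) := by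
  obtain ⟨C, c, hC, h⟩ := h
  filter_upwards [eventually_ge_atTop (c : ℝ), eventually_ge_atTop (C * Real.exp (2 * c))]
    with K hc hCK
  filter_upwards [h] with x hx
  rw [neg_mul]
  exact hx.trans (x.mul_exp_pow_le x.d.sqrt_pos.le x.d.sqrt_le_one hC (hs x) hc hCK)

lemma eventually_le_rpow_third (h : ∃ (C : ℝ) (c : ℕ), 0 ≤ C ∧ ∀ᶠ x in smallParam,
      f x ≤ C * x.d.ε * (x.r * Real.exp (x.d.σ * x.τ) ^ c)) :
    ∀ᶠ K in atTop, ∀ᶠ x in smallParam, f x ≤ K * x.d.ε * x.a ^ (1 / 3 - K * x.d.σ) := by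
  obtain ⟨C, c, hC, h⟩ := h
  filter_upwards [eventually_ge_atTop (c : ℝ), eventually_ge_atTop (C * Real.exp (2 * c))]
    with K hc hCK
  filter_upwards [h] with x hx
  calc f x ≤ x.r * (C * x.d.ε * Real.exp (x.d.σ * x.τ) ^ c) := hx.trans (le_of_eq (by ring))
    _ ≤ x.r * (K * x.d.ε * x.a ^ (-(K * x.d.σ))) := mul_le_mul_of_nonneg_left
        (x.mul_exp_pow_le x.d.σ_pos.le x.d.σ_le_one hC x.d.ε_pos.le hc hCK) x.r_pos.le
    _ = K * x.d.ε * (x.a ^ (1 / 3 : ℝ) * x.a ^ (-(K * x.d.σ))) := mul_left_comm _ _ _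
    _ = K * x.d.ε * x.a ^ (1 / 3 - K * x.d.σ) := by rw [← Real.rpow_add x.a_pos, ← sub_eq_add_neg]

lemma eventually_le_mul (hs : ∀ x, 0 ≤ s x) (h : ∃ C, ∀ᶠ x in smallParam, f x ≤ C * s x) :
    ∀ᶠ K in atTop, ∀ᶠ x in smallParam, f x ≤ K * s x := by
  obtain ⟨C, h⟩ := h
  filter_upwards [eventually_ge_atTop C] with K hK
  filter_upwards [h] with x hx
  exact hx.trans (mul_le_mul_of_nonneg_right hK (hs x))

lemma eventually_le_mul_ε (h : ∃ (C : ℝ) (c : ℕ), 0 ≤ C ∧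
      ∀ᶠ x in smallParam, f x ≤ C * x.d.ε * 1 ^ c) :
    ∀ᶠ K in atTop, ∀ᶠ x in smallParam, f x ≤ K * x.d.ε := by
  obtain ⟨C, c, -, h⟩ := h
  exact eventually_le_mul (fun x => x.d.ε_pos.le) ⟨C, by simpa using h⟩

end Conversion

/-! ### The strong sup-norm estimates -/

section StrongEstimates

variable {M l m : ℕ} {ξ : Slice → Tensor l m}

lemma sharp_one_G (A B : Fin 3) : sharp.one.Small 0 fun x p => x.G p A B :=
  (sharp_G A B).bdd.of_le (Nat.zero_le _)

lemma sharp_one_Gi (A B : Fin 3) : sharp.one.Small 0 fun x p => (x.G p)⁻¹ A B :=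
  (sharp_Gi A B).bdd.of_le (Nat.zero_le _)

lemma eventually_sumSup_St_of_sharp (hξ : ∀ I J, sharp.Small M fun x => ξ x I J) :
    ∀ᶠ K in atTop, ∀ᶠ x in smallParam, sumSup St (Finset.Icc 0 M) (ξ x)
      ≤ K * Real.sqrt x.d.ε * x.a ^ (-K * Real.sqrt x.d.ε) :=
  eventually_le_rpow (fun x => x.d.sqrt_pos.le)
    (exists_sumSup_St_le hξ fun _ hN => (Finset.mem_Icc.mp hN).2)

lemma eventually_sumSup_of_sharp (hξ : ∀ I J, sharp.Small M fun x => ξ x I J) :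
    ∀ᶠ K in atTop, ∀ᶠ x in smallParam, sumSup x.G (Finset.Icc 0 M) (ξ x)
      ≤ K * Real.sqrt x.d.ε * x.a ^ (-K * Real.sqrt x.d.ε) :=
  eventually_le_rpow (fun x => x.d.sqrt_pos.le)
    (exists_sumSup_le sharp_one_G sharp_one_Gi hξ fun _ hN => (Finset.mem_Icc.mp hN).2)

lemma eventually_sumSup_St_of_lossless (hξ : ∀ I J, lossless.Small M fun x => ξ x I J) :
    ∀ᶠ K in atTop, ∀ᶠ x in smallParam, sumSup St (Finset.Icc 0 M) (ξ x) ≤ K * x.d.ε :=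
  eventually_le_mul_ε (exists_sumSup_St_le hξ fun _ hN => (Finset.mem_Icc.mp hN).2)

lemma eventually_sumSup_St_G : ∀ᶠ K in atTop, ∀ᶠ x in smallParam,
    sumSup St (Finset.Icc 0 10) (covT (x.G - St))
      ≤ K * Real.sqrt x.d.ε * x.a ^ (-K * Real.sqrt x.d.ε) :=
  eventually_sumSup_St_of_sharp fun _ J => sharp_G (J 0) (J 1)

lemma eventually_sumSup_St_Gi : ∀ᶠ K in atTop, ∀ᶠ x in smallParam,
    sumSup St (Finset.Icc 0 10) (contraT (x.Gi - St))
      ≤ K * Real.sqrt x.d.ε * x.a ^ (-K * Real.sqrt x.d.ε) :=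
  eventually_sumSup_St_of_sharp fun I _ => sharp_Gi (I 0) (I 1)

lemma eventually_sumSup_G : ∀ᶠ K in atTop, ∀ᶠ x in smallParam,
    sumSup x.G (Finset.Icc 0 10) (covT (x.G - St))
      ≤ K * Real.sqrt x.d.ε * x.a ^ (-K * Real.sqrt x.d.ε) :=
  eventually_sumSup_of_sharp fun _ J => sharp_G (J 0) (J 1)

lemma eventually_sumSup_Gi : ∀ᶠ K in atTop, ∀ᶠ x in smallParam,
    sumSup x.G (Finset.Icc 0 10) (contraT (x.Gi - St))
      ≤ K * Real.sqrt x.d.ε * x.a ^ (-K * Real.sqrt x.d.ε) :=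
  eventually_sumSup_of_sharp fun I _ => sharp_Gi (I 0) (I 1)

lemma eventually_supNorm_of_abs_κ {F : Slice → Tensor l m}
    (hF : ∀ x B, 0 ≤ B → ∀ p, (∀ A A', |x.κ p A A'| ≤ B) →
      pnorm x.G (F x) p ≤ 3 * (B * x.a⁻¹)) :
    ∀ᶠ K in atTop, ∀ᶠ x in smallParam, supNorm x.G (F x) ≤ K * x.d.ε * x.a ^ (-1 : ℝ) := by
  obtain ⟨C, hC, hκ⟩ := exists_derivBound_κ
  simp only [mul_assoc]
  refine eventually_le_mul (fun x => mul_nonneg x.d.ε_pos.le (Real.rpow_nonneg x.a_pos.le _))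
    ⟨3 * C, hκ.mono fun x hx => supNorm_le fun p => ?_⟩
  refine (hF x _ (mul_nonneg hC x.d.ε_pos.le) p fun A B => (hx A B).abs_le p).trans
    (le_of_eq ?_)
  rw [Real.rpow_neg_one]
  ring

lemma eventually_supNorm_dt_G : ∀ᶠ K in atTop, ∀ᶠ x in smallParam,
    supNorm x.G (timeDeriv x.d.T (fun s => covT (resMetric x.d.a x.d.g s)) x.t)
      ≤ K * x.d.ε * x.a ^ (-1 : ℝ) :=
  eventually_supNorm_of_abs_κ fun _ _ hB _ => Slice.pnorm_dt_G_le hB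

lemma eventually_supNorm_dt_Gi : ∀ᶠ K in atTop, ∀ᶠ x in smallParam,
    supNorm x.G (timeDeriv x.d.T (fun s => contraT (resInv x.d.a x.d.g s)) x.t)
      ≤ K * x.d.ε * x.a ^ (-1 : ℝ) :=
  eventually_supNorm_of_abs_κ fun _ _ hB _ => Slice.pnorm_dt_Gi_le hB

lemma eventually_sumSup_St_K : ∀ᶠ K in atTop, ∀ᶠ x in smallParam,
    sumSup St (Finset.Icc 0 10) (mixedT x.K) ≤ K * x.d.ε :=
  eventually_sumSup_St_of_lossless fun I J => lossless_K (I 0) (J 0)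

lemma eventually_sumSupDt_St_K : ∀ᶠ K in atTop, ∀ᶠ x in smallParam,
    sumSupDt x.d.T St (Finset.Icc 0 10) (fun s => mixedT (resK x.d.a x.d.k s)) x.t
      ≤ K * x.d.ε * x.a ^ (1 / 3 - K * x.d.σ) :=
  eventually_le_rpow_third (exists_sumSupDt_St_le (u := fun d s => mixedT (resK d.a d.k s))
    (fun d I J => (d.sol.slabC_resK d.scale (I 0) (J 0)).of_le (by norm_num))
    (fun I J => exists_crude_rate_K (I 0) (J 0)) fun _ hN => (Finset.mem_Icc.mp hN).2)

lemma eventually_supNorm_K : ∀ᶠ K in atTop, ∀ᶠ x in smallParam,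
    supNorm x.G (mixedT x.K) ≤ K * x.d.ε := by
  obtain ⟨C, c, hC, hK⟩ := Small.exists_abs_le lossless_K
  simp only [lossless, one_pow, mul_one] at hK
  exact eventually_le_mul (fun x => x.d.ε_pos.le) ⟨3 * C, hK.mono fun x hx => supNorm_le fun p =>
    (Slice.pnorm_K_le (mul_nonneg hC x.d.ε_pos.le) (hx p)).trans_eq (mul_assoc _ _ _).symm⟩

lemma eventually_sumSup_K : ∀ᶠ K in atTop, ∀ᶠ x in smallParam,
    sumSup x.G (Finset.Icc 1 10) (mixedT x.K)
      ≤ K * x.d.ε * x.a ^ (-K * Real.sqrt x.d.ε) :=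
  eventually_le_rpow (fun x => x.d.ε_pos.le) (exists_sumSup_le (γ := sharpSmall) sharp_one_G
    sharp_one_Gi (fun I J => (lossless_K (I 0) (J 0)).sharpSmall_of_lossless)
    fun _ hN => (Finset.mem_Icc.mp hN).2)

lemma eventually_sumSup_St_Ψ : ∀ᶠ K in atTop, ∀ᶠ x in smallParam,
    sumSup St (Finset.Icc 0 10) (scalarT x.Ψ) ≤ K * x.d.ε :=
  eventually_sumSup_St_of_lossless fun _ _ => lossless_Ψ

lemma eventually_sumSupDt_St_Ψ : ∀ᶠ K in atTop, ∀ᶠ x in smallParam,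
    sumSupDt x.d.T St (Finset.Icc 0 10)
        (fun s => scalarT (timeScalar x.d.T x.d.a x.d.n x.d.φ s)) x.t
      ≤ K * x.d.ε * x.a ^ (1 / 3 - K * x.d.σ) :=
  eventually_le_rpow_third (exists_sumSupDt_St_le
    (u := fun d s => scalarT (timeScalar d.T d.a d.n d.φ s))
    (fun d _ _ => (d.sol.slabC_timeScalar d.scale).of_le (by norm_num))
    (fun _ _ => exists_crude_rate_Ψ) fun _ hN => (Finset.mem_Icc.mp hN).2)

lemma eventually_sumSup_dT : ∀ᶠ K in atTop, ∀ᶠ x in smallParam,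
    sumSup x.G (Finset.Icc 0 9) (dT (x.d.φ x.t))
      ≤ K * Real.sqrt x.d.ε * x.a ^ (-K * Real.sqrt x.d.ε) :=
  eventually_sumSup_of_sharp fun _ J => sharp_dT (J 0)

lemma eventually_sumSup_St_ν : ∀ᶠ K in atTop, ∀ᶠ x in smallParam,
    sumSup St (Finset.Icc 0 8) (scalarT x.ν)
      ≤ K * Real.sqrt x.d.ε * x.a ^ (-K * Real.sqrt x.d.ε) :=
  eventually_sumSup_St_of_sharp fun _ _ => sharp_ν

lemma eventually_sumSup_RicSharp : ∀ᶠ K in atTop, ∀ᶠ x in smallParam,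
    sumSup x.G (Finset.Icc 0 8) (mixedT fun p => RicSharp x.G p - (2 / 9 : ℝ) • 1)
      ≤ K * Real.sqrt x.d.ε * x.a ^ (-K * Real.sqrt x.d.ε) :=
  eventually_sumSup_of_sharp fun I J => sharp_RicSharp (I 0) (J 0)

end StrongEstimates

end

end EinsteinScalar

theorem proposition14p3 :
    ∃ ε₀ σ₀ C c : ℝ, 0 < ε₀ ∧ 0 < σ₀ ∧ 0 < C ∧ 0 < c ∧
      ∀ (ε σ T : ℝ) (a : ℝ → ℝ) (g k : ℝ → MatrixField) (n φ : ℝ → S3 → ℝ),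
        0 < ε → ε ≤ ε₀ → Real.sqrt ε ≤ σ → σ ≤ σ₀ → 0 < T →
        IsScaleFactor T a →
        IsSolution T a g k n φ →
        highNorm T a g k n φ 0 ≤ ε ^ 2 →
        (∀ t ∈ Set.Ico 0 T, highNorm T a g k n φ t ≤ ε * a t ^ (-σ)) →
        ∀ t ∈ Set.Ico 0 T,
          sumSup St (Finset.Icc 0 10) (covT (resMetric a g t - St))
            ≤ C * Real.sqrt ε * a t ^ (-c * Real.sqrt ε) ∧
          sumSup St (Finset.Icc 0 10) (contraT (resInv a g t - St))
            ≤ C * Real.sqrt ε * a t ^ (-c * Real.sqrt ε) ∧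
          sumSup (resMetric a g t) (Finset.Icc 0 10) (covT (resMetric a g t - St))
            ≤ C * Real.sqrt ε * a t ^ (-c * Real.sqrt ε) ∧
          sumSup (resMetric a g t) (Finset.Icc 0 10) (contraT (resInv a g t - St))
            ≤ C * Real.sqrt ε * a t ^ (-c * Real.sqrt ε) ∧
          supNorm (resMetric a g t) (timeDeriv T (fun s => covT (resMetric a g s)) t)
            ≤ C * ε * a t ^ (-1 : ℝ) ∧
          supNorm (resMetric a g t) (timeDeriv T (fun s => contraT (resInv a g s)) t)
            ≤ C * ε * a t ^ (-1 : ℝ) ∧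
          sumSup St (Finset.Icc 0 10) (mixedT (resK a k t)) ≤ C * ε ∧
          sumSupDt T St (Finset.Icc 0 10) (fun s => mixedT (resK a k s)) t
            ≤ C * ε * a t ^ (1 / 3 - c * σ) ∧
          supNorm (resMetric a g t) (mixedT (resK a k t)) ≤ C * ε ∧
          sumSup (resMetric a g t) (Finset.Icc 1 10) (mixedT (resK a k t))
            ≤ C * ε * a t ^ (-c * Real.sqrt ε) ∧
          sumSup St (Finset.Icc 0 10) (scalarT (timeScalar T a n φ t)) ≤ C * ε ∧
          sumSupDt T St (Finset.Icc 0 10) (fun s => scalarT (timeScalar T a n φ s)) t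
            ≤ C * ε * a t ^ (1 / 3 - c * σ) ∧
          sumSup (resMetric a g t) (Finset.Icc 0 9) (dT (φ t))
            ≤ C * Real.sqrt ε * a t ^ (-c * Real.sqrt ε) ∧
          sumSup St (Finset.Icc 0 8) (scalarT (resLapse a n t))
            ≤ C * Real.sqrt ε * a t ^ (-c * Real.sqrt ε) ∧
          sumSup (resMetric a g t) (Finset.Icc 0 8)
              (mixedT (fun p => RicSharp (resMetric a g t) p - (2 / 9 : ℝ) • 1))
            ≤ C * Real.sqrt ε * a t ^ (-c * Real.sqrt ε) := by
  have hall := eventually_sumSup_St_G.and <| eventually_sumSup_St_Gi.and <|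
    eventually_sumSup_G.and <| eventually_sumSup_Gi.and <|
    eventually_supNorm_dt_G.and <| eventually_supNorm_dt_Gi.and <|
    eventually_sumSup_St_K.and <| eventually_sumSupDt_St_K.and <|
    eventually_supNorm_K.and <| eventually_sumSup_K.and <|
    eventually_sumSup_St_Ψ.and <| eventually_sumSupDt_St_Ψ.and <|
    eventually_sumSup_dT.and <| eventually_sumSup_St_ν.and eventually_sumSup_RicSharp
  simp only [← Filter.eventually_and] at hall
  obtain ⟨K, hK, hslice⟩ := ((Filter.eventually_gt_atTop (0 : ℝ)).and hall).exists
  obtain ⟨δ, hδ, hbounds⟩ := eventually_smallParam.mp hslice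
  refine ⟨1, min 1 (δ / 2), K, K, one_pos, by positivity, hK, hK, ?_⟩
  intro ε σ T a g k n φ hε _ hεσ hσ hT ha hsol hinit hboot t ht
  let d : Datum := ⟨ε, σ, T, a, g, k, n, φ, hε, hεσ, hσ.trans (min_le_left _ _), hT, ha, hsol,
    hinit, hboot⟩
  exact hbounds ⟨d, t, ht⟩ ((hσ.trans (min_le_right _ _)).trans_lt (half_lt_self hδ))
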